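/- Let $(G,X)$ be a Shimura datum with $G$ semisimple of adjoint type, and let $V$ be a faithful finite-dimensional rational representation of $G$, through which $G$ is viewed as a closed algebraic subgroup of $\mathrm{GL}(V)$ over $\mathbb{Q}$. For $h\colon \mathbb{S}=\mathrm{Res}_{\mathbb{C}/\mathbb{R}}\mathbb{G}_m\to G_{\mathbb{R}}$ in $X$, the Mumford–Tate group $M$ of $h$ is the smallest algebraic subgroup $H$ of $\mathrm{GL}(V)$ over $\mathbb{Q}$ such that $h$ factors through $H_{\mathbb{R}}$; $h$ is called special if $M$ is a torus. For special $h$, let $L\subset\mathbb{C}$ be the splitting field of $M$ (the smallest number field over which $M$ becomes a split torus, which is Galois over $\mathbb{Q}$) with ring of integers $O_L$, and let $T=\mathrm{Res}_{L/\mathbb{Q}}\mathbb{G}_{m}$. The cocharacter $\mu=h_{\mathbb{C}}(z,1)$ of $M_{\mathbb{C}}$ is defined over $L$, and the reciprocity morphism $r\colon T\to M$ attached to $h$ is the composite of $\mathrm{Res}_{L/\mathbb{Q}}\mu\colon T\to \mathrm{Res}_{L/\mathbb{Q}}M_L$ with the norm $\mathrm{Res}_{L/\mathbb{Q}}M_L\to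 M$. Then there is a real number $e>0$ (depending only on $G$, $X$ and $V$) such that for every special $h\in X$, with $M$, $L$ and $r$ as above, and for every prime $p$: 1. the index of $r((\mathbb{Q}_p\otimes L)^*)$ in $M(\mathbb{Q}_p)$ is finite and at most $e$; 2. $r((\mathbb{Z}_p\otimes O_L)^*)$ is contained in the maximal compact open subgroup of $M(\mathbb{Q}_p)$, and its index there is finite and at most $e$. -/

import Mathlib

open scoped TensorProduct

namespace ShimuraTorus

/-- The `R`-valued matrices in `GL_n` at which all polynomials of `E` vanish. -/
def solutions {n : ℕ} (E : Set (MvPolynomial (Fin n × Fin n) ℚ))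
    (R : Type) [CommRing R] [Algebra ℚ R] : Set (GL (Fin n) R) :=
  {g | ∀ f ∈ E, MvPolynomial.aeval (fun ij : Fin n × Fin n => (g : Matrix (Fin n) (Fin n) R) ij.1 ij.2) f = 0}

/-- A closed algebraic subgroup of `GL_n` over `ℚ`: a closed subscheme, cut out by polynomials
in the matrix entries, whose points in every commutative `ℚ`-algebra form a subgroup. -/
structure AlgSubgroup (n : ℕ) where
  eqns : Set (MvPolynomial (Fin n × Fin n) ℚ)
  one_mem : ∀ (R : Type) [CommRing R] [Algebra ℚ R], (1 : GL (Fin n) R) ∈ solutions eqns R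
  mul_mem : ∀ (R : Type) [CommRing R] [Algebra ℚ R] (a b : GL (Fin n) R),
    a ∈ solutions eqns R → b ∈ solutions eqns R → a * b ∈ solutions eqns R
  inv_mem : ∀ (R : Type) [CommRing R] [Algebra ℚ R] (a : GL (Fin n) R),
    a ∈ solutions eqns R → a⁻¹ ∈ solutions eqns R

namespace AlgSubgroup

variable {n : ℕ}

/-- The group `G(R)`. -/
def points (G : AlgSubgroup n) (R : Type) [CommRing R] [Algebra ℚ R] :
    Subgroup (GL (Fin n) R) where
  carrier := solutions G.eqns R
  one_mem' := G.one_mem R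
  mul_mem' := fun {a b} ha hb => G.mul_mem R a b ha hb
  inv_mem' := fun {a} ha => G.inv_mem R a ha

/-- `H` is contained in `G` as a subscheme. -/
def Le (H G : AlgSubgroup n) : Prop :=
  ∀ (R : Type) [CommRing R] [Algebra ℚ R], H.points R ≤ G.points R

def IsTrivial (H : AlgSubgroup n) : Prop :=
  ∀ (R : Type) [CommRing R] [Algebra ℚ R], H.points R = ⊥

/-- `N` is normalised by `G`. -/
def NormalisedBy (N G : AlgSubgroup n) : Prop :=
  ∀ (R : Type) [CommRing R] [Algebra ℚ R], ∀ g ∈ G.points R, ∀ x ∈ N.points R,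
    g * x * g⁻¹ ∈ N.points R

/-- `Z` is centralised by `G`. -/
def CentralisedBy (Z G : AlgSubgroup n) : Prop :=
  ∀ (R : Type) [CommRing R] [Algebra ℚ R], ∀ g ∈ G.points R, ∀ x ∈ Z.points R, g * x = x * g

/-- An algebraic group is connected when it has no proper closed subgroup of finite index
(the identity component is such a subgroup, defined over `ℚ`). -/
def IsConnected (G : AlgSubgroup n) : Prop :=
  ∀ H : AlgSubgroup n, H.Le G → (H.points ℂ).relIndex (G.points ℂ) ≠ 0 → G.Le H

/-- Semisimple: connected, and the radical is trivial. -/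
def IsSemisimple (G : AlgSubgroup n) : Prop :=
  G.IsConnected ∧ ∀ N : AlgSubgroup n, N.Le G → N.NormalisedBy G → N.IsConnected →
    Group.IsSolvable (N.points ℂ) → N.IsTrivial

/-- The (scheme-theoretic) centre is trivial; for a semisimple group this is being of
adjoint type. -/
def HasTrivialCentre (G : AlgSubgroup n) : Prop :=
  ∀ Z : AlgSubgroup n, Z.Le G → Z.CentralisedBy G → Z.IsTrivial

/-- The Lie algebra of `G_ℂ`: the matrices `Y` with `1 + ε Y ∈ G(ℂ[ε])`. -/
def lieComplex (G : AlgSubgroup n) : Set (Matrix (Fin n) (Fin n) ℂ) :=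
  {Y | ∃ g ∈ G.points (DualNumber ℂ), ∀ i j,
    (g : Matrix (Fin n) (Fin n) (DualNumber ℂ)) i j =
      TrivSqZeroExt.inl ((1 : Matrix (Fin n) (Fin n) ℂ) i j) + TrivSqZeroExt.inr (Y i j)}

/-- `M_k` is isomorphic, as an algebraic group over `k`, to a power of the multiplicative
group. (A `k`-algebra has exactly one structure of `ℚ`-algebra.) -/
def SplitsOver (M : AlgSubgroup n) (k : Type) [Field k] [CharZero k] : Prop :=
  ∃ (d : ℕ) (φ : ∀ (B : Type) [CommRing B] [Algebra ℚ B] [Algebra k B],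
      (Fin d → Bˣ) ≃* M.points B),
    ∀ (B C : Type) [CommRing B] [Algebra ℚ B] [Algebra k B]
      [CommRing C] [Algebra ℚ C] [Algebra k C] (f : B →ₐ[k] C) (u : Fin d → Bˣ),
      ((φ C fun i => Units.map (f : B →* C) (u i) : M.points C) : GL (Fin n) C) =
        Matrix.GeneralLinearGroup.map (f : B →+* C) (φ B u : M.points B)

/-- `M` is a torus over `ℚ`. -/
def IsTorus (M : AlgSubgroup n) : Prop := M.SplitsOver (AlgebraicClosure ℚ)

/-- `L` is the splitting field of `M` in `ℂ`: the smallest number field over which `M` is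
isomorphic to a power of the multiplicative group. -/
def IsSplittingField (M : AlgSubgroup n) (L : IntermediateField ℚ ℂ) : Prop :=
  IsLeast {E : IntermediateField ℚ ℂ | FiniteDimensional ℚ E ∧ M.SplitsOver E} L

end AlgSubgroup

/-- A morphism of real algebraic groups `h : 𝕊 → GL_{n,ℝ}`, where `𝕊 = Res_{ℂ/ℝ} 𝔾ₘ`, as a
morphism of functors: `𝕊(A) = (ℂ ⊗ A)ˣ` for every commutative `ℝ`-algebra `A`. -/
@[ext]
structure DeligneHom (n : ℕ) where
  app : ∀ (A : Type) [CommRing A] [Algebra ℝ A], (ℂ ⊗[ℝ] A)ˣ →* GL (Fin n) A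
  natural : ∀ (A B : Type) [CommRing A] [Algebra ℝ A] [CommRing B] [Algebra ℝ B]
    (f : A →ₐ[ℝ] B) (s : (ℂ ⊗[ℝ] A)ˣ),
    app B (Units.map (Algebra.TensorProduct.map (AlgHom.id ℝ ℂ) f : ℂ ⊗[ℝ] A →* ℂ ⊗[ℝ] B) s) =
      Matrix.GeneralLinearGroup.map (f : A →+* B) (app A s)

namespace DeligneHom

variable {n : ℕ}

/-- `h` factors through `H_ℝ`. -/
def FactorsThrough (h : DeligneHom n) (H : AlgSubgroup n) : Prop :=
  ∀ (A : Type) [CommRing A] [Algebra ℚ A] [Algebra ℝ A] (s : (ℂ ⊗[ℝ] A)ˣ),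
    h.app A s ∈ H.points A

/-- `h' = g h g⁻¹`. -/
def IsConjBy (g : GL (Fin n) ℝ) (h h' : DeligneHom n) : Prop :=
  ∀ (A : Type) [CommRing A] [Algebra ℝ A] (s : (ℂ ⊗[ℝ] A)ˣ),
    h'.app A s = Matrix.GeneralLinearGroup.map (algebraMap ℝ A) g * h.app A s *
      (Matrix.GeneralLinearGroup.map (algebraMap ℝ A) g)⁻¹

/-- The map `h : ℂˣ = 𝕊(ℝ) → GL_n(ℝ)` on real points. -/
noncomputable def onReal (h : DeligneHom n) (w : ℂˣ) : GL (Fin n) ℝ :=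
  h.app ℝ (Units.map (Algebra.TensorProduct.includeLeftRingHom : ℂ →+* ℂ ⊗[ℝ] ℝ) w)

/-- The real matrix `h(w)`, viewed in `GL_n(ℂ)`. -/
noncomputable def onRealC (h : DeligneHom n) (w : ℂˣ) : GL (Fin n) ℂ :=
  Matrix.GeneralLinearGroup.map Complex.ofRealHom (h.onReal w)

/-- The Mumford–Tate group of `h`: the smallest algebraic subgroup `H` of `GL_n` over `ℚ` such
that `h` factors through `H_ℝ`, that is, the intersection of all of these. -/
def mumfordTate (h : DeligneHom n) : AlgSubgroup n where
  eqns := {f | ∃ H : AlgSubgroup n, h.FactorsThrough H ∧ f ∈ H.eqns}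
  one_mem := by
    rintro R _ _ f ⟨H, -, hf⟩
    exact H.one_mem R f hf
  mul_mem := by
    rintro R _ _ a b ha hb f ⟨H, hH, hf⟩
    exact H.mul_mem R a b (fun f' hf' => ha f' ⟨H, hH, hf'⟩) (fun f' hf' => hb f' ⟨H, hH, hf'⟩) f hf
  inv_mem := by
    rintro R _ _ a ha f ⟨H, hH, hf⟩
    exact H.inv_mem R a (fun f' hf' => ha f' ⟨H, hH, hf'⟩) f hf

theorem factorsThrough_mumfordTate (h : DeligneHom n) : h.FactorsThrough h.mumfordTate := by
  rintro A _ _ _ s f ⟨H, hH, hf⟩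
  exact hH A s f hf

theorem mumfordTate_le (h : DeligneHom n) {H : AlgSubgroup n} (hH : h.FactorsThrough H) :
    h.mumfordTate.Le H :=
  fun _ _ _ _ hg f hf => hg f ⟨H, hH, hf⟩

/-- `h` is special when its Mumford–Tate group is a torus. -/
def IsSpecial (h : DeligneHom n) : Prop := h.mumfordTate.IsTorus

end DeligneHom

/-- `(G, X)` is a Shimura datum with `G` semisimple of adjoint type (so that `G` is its own
adjoint group in Deligne's axioms). -/
structure IsAdjointShimuraDatum {n : ℕ} (G : AlgSubgroup n) (X : Set (DeligneHom n)) : Prop where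
  semisimple : G.IsSemisimple
  adjoint : G.HasTrivialCentre
  /-- `X` is a `G(ℝ)`-conjugacy class of morphisms `𝕊 → G_ℝ`. -/
  conjClass : ∃ h₀ : DeligneHom n, h₀.FactorsThrough G ∧
    ∀ h : DeligneHom n, h ∈ X ↔ ∃ g ∈ G.points ℝ, DeligneHom.IsConjBy g h₀ h
  /-- The Hodge structure on `Lie G` has type `(-1,1), (0,0), (1,-1)`. -/
  hodgeType : ∀ h ∈ X, ∀ Y ∈ G.lieComplex,
    ∃ Y₁ ∈ G.lieComplex, ∃ Y₀ ∈ G.lieComplex, ∃ Y₂ ∈ G.lieComplex, Y = Y₁ + Y₀ + Y₂ ∧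
      ∀ w : ℂˣ,
        (h.onRealC w).val * Y₁ * (h.onRealC w)⁻¹.val = ((w : ℂ) / starRingEnd ℂ w) • Y₁ ∧
        (h.onRealC w).val * Y₀ * (h.onRealC w)⁻¹.val = Y₀ ∧
        (h.onRealC w).val * Y₂ * (h.onRealC w)⁻¹.val = (starRingEnd ℂ w / (w : ℂ)) • Y₂
  /-- `ad h(i)` is a Cartan involution of `G_ℝ`: the real form of `G` that it defines
  is compact. -/
  cartan : ∀ h ∈ X, IsCompact {g : GL (Fin n) ℂ | g ∈ G.points ℂ ∧
    h.onRealC (Units.mk0 Complex.I Complex.I_ne_zero) *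
      Matrix.GeneralLinearGroup.map (starRingEnd ℂ) g *
      (h.onRealC (Units.mk0 Complex.I Complex.I_ne_zero))⁻¹ = g}
  /-- There is no nontrivial quotient `G/N` over `ℚ` on which `h` is trivial. -/
  noFactor : ∀ h ∈ X, ∀ N : AlgSubgroup n, N.Le G → N.NormalisedBy G → h.FactorsThrough N →
    G.Le N

/-- The character `z` of `𝕊_ℂ`, on points in a `ℂ`-algebra `A`: it is induced by
`w ⊗ a ↦ w a`. -/
noncomputable def charZ (A : Type) [CommRing A] [Algebra ℂ A] : ℂ ⊗[ℝ] A →ₐ[ℝ] A :=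
  Algebra.TensorProduct.lift (IsScalarTower.toAlgHom ℝ ℂ A) (AlgHom.id ℝ A)
    (fun _ _ => Commute.all _ _)

/-- The character `z̄` of `𝕊_ℂ`, induced by `w ⊗ a ↦ w̄ a`. -/
noncomputable def charZbar (A : Type) [CommRing A] [Algebra ℂ A] : ℂ ⊗[ℝ] A →ₐ[ℝ] A :=
  Algebra.TensorProduct.lift ((IsScalarTower.toAlgHom ℝ ℂ A).comp Complex.conjAe.toAlgHom)
    (AlgHom.id ℝ A) (fun _ _ => Commute.all _ _)

/-- A cocharacter `𝔾ₘ → GL_n` over the field `k`. -/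
structure Cocharacter (k : Type) [Field k] (n : ℕ) where
  app : ∀ (B : Type) [CommRing B] [Algebra k B], Bˣ →* GL (Fin n) B
  natural : ∀ (B C : Type) [CommRing B] [Algebra k B] [CommRing C] [Algebra k C]
    (f : B →ₐ[k] C) (t : Bˣ),
    app C (Units.map (f : B →* C) t) = Matrix.GeneralLinearGroup.map (f : B →+* C) (app B t)

/-- `μ`, a cocharacter over the subfield `L` of `ℂ`, becomes `h_ℂ(z, 1)` over `ℂ`: in every
`ℂ`-algebra `A`, the point `s` of `𝕊` with coordinates `z(s) = t` and `z̄(s) = 1` has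
`h(s) = μ(t)`. -/
def IsHodgeCocharacter {n : ℕ} (h : DeligneHom n) (L : IntermediateField ℚ ℂ)
    (μ : Cocharacter L n) : Prop :=
  ∀ (A : Type) [CommRing A] [Algebra ℂ A] (s : (ℂ ⊗[ℝ] A)ˣ),
    charZbar A (s : ℂ ⊗[ℝ] A) = 1 →
      h.app A s = μ.app A (Units.map (charZ A : ℂ ⊗[ℝ] A →* A) s)

/-- A morphism of algebraic groups over `ℚ` from the torus `T = Res_{L/ℚ} 𝔾ₘ`, with
`T(R) = (L ⊗ R)ˣ`, to `M`. -/
structure ResHom {n : ℕ} (L : Type) [Field L] [Algebra ℚ L] (M : AlgSubgroup n) where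
  app : ∀ (R : Type) [CommRing R] [Algebra ℚ R], (L ⊗[ℚ] R)ˣ →* M.points R
  natural : ∀ (R R' : Type) [CommRing R] [Algebra ℚ R] [CommRing R'] [Algebra ℚ R']
    (f : R →ₐ[ℚ] R') (t : (L ⊗[ℚ] R)ˣ),
    (app R' (Units.map
        (Algebra.TensorProduct.map (AlgHom.id ℚ L) f : L ⊗[ℚ] R →* L ⊗[ℚ] R') t) :
          GL (Fin n) R') =
      Matrix.GeneralLinearGroup.map (f : R →+* R') (app R t : GL (Fin n) R)

/-- The action of `σ ∈ Gal(L/ℚ)` on `GL_n(L ⊗ R)`. -/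
noncomputable def galAct {n : ℕ} {L : Type} [Field L] [Algebra ℚ L] (R : Type) [CommRing R] [Algebra ℚ R]
    (σ : L ≃ₐ[ℚ] L) : GL (Fin n) (L ⊗[ℚ] R) →* GL (Fin n) (L ⊗[ℚ] R) :=
  Matrix.GeneralLinearGroup.map
    (Algebra.TensorProduct.map σ.toAlgHom (AlgHom.id ℚ R)).toRingHom

/-- The norm `∏ σ(m)` over `σ ∈ Gal(L/ℚ)`. It is applied to points `m` of a torus over `ℚ`, so
that the factors commute and their order does not matter, and to its splitting field `L`,
which is Galois over `ℚ`. -/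
noncomputable def galNorm {n : ℕ} {L : Type} [Field L] [Algebra ℚ L] [FiniteDimensional ℚ L]
    (R : Type) [CommRing R] [Algebra ℚ R] (m : GL (Fin n) (L ⊗[ℚ] R)) :
    GL (Fin n) (L ⊗[ℚ] R) :=
  ((Finset.univ : Finset (L ≃ₐ[ℚ] L)).toList.map fun σ => galAct R σ m).prod

/-- `r` is the reciprocity morphism of `h`: the composite of
`Res μ : Res_{L/ℚ} 𝔾ₘ → Res_{L/ℚ} M_L`, where `μ = h_ℂ(z, 1)` over `L`, with the norm
`Res_{L/ℚ} M_L → M`. -/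
def IsReciprocityMorphism {n : ℕ} (h : DeligneHom n) (L : IntermediateField ℚ ℂ)
    [FiniteDimensional ℚ L] (r : ResHom L h.mumfordTate) : Prop :=
  ∃ μ : Cocharacter L n, IsHodgeCocharacter h L μ ∧
    ∀ (R : Type) [CommRing R] [Algebra ℚ R] (t : (L ⊗[ℚ] R)ˣ),
      Matrix.GeneralLinearGroup.map
          (Algebra.TensorProduct.includeRight : R →ₐ[ℚ] L ⊗[ℚ] R).toRingHom
          (r.app R t : GL (Fin n) R) =
        galNorm R (μ.app (L ⊗[ℚ] R) t)

/-- The natural ring homomorphism `O_L ⊗ ℤ_p → L ⊗ ℚ_p`. -/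
noncomputable def integralToRational (L : Type) [Field L] [Algebra ℚ L] (p : ℕ) [Fact p.Prime] :
    NumberField.RingOfIntegers L ⊗[ℤ] ℤ_[p] →ₐ[ℤ] L ⊗[ℚ] ℚ_[p] :=
  Algebra.TensorProduct.productMap
    ((Algebra.TensorProduct.includeLeftRingHom : L →+* L ⊗[ℚ] ℚ_[p]).comp
      (algebraMap (NumberField.RingOfIntegers L) L)).toIntAlgHom
    (((Algebra.TensorProduct.includeRight : ℚ_[p] →ₐ[ℚ] L ⊗[ℚ] ℚ_[p]).toRingHom).comp
      (PadicInt.Coe.ringHom : ℤ_[p] →+* ℚ_[p])).toIntAlgHom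

/-- The subgroup `(O_L ⊗ ℤ_p)ˣ` of `(L ⊗ ℚ_p)ˣ`. -/
noncomputable def integralUnits (L : Type) [Field L] [Algebra ℚ L] (p : ℕ) [Fact p.Prime] :
    Subgroup (L ⊗[ℚ] ℚ_[p])ˣ :=
  (Units.map (integralToRational L p :
    NumberField.RingOfIntegers L ⊗[ℤ] ℤ_[p] →* L ⊗[ℚ] ℚ_[p])).range

/-- The maximal compact subgroup of `M(ℚ_p)`, for a torus `M`: the compact subgroups of
`M(ℚ_p)` have a greatest element, which is open. -/
noncomputable def maximalCompact {n : ℕ} (M : AlgSubgroup n) (p : ℕ) [Fact p.Prime] :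
    Subgroup (M.points ℚ_[p]) :=
  sSup {K : Subgroup (M.points ℚ_[p]) | IsCompact (K : Set (M.points ℚ_[p]))}

end ShimuraTorus

/-! Let `d` be the rank of the Mumford–Tate torus `M`, `Γ = Gal(L/ℚ)`, and `a ∈ ℤ^d` the coordinates
of `μ` in the cocharacter lattice. The reciprocity morphism has a section up to a bounded power. If
a character `χ` of `M` over `L` satisfies `∑ σ (a ⊗ χ) σ⁻¹ = m` in the endomorphisms of the
cocharacter lattice, then `r (χ x) = x ^ m` for every point `x` of `M` (`reciprocity_section`).
Hence the image of `r` contains all `m`-th powers, and the image of the integral units contains the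
`m`-th powers of integral points. It remains to bound `m` and the index of the `m`-th powers,
uniformly in `h` and `p`.

Bound on `m`. The Galois conjugates of `a` span the cocharacters rationally: the kernel of a
character orthogonal to all of them is a `ℚ`-group through which `h` factors, so it contains `M` and
the character is trivial (`hodge_separating`). If `N` is the matrix of `d` independent conjugates,
Cramer's rule yields `χ` with `m = |Γ| |det N|` (`exists_equivariant_section`). The pairings of the
weights of the representation with the conjugates of `a` are bounded by a constant `C`, because the
exponents of `h` occur already in one fixed member of its conjugacy class (`exists_weight_bound`).
The weights generate the character lattice, so `d` of them form an integral matrix `D` with `det D ≠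
0`, and `|det N| ≤ |det (D Nᵗ)| ≤ d! C^d`. Finally `Γ` acts faithfully on the at most `n` weights,
by minimality of `L`; this bounds `|Γ| = [L : ℚ]` (`card_gal_le`).

Bound on the index. `M(ℚ_p)` is the group of fixed points of a twisted action of `Γ` on `d`-tuples
of units of `L ⊗ ℚ_p`, and its maximal compact subgroup consists of the fixed tuples of integral
units (`mem_range_coord`, `maximalCompact_eq`). On fixed points the index of the `m`-th powers grows
at most by the factor `|m-torsion|^|Γ|` (`relIndex_map_pow_fixed`). For the units themselves there
are two cases (`index_pow_units_le`). If `p ∤ m`, every unit congruent to `1` modulo `p` is an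
`m`-th power and the torsion bounds the index. If `p ∣ m`, then `p ≤ m`, and a congruence subgroup
whose index is bounded in terms of `m` consists of `m`-th powers. -/

namespace ShimuraTorus

/-! ### Characters and monomial homomorphisms of split tori. -/

section Characters

variable {ι κ : Type*} [Fintype ι] [Fintype κ] {A B : Type*} [CommGroup A] [CommGroup B]

/-- The value `∏ uᵢ ^ χᵢ` of the character `χ` at the point `u` of a split torus. -/
def charVal (χ : ι → ℤ) (u : ι → A) : A := ∏ i, u i ^ χ i

@[simp] lemma charVal_zero (u : ι → A) : charVal 0 u = 1 := by simp [charVal]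

lemma charVal_add (χ ψ : ι → ℤ) (u : ι → A) :
    charVal (χ + ψ) u = charVal χ u * charVal ψ u := by
  simp [charVal, zpow_add, Finset.prod_mul_distrib]

lemma charVal_neg (χ : ι → ℤ) (u : ι → A) : charVal (-χ) u = (charVal χ u)⁻¹ := by
  simp [charVal]

lemma charVal_smul (c : ℤ) (χ : ι → ℤ) (u : ι → A) :
    charVal (c • χ) u = charVal χ u ^ c := by
  simp only [charVal, Pi.smul_apply, smul_eq_mul, ← Finset.prod_zpow]
  exact Finset.prod_congr rfl fun i _ => by rw [mul_comm, zpow_mul]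

lemma charVal_sum {τ : Type*} (s : Finset τ) (χ : τ → ι → ℤ) (u : ι → A) :
    charVal (∑ t ∈ s, χ t) u = ∏ t ∈ s, charVal (χ t) u := by
  classical
  induction s using Finset.induction_on with
  | empty => simp
  | insert a s ha ih => rw [Finset.sum_insert ha, Finset.prod_insert ha, charVal_add, ih]

@[simp] lemma charVal_one (χ : ι → ℤ) : charVal χ (1 : ι → A) = 1 := by simp [charVal]

lemma charVal_mul (χ : ι → ℤ) (u v : ι → A) :
    charVal χ (u * v) = charVal χ u * charVal χ v := by
  simp [charVal, mul_zpow, Finset.prod_mul_distrib]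

lemma map_charVal (f : A →* B) (χ : ι → ℤ) (u : ι → A) :
    f (charVal χ u) = charVal χ (fun i => f (u i)) := by
  simp [charVal, map_prod, map_zpow]

lemma charVal_single [DecidableEq ι] (i : ι) (u : ι → A) :
    charVal (Pi.single i 1) u = u i := by
  rw [charVal, Finset.prod_eq_single i] <;> simp +contextual [Pi.single_apply]

lemma charVal_mem (S : Subgroup A) (χ : ι → ℤ) {u : ι → A} (hu : ∀ i, u i ∈ S) :
    charVal χ u ∈ S :=
  Subgroup.prod_mem _ fun i _ => Subgroup.zpow_mem _ (hu i) _

/-- The homomorphism of split tori given by an integral matrix. -/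
def monoMap (M : Matrix κ ι ℤ) : (ι → A) →* (κ → A) where
  toFun u k := charVal (M k) u
  map_one' := by ext; simp
  map_mul' u v := by ext; simp [charVal_mul]

lemma monoMap_apply (M : Matrix κ ι ℤ) (u : ι → A) (k : κ) :
    monoMap M u k = charVal (M k) u := rfl

lemma charVal_monoMap (χ : κ → ℤ) (M : Matrix κ ι ℤ) (u : ι → A) :
    charVal χ (monoMap M u) = charVal (Matrix.vecMul χ M) u := by
  have : Matrix.vecMul χ M = ∑ k, χ k • M k := by
    ext i; simp [Matrix.vecMul, dotProduct]
  rw [this, charVal_sum]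
  simp only [charVal_smul]
  rfl

lemma monoMap_mul {l : Type*} [Fintype l] (M : Matrix l κ ℤ) (N : Matrix κ ι ℤ) (u : ι → A) :
    monoMap (M * N) u = monoMap M (monoMap N u) := by
  ext k
  rw [monoMap_apply, monoMap_apply, charVal_monoMap]
  rfl

@[simp] lemma monoMap_one [DecidableEq ι] (u : ι → A) :
    monoMap (1 : Matrix ι ι ℤ) u = u := by
  ext k
  rw [monoMap_apply, ← charVal_single k u]
  congr 1
  ext j
  simp [Matrix.one_apply, Pi.single_apply, eq_comm]

lemma monoMap_sum {τ : Type*} (s : Finset τ) (M : τ → Matrix κ ι ℤ) (u : ι → A) :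
    monoMap (∑ t ∈ s, M t) u = ∏ t ∈ s, monoMap (M t) u := by
  ext k
  have h : (∑ t ∈ s, M t) k = ∑ t ∈ s, M t k := Finset.sum_apply k s M
  rw [monoMap_apply, Finset.prod_apply, h, charVal_sum]
  rfl

lemma monoMap_smul_one [DecidableEq ι] (m : ℤ) (u : ι → A) :
    monoMap (m • (1 : Matrix ι ι ℤ)) u = u ^ m := by
  ext k
  have h : (m • (1 : Matrix ι ι ℤ)) k = m • (1 : Matrix ι ι ℤ) k := rfl
  rw [monoMap_apply, h, charVal_smul, ← monoMap_apply, monoMap_one]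
  rfl

lemma monoMap_vecMulVec (a : κ → ℤ) (χ : ι → ℤ) (u : ι → A) :
    monoMap (Matrix.vecMulVec a χ) u = fun k => charVal χ u ^ a k := by
  ext k
  rw [monoMap_apply, ← charVal_smul]
  rfl

lemma map_monoMap (f : A →* B) (M : Matrix κ ι ℤ) (u : ι → A) :
    (fun k => f (monoMap M u k)) = monoMap M (fun i => f (u i)) := by
  ext k
  exact map_charVal f _ u

end Characters

/-! ### Weight decomposition of representations of split tori, through the universal point. -/

section GroupAlgebra

variable (L : Type*) [CommRing L] (Λ : Type*) [AddCommGroup Λ]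

/-- The monomials of the group algebra, as units. -/
noncomputable def monoUnit : Multiplicative Λ →* (AddMonoidAlgebra L Λ)ˣ :=
  (AddMonoidAlgebra.of L Λ).toHomUnits

@[simp] lemma monoUnit_val (x : Λ) :
    (monoUnit L Λ (Multiplicative.ofAdd x) : AddMonoidAlgebra L Λ) =
      AddMonoidAlgebra.single x 1 := rfl

variable {Λ}

lemma charVal_monoUnit {ι : Type*} [Fintype ι] (χ : ι → ℤ) (x : ι → Λ) :
    charVal χ (fun i => monoUnit L Λ (Multiplicative.ofAdd (x i))) =
      monoUnit L Λ (Multiplicative.ofAdd (∑ i, χ i • x i)) := by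
  rw [← map_charVal (monoUnit L Λ) χ (fun i => Multiplicative.ofAdd (x i))]
  congr 1

lemma monoUnit_injective [Nontrivial L] : Function.Injective (monoUnit L Λ) := by
  intro x y h
  have h' := congrArg Units.val h
  exact AddMonoidAlgebra.of_injective h'

end GroupAlgebra

/-- A morphism of functors from a split torus of rank `d` over `L` to `GL_n`. The structure
of `L`-algebra on `B` is recorded as a ring homomorphism, so that it can vary. -/
structure TorusRep (L : Type) [Field L] (d n : ℕ) where
  app : ∀ (B : Type) [CommRing B] (_ : L →+* B), (Fin d → Bˣ) →* GL (Fin n) B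
  natural : ∀ (B C : Type) [CommRing B] [CommRing C] (i : L →+* B) (f : B →+* C)
    (u : Fin d → Bˣ),
    app C (f.comp i) (fun k => Units.map (f : B →* C) (u k)) =
      Matrix.GeneralLinearGroup.map f (app B i u)

namespace TorusRep

variable {L : Type} [Field L] {d n : ℕ} (ρ : TorusRep L d n)

/-- The universal point of the split torus. -/
noncomputable def univPoint (L : Type) [Field L] (d : ℕ) :
    Fin d → (AddMonoidAlgebra L (Fin d → ℤ))ˣ :=
  fun k => monoUnit L _ (Multiplicative.ofAdd (Pi.single k 1))

lemma sum_smul_single (χ : Fin d → ℤ) : ∑ k, χ k • (Pi.single k 1 : Fin d → ℤ) = χ := by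
  ext k
  simp [Finset.sum_apply, Pi.single_apply]

lemma charVal_univPoint (χ : Fin d → ℤ) :
    charVal χ (univPoint L d) = monoUnit L _ (Multiplicative.ofAdd χ) := by
  unfold univPoint
  rw [charVal_monoUnit, sum_smul_single]

/-- By Yoneda this one matrix of Laurent polynomials determines the whole representation; its
coefficients are the weight projectors. -/
noncomputable def univMat : Matrix (Fin n) (Fin n) (AddMonoidAlgebra L (Fin d → ℤ)) :=
  (ρ.app _ (algebraMap L _) (univPoint L d)).val

/-- The projector on the weight space of the character `χ`. -/
noncomputable def proj (χ : Fin d → ℤ) : Matrix (Fin n) (Fin n) L :=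
  fun a b => (ρ.univMat a b).coeff χ

/-- The weights of the representation. -/
noncomputable def weights : Finset (Fin d → ℤ) :=
  Finset.univ.biUnion fun a => Finset.univ.biUnion fun b => (ρ.univMat a b).coeff.support

lemma mem_weights {χ : Fin d → ℤ} : χ ∈ ρ.weights ↔ ρ.proj χ ≠ 0 := by
  simp only [weights, Finset.mem_biUnion, Finset.mem_univ, true_and, Finsupp.mem_support_iff]
  constructor
  · rintro ⟨a, b, h⟩ h0
    exact h (congrFun (congrFun h0 a) b)
  · intro h
    by_contra! h'
    exact h (by ext a b; exact h' a b)

/-- Evaluation of Laurent polynomials at a point of the torus. -/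
noncomputable def evalAt {B : Type} [CommRing B] (i : L →+* B) (u : Fin d → Bˣ) :
    AddMonoidAlgebra L (Fin d → ℤ) →+* B :=
  AddMonoidAlgebra.liftNCRingHom i
    { toFun := fun χ => (charVal χ.toAdd u : Bˣ)
      map_one' := by simp
      map_mul' := fun a b => by simp [charVal_add] }
    (fun _ _ => Commute.all _ _)

lemma evalAt_single {B : Type} [CommRing B] (i : L →+* B) (u : Fin d → Bˣ) (χ : Fin d → ℤ)
    (c : L) : evalAt i u (AddMonoidAlgebra.single χ c) = i c * (charVal χ u : Bˣ) := by
  simp [evalAt, AddMonoidAlgebra.liftNCRingHom]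

lemma evalAt_apply {B : Type} [CommRing B] (i : L →+* B) (u : Fin d → Bˣ)
    (f : AddMonoidAlgebra L (Fin d → ℤ)) (s : Finset (Fin d → ℤ)) (hs : f.coeff.support ⊆ s) :
    evalAt i u f = ∑ χ ∈ s, i (f.coeff χ) * (charVal χ u : Bˣ) := by
  have h : f = ∑ χ ∈ f.coeff.support, AddMonoidAlgebra.single χ (f.coeff χ) := by
    exact (AddMonoidAlgebra.sum_coeff_single f).symm
  conv_lhs => rw [h]
  rw [map_sum]
  simp only [evalAt_single]
  refine Finset.sum_subset hs fun χ _ hχ => ?_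
  rw [Finsupp.notMem_support_iff.mp hχ, map_zero, zero_mul]

/-- Every point `u` is the image of the universal point under evaluation of Laurent polynomials at
`u`, so naturality reduces the claim to expanding the universal matrix into monomials. -/
lemma app_eq {B : Type} [CommRing B] (i : L →+* B) (u : Fin d → Bˣ) :
    (ρ.app B i u).val = ∑ χ ∈ ρ.weights, (charVal χ u : Bˣ).val • (ρ.proj χ).map i := by
  have hc : (evalAt i u).comp (algebraMap L (AddMonoidAlgebra L (Fin d → ℤ))) = i := by
    ext c
    simp [evalAt_single]
  have hu : (fun k => Units.map (evalAt i u : _ →* B) (univPoint L d k)) = u := by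
    ext k
    simp [univPoint, evalAt_single, charVal_single]
  have h := ρ.natural _ B (algebraMap L _) (evalAt i u) (univPoint L d)
  rw [hc, hu] at h
  rw [h]
  ext a b
  rw [Matrix.sum_apply]
  simp only [Matrix.smul_apply, Matrix.map_apply, smul_eq_mul]
  change evalAt i u (ρ.univMat a b) = _
  rw [evalAt_apply i u _ ρ.weights]
  · exact Finset.sum_congr rfl fun χ _ => mul_comm _ _
  · intro χ hχ
    simp only [weights, Finset.mem_biUnion, Finset.mem_univ, true_and]
    exact ⟨a, b, hχ⟩

lemma sum_proj : ∑ χ ∈ ρ.weights, ρ.proj χ = 1 := by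
  have h := ρ.app_eq (RingHom.id L) 1
  simpa [eq_comm] using h

lemma proj_mul_proj (χ ψ : Fin d → ℤ) :
    ρ.proj χ * ρ.proj ψ = if χ = ψ then ρ.proj χ else 0 := by
  classical
  by_cases hχ : χ ∈ ρ.weights
  swap
  · rw [mem_weights, not_not] at hχ
    simp [hχ]
  by_cases hψ : ψ ∈ ρ.weights
  swap
  · rw [mem_weights, not_not] at hψ
    split_ifs with h
    · simp [h, hψ]
    · simp [hψ]
  -- Two independent universal points live over the group algebra of `ℤ^d × ℤ^d`. Comparing the
  -- coefficients of the monomial `(χ, ψ)` in `ρ(uv) = ρ(u) ρ(v)` gives orthogonality: the left side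
  -- has diagonal monomials only.
  let u : Fin d → (AddMonoidAlgebra L ((Fin d → ℤ) × (Fin d → ℤ)))ˣ := fun k => monoUnit L _ (Multiplicative.ofAdd (Pi.single k 1, 0))
  let v : Fin d → (AddMonoidAlgebra L ((Fin d → ℤ) × (Fin d → ℤ)))ˣ := fun k => monoUnit L _ (Multiplicative.ofAdd (0, Pi.single k 1))
  have hu : ∀ χ, ((charVal χ u : (AddMonoidAlgebra L ((Fin d → ℤ) × (Fin d → ℤ)))ˣ) : AddMonoidAlgebra L ((Fin d → ℤ) × (Fin d → ℤ))) = AddMonoidAlgebra.single (χ, 0) 1 := fun χ => by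
    rw [charVal_monoUnit, monoUnit_val]
    congr 1
    exact Prod.ext (by rw [Prod.fst_sum]; exact sum_smul_single χ)
      (by rw [Prod.snd_sum]; exact Finset.sum_eq_zero fun k _ => smul_zero (A := Fin d → ℤ) (χ k))
  have hv : ∀ χ, ((charVal χ v : (AddMonoidAlgebra L ((Fin d → ℤ) × (Fin d → ℤ)))ˣ) : AddMonoidAlgebra L ((Fin d → ℤ) × (Fin d → ℤ))) = AddMonoidAlgebra.single (0, χ) 1 := fun χ => by
    rw [charVal_monoUnit, monoUnit_val]
    congr 1
    exact Prod.ext (by rw [Prod.fst_sum]; exact Finset.sum_eq_zero fun k _ => smul_zero (A := Fin d → ℤ) (χ k))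
      (by rw [Prod.snd_sum]; exact sum_smul_single χ)
  have h := congrArg Units.val (map_mul (ρ.app _ (algebraMap L _)) u v)
  rw [Units.val_mul, ρ.app_eq, ρ.app_eq, ρ.app_eq, Finset.sum_mul_sum] at h
  ext a b
  have h' := congrArg (fun f : AddMonoidAlgebra L ((Fin d → ℤ) × (Fin d → ℤ)) => f.coeff (χ, ψ)) (congrFun (congrFun h a) b)
  have hl : ∀ χ₁, ((charVal χ₁ (u * v) : (AddMonoidAlgebra L ((Fin d → ℤ) × (Fin d → ℤ)))ˣ).val • (ρ.proj χ₁).map (algebraMap L _)) a b =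
      AddMonoidAlgebra.single (χ₁, χ₁) (ρ.proj χ₁ a b) := fun χ₁ => by
    rw [charVal_mul, Units.val_mul, hu, hv, AddMonoidAlgebra.single_mul_single]
    simp [AddMonoidAlgebra.single_mul_single]
  have hr : ∀ χ₁ χ₂, (((charVal χ₁ u : (AddMonoidAlgebra L ((Fin d → ℤ) × (Fin d → ℤ)))ˣ).val • (ρ.proj χ₁).map (algebraMap L (AddMonoidAlgebra L ((Fin d → ℤ) × (Fin d → ℤ))))) *
      ((charVal χ₂ v : (AddMonoidAlgebra L ((Fin d → ℤ) × (Fin d → ℤ)))ˣ).val • (ρ.proj χ₂).map (algebraMap L (AddMonoidAlgebra L ((Fin d → ℤ) × (Fin d → ℤ)))))) a b =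
      AddMonoidAlgebra.single (χ₁, χ₂) ((ρ.proj χ₁ * ρ.proj χ₂) a b) := fun χ₁ χ₂ => by
    rw [Matrix.smul_mul, Matrix.mul_smul, smul_smul, ← Matrix.map_mul, hu, hv,
      AddMonoidAlgebra.single_mul_single]
    simp [AddMonoidAlgebra.single_mul_single]
  simp only [Matrix.sum_apply, hl, hr, AddMonoidAlgebra.coeff_sum, Finsupp.finsetSum_apply,
    AddMonoidAlgebra.coeff_single, Finsupp.single_apply, Prod.mk.injEq] at h'
  simp only [ite_and, Finset.sum_ite_eq', hχ, hψ, if_true, Finset.sum_const_zero,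
    Finset.sum_ite_irrel] at h'
  rw [← h']
  split_ifs <;> rfl

lemma proj_mul_app {B : Type} [CommRing B] (i : L →+* B) (u : Fin d → Bˣ) (χ : Fin d → ℤ) :
    (ρ.proj χ).map i * (ρ.app B i u).val = (charVal χ u : Bˣ).val • (ρ.proj χ).map i := by
  rw [ρ.app_eq, Finset.mul_sum]
  simp only [Matrix.mul_smul, ← Matrix.map_mul, proj_mul_proj]
  by_cases hχ : χ ∈ ρ.weights
  · rw [Finset.sum_eq_single χ] <;> aesop
  · rw [mem_weights, not_not] at hχ
    simp [hχ]


/-- Distinct monomials in the universal point are linearly independent, so a weight expansion there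
is unique. -/
lemma proj_eq_of_app_eq (S : Finset (Fin d → ℤ)) (Q : (Fin d → ℤ) → Matrix (Fin n) (Fin n) L)
    (h : (ρ.app _ (algebraMap L _) (univPoint L d)).val =
      ∑ χ ∈ S, (charVal χ (univPoint L d) : _ˣ).val •
        (Q χ).map (algebraMap L (AddMonoidAlgebra L (Fin d → ℤ)))) (χ : Fin d → ℤ) :
    ρ.proj χ = if χ ∈ S then Q χ else 0 := by
  ext a b
  have h' := congrArg (fun f : AddMonoidAlgebra L (Fin d → ℤ) => f.coeff χ)
    (congrFun (congrFun h a) b)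
  have hl : ∀ χ₁, ((charVal χ₁ (univPoint L d) : _ˣ).val •
      (Q χ₁).map (algebraMap L (AddMonoidAlgebra L (Fin d → ℤ)))) a b =
      AddMonoidAlgebra.single χ₁ (Q χ₁ a b) := fun χ₁ => by
    rw [charVal_univPoint, monoUnit_val]
    simp [AddMonoidAlgebra.single_mul_single]
  simp only [Matrix.sum_apply, hl, AddMonoidAlgebra.coeff_sum, Finsupp.finsetSum_apply,
    AddMonoidAlgebra.coeff_single, Finsupp.single_apply, Finset.sum_ite_eq'] at h'
  refine Eq.trans h' ?_
  split_ifs <;> rfl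

/-- Nonzero columns chosen one from each projector are linearly independent, since the projectors
are orthogonal idempotents. -/
lemma weights_card_le : ρ.weights.card ≤ n := by
  classical
  have hex : ∀ χ : ρ.weights, ∃ b : Fin n, (ρ.proj χ.1).col b ≠ 0 := fun χ => by
    by_contra! h
    exact ρ.mem_weights.mp χ.2 (by ext a b; exact congrFun (h b) a)
  choose b hb using hex
  have hli : LinearIndependent L fun χ : ρ.weights => (ρ.proj χ.1).col (b χ) := by
    rw [linearIndependent_iff']
    intro s c hc χ hχ
    have h := congrArg (fun v => (ρ.proj χ.1).mulVec v) hc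
    have hv : ∀ ψ : ρ.weights, (ρ.proj χ.1).mulVec ((ρ.proj ψ.1).col (b ψ)) =
        if χ = ψ then (ρ.proj χ.1).col (b ψ) else 0 := fun ψ => by
      have := congrArg (fun M => Matrix.col M (b ψ)) (ρ.proj_mul_proj χ.1 ψ.1)
      refine Eq.trans ?_ (this.trans ?_)
      · ext a; rfl
      · simp only [Subtype.ext_iff]
        split_ifs <;> rfl
    simp only [Matrix.mulVec_sum, Matrix.mulVec_smul, hv, smul_ite, smul_zero,
      Finset.sum_ite_eq, hχ, if_true, Matrix.mulVec_zero] at h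
    exact (smul_eq_zero.mp h).resolve_right (hb χ)
  simpa using hli.fintype_card_le_finrank

/-- The weights of a faithful representation generate the character group. -/
lemma closure_weights (hinj : ∀ (B : Type) [CommRing B] (i : L →+* B),
    Function.Injective (ρ.app B i)) :
    AddSubgroup.closure (ρ.weights : Set (Fin d → ℤ)) = ⊤ := by
  set Λ := AddSubgroup.closure (ρ.weights : Set (Fin d → ℤ)) with hΛ
  -- The tautological point with values in the group algebra of `ℤ^d / Λ`. All weights take the
  -- value `1` there, so it acts trivially and faithfulness makes it the identity; hence the
  -- quotient is zero.
  let u : Fin d → (AddMonoidAlgebra L ((Fin d → ℤ) ⧸ Λ))ˣ := fun k =>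
    monoUnit L _ (Multiplicative.ofAdd (QuotientAddGroup.mk' Λ (Pi.single k 1)))
  have hu : ∀ χ, charVal χ u = monoUnit L _ (Multiplicative.ofAdd (QuotientAddGroup.mk' Λ χ)) := by
    intro χ
    simp only [u]
    have h : ∑ k, χ k • QuotientAddGroup.mk' Λ (Pi.single k 1) = QuotientAddGroup.mk' Λ χ := by
      simp only [← map_zsmul, ← map_sum, sum_smul_single]
    rw [charVal_monoUnit, h]
  have h1 : u = 1 := by
    apply hinj _ (algebraMap L _)
    rw [map_one]
    ext1
    rw [ρ.app_eq, Units.val_one, ← Matrix.map_one (algebraMap L _) (map_zero _) (map_one _),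
      ← ρ.sum_proj, ← RingHom.mapMatrix_apply, map_sum]
    refine Finset.sum_congr rfl fun χ hχ => ?_
    have hχ' : QuotientAddGroup.mk' Λ χ = 0 :=
      (QuotientAddGroup.eq_zero_iff χ).mpr (AddSubgroup.subset_closure hχ)
    rw [hu, hχ', ofAdd_zero, map_one, Units.val_one, one_smul]
    rfl
  rw [eq_top_iff]
  intro χ _
  have h2 := hu χ
  rw [h1, charVal_one, eq_comm, map_eq_one_iff _ (monoUnit_injective L)] at h2
  exact (QuotientAddGroup.eq_zero_iff χ).mp (ofAdd_eq_one.mp h2)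

/-- The representation obtained by composing the structure map with a field automorphism. -/
def twist (σ : L →+* L) : TorusRep L d n where
  app B _ i := ρ.app B (i.comp σ)
  natural B C _ _ i f u := by
    rw [← ρ.natural B C (i.comp σ) f u]
    rfl

lemma proj_twist (σ : L →+* L) (χ : Fin d → ℤ) : (ρ.twist σ).proj χ = (ρ.proj χ).map σ := by
  rw [(ρ.twist σ).proj_eq_of_app_eq ρ.weights (fun χ => (ρ.proj χ).map σ)]
  · split_ifs with h
    · rfl
    · rw [mem_weights, not_not] at h
      rw [h, Matrix.map_zero _ (map_zero σ)]
  · change (ρ.app _ ((algebraMap L _).comp σ) _).val = _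
    rw [ρ.app_eq]
    rfl

end TorusRep

/-- Every character of a split torus, as a morphism of functors, is a monomial. -/
theorem exists_charVal_eq {L : Type} [Field L] {d : ℕ}
    (c : ∀ (B : Type) [CommRing B] (_ : L →+* B), (Fin d → Bˣ) →* Bˣ)
    (hc : ∀ (B C : Type) [CommRing B] [CommRing C] (i : L →+* B) (f : B →+* C) (u : Fin d → Bˣ),
      c C (f.comp i) (fun k => Units.map (f : B →* C) (u k)) = Units.map (f : B →* C) (c B i u)) :
    ∃ χ : Fin d → ℤ, ∀ (B : Type) [CommRing B] (i : L →+* B) (u : Fin d → Bˣ),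
      c B i u = charVal χ u := by
  -- A character is a representation of rank one. Its projectors are scalars, so a nonzero one is an
  -- idempotent of the field, hence `1`, and its weight is the required exponent.
  let ρ : TorusRep L d 1 :=
    { app := fun B _ i => (Units.map (Matrix.scalar (Fin 1) : B →+* _).toMonoidHom).comp (c B i)
      natural := fun B C _ _ i f u => by
        ext a b
        simp [hc, Matrix.diagonal_apply, apply_ite f] }
  have hone : ∃ χ, χ ∈ ρ.weights := by
    by_contra! h
    have h0 := ρ.sum_proj
    rw [Finset.eq_empty_of_forall_notMem h, Finset.sum_empty] at h0
    exact zero_ne_one (congrFun (congrFun h0 0) 0)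
  obtain ⟨χ, hχ⟩ := hone
  have hval : ∀ A : Matrix (Fin 1) (Fin 1) L, A ≠ 0 → A 0 0 ≠ 0 := fun A hA h0 =>
    hA (by ext a b; fin_cases a; fin_cases b; exact h0)
  have hmul : ∀ A B : Matrix (Fin 1) (Fin 1) L, (A * B) 0 0 = A 0 0 * B 0 0 := fun A B => by
    simp [Matrix.mul_apply]
  have hP0 := hval _ (ρ.mem_weights.mp hχ)
  have hP : ρ.proj χ 0 0 = 1 := by
    have h := congrFun (congrFun (ρ.proj_mul_proj χ χ) 0) 0
    rw [hmul, if_pos rfl] at h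
    exact mul_left_cancel₀ hP0 (h.trans (mul_one _).symm)
  refine ⟨χ, fun B _ i u => ?_⟩
  have h := congrFun (congrFun (ρ.proj_mul_app i u χ) 0) 0
  have happ : (ρ.app B i u).val 0 0 = c B i u := by simp [ρ]
  simp only [Matrix.mul_apply, Finset.univ_unique, Finset.sum_singleton, Fin.default_eq_zero,
    Matrix.map_apply, Matrix.smul_apply, smul_eq_mul, happ, hP, map_one, one_mul, mul_one] at h
  exact Units.ext h

theorem exists_monoMap_eq {L : Type} [Field L] {d e : ℕ}
    (c : ∀ (B : Type) [CommRing B] (_ : L →+* B), (Fin d → Bˣ) →* (Fin e → Bˣ))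
    (hc : ∀ (B C : Type) [CommRing B] [CommRing C] (i : L →+* B) (f : B →+* C) (u : Fin d → Bˣ)
      (k : Fin e), c C (f.comp i) (fun k => Units.map (f : B →* C) (u k)) k =
        Units.map (f : B →* C) (c B i u k)) :
    ∃ M : Matrix (Fin e) (Fin d) ℤ, ∀ (B : Type) [CommRing B] (i : L →+* B) (u : Fin d → Bˣ),
      c B i u = monoMap M u := by
  choose M hM using fun k => exists_charVal_eq
    (fun B _ i => (Pi.evalMonoidHom (fun _ : Fin e => Bˣ) k).comp (c B i))
    (fun B C _ _ i f u => hc B C i f u k)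
  exact ⟨M, fun B _ i u => funext fun k => hM k B i u⟩

/-- A monomial map is determined by its values. -/
theorem monoMap_injective (L : Type) [Field L] {d e : ℕ} {M N : Matrix (Fin e) (Fin d) ℤ}
    (h : ∀ (B : Type) [CommRing B] (_ : L →+* B) (u : Fin d → Bˣ), monoMap M u = monoMap N u) :
    M = N := by
  funext k
  have h' := congrFun (h _ (algebraMap L _) (TorusRep.univPoint L d)) k
  simp only [monoMap_apply, TorusRep.charVal_univPoint] at h'
  exact Multiplicative.ofAdd.injective (monoUnit_injective L h')

end ShimuraTorus

/-! ### Splittings of a torus, their descent to subfields, and the splitting field as a Galois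
extension. -/

namespace ShimuraTorus

namespace TorusRep

variable {L : Type} [Field L] {d n : ℕ} (ρ : TorusRep L d n)

/-- A weight is a linear form on each column on which its projector does not vanish. -/
lemma charVal_eq_sum {χ : Fin d → ℤ} {a b : Fin n} (hab : ρ.proj χ a b ≠ 0) {B : Type}
    [CommRing B] (i : L →+* B) (u : Fin d → Bˣ) :
    (charVal χ u : Bˣ).val =
      ∑ c, i ((ρ.proj χ a b)⁻¹ * ρ.proj χ a c) * (ρ.app B i u).val c b := by
  have h := congrFun (congrFun (ρ.proj_mul_app i u χ) a) b
  simp only [Matrix.mul_apply, Matrix.map_apply, Matrix.smul_apply, smul_eq_mul] at h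
  simp only [map_mul, mul_assoc, ← Finset.mul_sum]
  rw [h, mul_left_comm, ← map_mul, inv_mul_cancel₀ hab, map_one, mul_one]

end TorusRep

lemma aeval_map_entries {n : ℕ} {R S : Type} [CommRing R] [CommRing S] [Algebra ℚ R]
    [Algebra ℚ S] (f : R →+* S) (g : GL (Fin n) R) (P : MvPolynomial (Fin n × Fin n) ℚ) :
    MvPolynomial.aeval (fun ij : Fin n × Fin n =>
        (Matrix.GeneralLinearGroup.map f g : Matrix (Fin n) (Fin n) S) ij.1 ij.2) P =
      f (MvPolynomial.aeval
        (fun ij : Fin n × Fin n => (g : Matrix (Fin n) (Fin n) R) ij.1 ij.2) P) :=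
  (MvPolynomial.comp_aeval_apply _ f.toRatAlgHom P).symm

lemma AlgSubgroup.map_mem_points {n : ℕ} (M : AlgSubgroup n) {R S : Type}
    [CommRing R] [CommRing S] [Algebra ℚ R] [Algebra ℚ S] (f : R →+* S)
    {g : GL (Fin n) R} (hg : g ∈ M.points R) :
    Matrix.GeneralLinearGroup.map f g ∈ M.points S := fun P hP => by
  rw [aeval_map_entries, hg P hP, map_zero]

lemma AlgSubgroup.mem_points_of_injective {n : ℕ} (M : AlgSubgroup n) {R S : Type}
    [CommRing R] [CommRing S] [Algebra ℚ R] [Algebra ℚ S] {f : R →+* S}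
    (hf : Function.Injective f) {g : GL (Fin n) R}
    (hg : Matrix.GeneralLinearGroup.map f g ∈ M.points S) : g ∈ M.points R := fun P hP => by
  apply hf
  rw [map_zero, ← aeval_map_entries, hg P hP]

lemma GL_map_injective {n : ℕ} {R S : Type*} [CommRing R] [CommRing S] {f : R →+* S}
    (hf : Function.Injective f) :
    Function.Injective (Matrix.GeneralLinearGroup.map (n := Fin n) f) := by
  intro x y h
  ext a b
  exact hf (congrFun (congrFun (congrArg (fun z : GL (Fin n) S => z.val) h) a) b)

/-- A splitting of the torus `M` over `L`, with the `L`-algebra structures recorded as ring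
homomorphisms. -/
structure Splitting {n : ℕ} (M : AlgSubgroup n) (L : Type) [Field L] (d : ℕ) where
  rep : TorusRep L d n
  mem : ∀ (B : Type) [CommRing B] [Algebra ℚ B] (i : L →+* B) (u : Fin d → Bˣ),
    rep.app B i u ∈ M.points B
  inj : ∀ (B : Type) [CommRing B] (i : L →+* B), Function.Injective (rep.app B i)
  surj : ∀ (B : Type) [CommRing B] [Algebra ℚ B] (i : L →+* B), ∀ x ∈ M.points B,
    ∃ u, rep.app B i u = x

lemma AlgSubgroup.SplitsOver.exists_splitting {n : ℕ} {M : AlgSubgroup n} {L : Type} [Field L]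
    [CharZero L] (h : M.SplitsOver L) : ∃ d, Nonempty (Splitting M L d) := by
  obtain ⟨d, φ, hφ⟩ := h
  -- A homomorphism `L →+* B` already carries a `ℚ`-algebra structure on `B`, and such a structure
  -- is unique, so nothing depends on this choice.
  let alg : ∀ {B : Type} [CommRing B] (_ : L →+* B), Algebra ℚ B := fun i =>
    (i.comp (algebraMap ℚ L)).toAlgebra
  refine ⟨d, ⟨⟨⟨fun B _ i => (@AlgSubgroup.points n M B _ (alg i)).subtype.comp
      (@φ B _ (alg i) i.toAlgebra).toMonoidHom, ?_⟩, ?_, ?_, ?_⟩⟩⟩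
  · intro B C _ _ i f u
    letI := alg i
    letI := alg (f.comp i)
    letI := i.toAlgebra
    letI := (f.comp i).toAlgebra
    exact hφ B C ({ f with commutes' := fun _ => rfl } : B →ₐ[L] C) u
  · intro B _ inst i u
    obtain rfl : inst = alg i := Subsingleton.elim _ _
    exact (@φ B _ (alg i) i.toAlgebra u).2
  · intro B _ i u v huv
    exact (@φ B _ (alg i) i.toAlgebra).injective (Subtype.ext huv)
  · intro B _ inst i x hx
    obtain rfl : inst = alg i := Subsingleton.elim _ _
    obtain ⟨u, hu⟩ := (@φ B _ (alg i) i.toAlgebra).surjective ⟨x, hx⟩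
    exact ⟨u, congrArg Subtype.val hu⟩


namespace Splitting

variable {n : ℕ} {M : AlgSubgroup n} {L : Type} [Field L] {d : ℕ} (s : Splitting M L d)

lemma closure_weights : AddSubgroup.closure (s.rep.weights : Set (Fin d → ℤ)) = ⊤ :=
  s.rep.closure_weights s.inj

/-- A splitting whose weight projectors are defined over a smaller field `E` descends to `E`. -/
theorem splitsOver {E : Type} [Field E] [CharZero E] (j : E →+* L)
    (Q : (Fin d → ℤ) → Matrix (Fin n) (Fin n) E) (hQ : ∀ χ, (Q χ).map j = s.rep.proj χ) :
    M.SplitsOver E := by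
  have hmapinj : Function.Injective (fun A : Matrix (Fin n) (Fin n) E => A.map j) :=
    Matrix.map_injective j.injective
  have hQQ : ∀ χ ψ, Q χ * Q ψ = if χ = ψ then Q χ else 0 := fun χ ψ => hmapinj <| by
    simp only [Matrix.map_mul, hQ, s.rep.proj_mul_proj]
    split_ifs
    · rw [hQ]
    · rw [Matrix.map_zero _ (map_zero j)]
  have hQ1 : ∑ χ ∈ s.rep.weights, Q χ = 1 := hmapinj <| by
    change j.mapMatrix _ = j.mapMatrix _
    rw [map_sum, map_one, ← s.rep.sum_proj]
    exact Finset.sum_congr rfl fun χ _ => hQ χ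
  let ψ : ∀ (B : Type) [CommRing B] [Algebra E B],
      (Fin d → Bˣ) →* Matrix (Fin n) (Fin n) B := fun B _ _ =>
    { toFun := fun u => ∑ χ ∈ s.rep.weights,
        (charVal χ u : Bˣ).val • (Q χ).map (algebraMap E B)
      map_one' := by
        simp only [charVal_one, Units.val_one, one_smul]
        change ∑ χ ∈ s.rep.weights, (algebraMap E B).mapMatrix (Q χ) = 1
        rw [← map_sum, hQ1, map_one]
      map_mul' := fun u v => by
        rw [Finset.sum_mul_sum]
        refine Finset.sum_congr rfl fun χ hχ => ?_
        rw [Finset.sum_eq_single χ]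
        · rw [Matrix.smul_mul, Matrix.mul_smul, smul_smul, ← Matrix.map_mul, hQQ, if_pos rfl,
            charVal_mul, Units.val_mul]
        · intro χ' _ h
          rw [Matrix.smul_mul, Matrix.mul_smul, ← Matrix.map_mul, hQQ, if_neg h.symm,
            Matrix.map_zero _ (map_zero _), smul_zero, smul_zero]
        · exact fun h => absurd hχ h }
  let Ψ : ∀ (B : Type) [CommRing B] [Algebra E B], (Fin d → Bˣ) →* GL (Fin n) B :=
    fun B _ _ => (ψ B).toHomUnits
  have hΨ : ∀ (B : Type) [CommRing B] [Algebra E B] (u : Fin d → Bˣ), (Ψ B u).val =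
      ∑ χ ∈ s.rep.weights, (charVal χ u : Bˣ).val • (Q χ).map (algebraMap E B) :=
    fun B _ _ u => rfl
  letI := j.toAlgebra
  have hmap : ∀ (B : Type) [CommRing B] [Algebra E B] (i : L →+* L ⊗[E] B) (f : B →+* L ⊗[E] B)
      (_ : i.comp j = f.comp (algebraMap E B)) (u : Fin d → Bˣ),
      Matrix.GeneralLinearGroup.map f (Ψ B u) =
        s.rep.app (L ⊗[E] B) i (fun k => Units.map (f : B →* L ⊗[E] B) (u k)) := by
    intro B _ _ i f hif u
    ext1
    change f.mapMatrix (Ψ B u).val = _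
    rw [s.rep.app_eq, hΨ, map_sum]
    refine Finset.sum_congr rfl fun χ _ => ?_
    rw [← hQ, ← map_charVal (Units.map (f : B →* L ⊗[E] B))]
    ext a b
    have h := congrArg (fun g => g (Q χ a b)) hif
    simp only [RingHom.comp_apply] at h
    simp [h]
  have hf : ∀ (B : Type) [CommRing B] [Algebra E B], Function.Injective
      (Algebra.TensorProduct.includeRight : B →ₐ[E] L ⊗[E] B) := fun B _ _ =>
    Algebra.TensorProduct.includeRight_injective (A := L) (B := B) j.injective
  have hif : ∀ (B : Type) [CommRing B] [Algebra E B],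
      (Algebra.TensorProduct.includeLeftRingHom : L →+* L ⊗[E] B).comp j =
        (Algebra.TensorProduct.includeRight : B →ₐ[E] L ⊗[E] B).toRingHom.comp
          (algebraMap E B) := by
    intro B _ _
    ext e
    exact Algebra.TensorProduct.tmul_one_eq_one_tmul e
  have hmem : ∀ (B : Type) [CommRing B] [Algebra ℚ B] [Algebra E B] (u : Fin d → Bˣ),
      Ψ B u ∈ M.points B := by
    intro B _ _ _ u
    letI : Algebra ℚ (L ⊗[E] B) :=
      ((Algebra.TensorProduct.includeRight : B →ₐ[E] L ⊗[E] B).toRingHom.comp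
        (algebraMap ℚ B)).toAlgebra
    refine M.mem_points_of_injective (hf B) ?_
    have h := hmap B _ _ (hif B) u
    exact h ▸ s.mem _ _ _
  have hinj : ∀ (B : Type) [CommRing B] [Algebra E B], Function.Injective (Ψ B) := by
    intro B _ _ u v huv
    have h := congrArg (Matrix.GeneralLinearGroup.map
      (Algebra.TensorProduct.includeRight : B →ₐ[E] L ⊗[E] B).toRingHom) huv
    rw [hmap B _ _ (hif B), hmap B _ _ (hif B)] at h
    ext k
    exact hf B (congrArg Units.val (congrFun (s.inj _ _ h) k))
  have hsurj : ∀ (B : Type) [CommRing B] [Algebra ℚ B] [Algebra E B], ∀ x ∈ M.points B,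
      ∃ u, Ψ B u = x := by
    intro B _ _ _ x hx
    set i : L →+* L ⊗[E] B := Algebra.TensorProduct.includeLeftRingHom with hi
    set f : B →+* L ⊗[E] B :=
      (Algebra.TensorProduct.includeRight : B →ₐ[E] L ⊗[E] B).toRingHom with hf'
    have hfi : Function.Injective f := hf B
    letI : Algebra ℚ (L ⊗[E] B) := (f.comp (algebraMap ℚ B)).toAlgebra
    obtain ⟨u, hu⟩ := s.surj _ i _ (M.map_mem_points f hx)
    -- The characters whose value at `u` is a unit of `B`. A weight lies here because its values at
    -- `u` and `u⁻¹` are linear forms, with coefficients in `E`, in the entries of `x` and `x⁻¹`. As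
    -- weights generate, all coordinates of `u` come from `B`.
    let T : AddSubgroup (Fin d → ℤ) :=
      { carrier := {χ | charVal χ u ∈ (Units.map (f : B →* L ⊗[E] B)).range}
        zero_mem' := by
          rw [Set.mem_ofPred_eq, charVal_zero]
          exact one_mem _
        add_mem' := fun {χ ψ} hχ hψ => by
          rw [Set.mem_ofPred_eq, charVal_add]
          exact mul_mem hχ hψ
        neg_mem' := fun {χ} hχ => by
          rw [Set.mem_ofPred_eq, charVal_neg]
          exact inv_mem hχ }
    have hT : T = ⊤ := by
      rw [eq_top_iff, ← s.closure_weights, AddSubgroup.closure_le]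
      intro χ hχ
      obtain ⟨a, b, hab⟩ : ∃ a b, s.rep.proj χ a b ≠ 0 := by
        by_contra! h
        exact s.rep.mem_weights.mp hχ (by ext a b; exact h a b)
      have key : ∀ (v : Fin d → (L ⊗[E] B)ˣ) (y : GL (Fin n) B),
          s.rep.app _ i v = Matrix.GeneralLinearGroup.map f y →
          (charVal χ v).val =
            f (∑ c, algebraMap E B ((Q χ a b)⁻¹ * Q χ a c) * y.val c b) := by
        intro v y hvy
        rw [s.rep.charVal_eq_sum hab i v, hvy, map_sum]
        refine Finset.sum_congr rfl fun c _ => ?_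
        have h := congrArg (fun g => g ((Q χ a b)⁻¹ * Q χ a c)) (hif B)
        rw [map_mul f, Matrix.GeneralLinearGroup.map_apply]
        refine congrArg₂ _ (Eq.trans ?_ h) rfl
        rw [← hQ]
        simp [i]
      have k1 := key u x hu
      have k2 := key u⁻¹ x⁻¹ (by rw [map_inv, map_inv, hu])
      rw [show charVal χ u⁻¹ = (charVal χ u)⁻¹ by simp [charVal]] at k2
      set v := ∑ c, algebraMap E B ((Q χ a b)⁻¹ * Q χ a c) * x.val c b
      set w := ∑ c, algebraMap E B ((Q χ a b)⁻¹ * Q χ a c) * (x⁻¹).val c b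
      have hvw : v * w = 1 := hfi <| by rw [map_mul, ← k1, ← k2, Units.mul_inv, map_one]
      exact ⟨⟨v, w, hvw, by rw [mul_comm, hvw]⟩, Units.ext k1.symm⟩
    have hu' : ∀ k, ∃ v : Bˣ, Units.map (f : B →* L ⊗[E] B) v = u k := fun k => by
      have h : Pi.single k 1 ∈ T := hT ▸ AddSubgroup.mem_top _
      obtain ⟨v, hv⟩ := h
      exact ⟨v, hv.trans (charVal_single k u)⟩
    choose v hv using hu'
    refine ⟨v, GL_map_injective hfi ?_⟩
    rw [hmap B i f (hif B), ← hu]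
    exact congrArg _ (funext hv)
  refine ⟨d, fun B _ _ _ => MulEquiv.ofBijective ((Ψ B).codRestrict (M.points B) (hmem B))
    ⟨fun u v h => hinj B (congrArg Subtype.val h), fun x => ?_⟩, ?_⟩
  · obtain ⟨u, hu⟩ := hsurj B x.1 x.2
    exact ⟨u, Subtype.ext hu⟩
  · intro B C _ _ _ _ _ _ f u
    ext1
    change (Ψ C _).val = (f : B →+* C).mapMatrix (Ψ B u).val
    rw [hΨ, hΨ, map_sum]
    refine Finset.sum_congr rfl fun χ _ => ?_
    rw [← map_charVal (Units.map (f : B →* C))]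
    ext a b
    simp

end Splitting

section Galois

variable {n : ℕ} {M : AlgSubgroup n} {L : IntermediateField ℚ ℂ} [FiniteDimensional ℚ L]

/-- Since `M` is defined over `ℚ`, a conjugate of a field that splits it also splits it. Minimality
gives one inclusion and equality of degrees the other. -/
lemma AlgSubgroup.IsSplittingField.fieldRange_eq (hL : M.IsSplittingField L) (τ : L →ₐ[ℚ] ℂ) :
    τ.fieldRange = L := by
  obtain ⟨d, ⟨s⟩⟩ := hL.1.2.exists_splitting
  let e : L ≃ₐ[ℚ] τ.fieldRange := AlgEquiv.ofInjectiveField τ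
  have hfd : FiniteDimensional ℚ τ.fieldRange := e.toLinearEquiv.finiteDimensional
  have hs : M.SplitsOver τ.fieldRange := s.splitsOver (e.symm : τ.fieldRange →+* L)
    (fun χ => (s.rep.proj χ).map e) (fun χ => by ext a b; simp)
  have hle : L ≤ τ.fieldRange := hL.2 ⟨hfd, hs⟩
  exact (IntermediateField.eq_of_le_of_finrank_eq hle e.toLinearEquiv.finrank_eq).symm

lemma AlgSubgroup.IsSplittingField.exists_algEquiv (hL : M.IsSplittingField L)
    (τ : L →ₐ[ℚ] ℂ) : ∃ σ : L ≃ₐ[ℚ] L, ∀ x, τ x = (σ x : ℂ) := by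
  refine ⟨(AlgEquiv.ofInjectiveField τ).trans
    (IntermediateField.equivOfEq (hL.fieldRange_eq τ)), fun x => rfl⟩

lemma AlgSubgroup.IsSplittingField.isGalois (hL : M.IsSplittingField L) : IsGalois ℚ L := by
  apply IsGalois.of_card_aut_eq_finrank
  rw [← AlgHom.card ℚ L ℂ, ← Nat.card_eq_fintype_card]
  refine Nat.card_congr (Equiv.ofBijective (fun σ : L ≃ₐ[ℚ] L => L.val.comp σ.toAlgHom) ⟨?_, ?_⟩)
  · intro σ τ h
    ext x
    exact congrArg (fun f : L →ₐ[ℚ] ℂ => f x) h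
  · intro τ
    obtain ⟨σ, hσ⟩ := hL.exists_algEquiv τ
    exact ⟨σ, by ext x; exact (hσ x).symm⟩

/-- If `σ` fixes the projectors, the splitting descends to the fixed field of `σ`, which by
minimality is all of `L`. -/
lemma AlgSubgroup.IsSplittingField.eq_one_of_proj_fixed (hL : M.IsSplittingField L) {d : ℕ}
    (s : Splitting M L d) (σ : L ≃ₐ[ℚ] L)
    (hσ : ∀ χ, (s.rep.proj χ).map σ = s.rep.proj χ) : σ = 1 := by
  let F : Subfield L := RingHom.eqLocusField (σ : L →+* L) (RingHom.id L)
  let E : IntermediateField ℚ ℂ := (F.map (algebraMap L ℂ)).toIntermediateField fun q =>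
    ⟨(q : L), map_ratCast (σ : L →+* L) q, by simp⟩
  have hEL : E ≤ L := by
    rintro _ ⟨y, -, rfl⟩
    exact y.2
  have hfd : FiniteDimensional ℚ E := FiniteDimensional.of_injective
    (IntermediateField.inclusion hEL).toLinearMap (IntermediateField.inclusion hEL).injective
  have hs : M.SplitsOver E := s.splitsOver (IntermediateField.inclusion hEL : E →+* L)
    (fun χ a b => ⟨s.rep.proj χ a b, s.rep.proj χ a b, congrFun (congrFun (hσ χ) a) b, rfl⟩)
    (fun χ => by ext a b; rfl)
  ext x
  obtain ⟨y, hy, hyx⟩ := hL.2 ⟨hfd, hs⟩ x.2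
  have hyx' : y = x := Subtype.ext hyx
  subst hyx'
  exact congrArg Subtype.val hy

end Galois

end ShimuraTorus

/-! ### Coset counting for fixed points, and the lattice argument that produces `χ` and `m`. -/

namespace ShimuraTorus

/-- Coset counting: for the fixed points `A` of a family of endomorphisms of `B`, the index of
the `m`-th powers is controlled by the `m`-th powers and the `m`-torsion of `B`. -/
theorem relIndex_map_pow_fixed {B Γ : Type*} [CommGroup B] [Fintype Γ] (f : Γ → B →* B)
    (A : Subgroup B) (hA : ∀ b, b ∈ A ↔ ∀ σ, f σ b = b) {m q t : ℕ}
    (hq0 : (powMonoidHom m : B →* B).range.index ≠ 0)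
    (hq : (powMonoidHom m : B →* B).range.index ≤ q)
    (hfin : Finite (powMonoidHom m : B →* B).ker)
    (ht : Nat.card (powMonoidHom m : B →* B).ker ≤ t) :
    (A.map (powMonoidHom m)).relIndex A ≠ 0 ∧
      (A.map (powMonoidHom m)).relIndex A ≤ q * t ^ Fintype.card Γ := by
  set P : B →* B := powMonoidHom m with hP
  set C : Subgroup B := A.comap P with hC
  have hAC : A ≤ C := fun a ha => Subgroup.pow_mem _ ha m
  -- The inclusion `A^m ≤ A` is split through `C^m = B^m ∩ A`, where `C` consists of the elements
  -- with `m`-th power in `A`.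
  have hCA : C.map P = P.range ⊓ A := by
    rw [hC, Subgroup.map_comap_eq]
  -- The coboundary of `c` is `m`-torsion because `c ^ m` is fixed, and it vanishes exactly when `c`
  -- is fixed. Thus `A` has index at most `t ^ |Γ|` in `C`.
  let δ : C →* (Γ → P.ker) :=
    { toFun := fun c σ => ⟨f σ c / c, by
        have h : f σ (P c) = P c := (hA _).mp c.2 σ
        rw [MonoidHom.mem_ker, map_div, div_eq_one, ← h]
        simp [P, map_pow]⟩
      map_one' := by ext; simp
      map_mul' := fun x y => by ext; simp [mul_div_mul_comm] }
  have hδ : δ.ker = A.subgroupOf C := by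
    ext c
    rw [MonoidHom.mem_ker, Subgroup.mem_subgroupOf, hA]
    simp [δ, funext_iff, Subtype.ext_iff, div_eq_one]
  have hδc : A.relIndex C = Nat.card δ.range := by
    rw [Subgroup.relIndex, ← hδ, Subgroup.index_ker]
  have hδ0 : A.relIndex C ≠ 0 := by
    rw [hδc]
    exact Nat.card_pos.ne'
  have hδt : A.relIndex C ≤ t ^ Fintype.card Γ := by
    rw [hδc]
    calc Nat.card δ.range ≤ Nat.card (Γ → P.ker) := Nat.card_le_card_of_injective _
          Subtype.val_injective
      _ = Nat.card P.ker ^ Fintype.card Γ := by rw [Nat.card_fun, Nat.card_eq_fintype_card (α := Γ)]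
      _ ≤ _ := Nat.pow_le_pow_left ht _
  have h1 : (A.map P).relIndex (C.map P) ∣ A.relIndex C := by
    rw [Subgroup.relIndex_map_map]
    have hk : P.ker ≤ C := fun b hb => by
      rw [hC, Subgroup.mem_comap, MonoidHom.mem_ker.mp hb]
      exact one_mem _
    rw [sup_eq_left.mpr hk]
    exact Subgroup.relIndex_dvd_of_le_left _ le_sup_left
  have h2 : (C.map P).relIndex A ∣ P.range.index := by
    rw [hCA, Subgroup.inf_relIndex_right]
    exact Subgroup.relIndex_dvd_index_of_normal _ _
  have h3 : (A.map P).relIndex (C.map P) * (C.map P).relIndex A = (A.map P).relIndex A :=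
    Subgroup.relIndex_mul_relIndex _ _ _ (Subgroup.map_mono hAC) (hCA ▸ inf_le_right)
  rw [← h3]
  refine ⟨mul_ne_zero (ne_zero_of_dvd_ne_zero hδ0 h1) (ne_zero_of_dvd_ne_zero hq0 h2), ?_⟩
  rw [mul_comm q]
  exact Nat.mul_le_mul ((Nat.le_of_dvd (Nat.pos_of_ne_zero hδ0) h1).trans hδt)
    ((Nat.le_of_dvd (Nat.pos_of_ne_zero hq0) h2).trans hq)

/-- A separating family of integral vectors contains a basis of the rational space. -/
lemma exists_det_ne_zero {ι : Type*} {d : ℕ} (v : ι → Fin d → ℤ)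
    (hv : ∀ χ : Fin d → ℤ, (∀ i, χ ⬝ᵥ v i = 0) → χ = 0) :
    ∃ τ : Fin d → ι, (Matrix.of fun j => v (τ j)).det ≠ 0 := by
  let w : ι → Fin d → ℚ := fun i k => (v i k : ℚ)
  have hspan : Submodule.span ℚ (Set.range w) = ⊤ := by
    by_contra hne
    -- A nonzero rational form vanishing on the family becomes, after clearing denominators, a
    -- nonzero integral vector orthogonal to it.
    obtain ⟨φ, hφ0, hφ⟩ := Submodule.exists_le_ker_of_lt_top _ (lt_top_iff_ne_top.mpr hne)
    let c : Fin d → ℚ := fun k => φ (Pi.single k 1)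
    have hc : ∀ x : Fin d → ℚ, φ x = ∑ k, x k * c k := fun x => by
      conv_lhs => rw [pi_eq_sum_univ' x, map_sum]
      refine Finset.sum_congr rfl fun k _ => ?_
      rw [map_smul, smul_eq_mul]
    obtain ⟨b, hb⟩ := IsLocalization.exist_integer_multiples_of_finite (nonZeroDivisors ℤ) c
    choose χ hχ using hb
    have hb0 : ((b : ℤ) : ℚ) ≠ 0 := by exact_mod_cast nonZeroDivisors.coe_ne_zero b
    have hχ' : ∀ k, (χ k : ℚ) = (b : ℤ) * c k := fun k => by
      have := hχ k
      simpa [Algebra.smul_def] using this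
    have hχ0 : χ = 0 := hv χ fun i => by
      have h : φ (w i) = 0 := hφ (Submodule.subset_span ⟨i, rfl⟩)
      rw [hc] at h
      have : ((χ ⬝ᵥ v i : ℤ) : ℚ) = (b : ℤ) * ∑ k, w i k * c k := by
        simp only [dotProduct, Int.cast_sum, Int.cast_mul, hχ', Finset.mul_sum, w]
        exact Finset.sum_congr rfl fun k _ => by ring
      rw [h, mul_zero] at this
      exact_mod_cast this
    apply hφ0
    ext x
    have hc0 : ∀ k, c k = 0 := fun k => by
      have := hχ' k
      rw [hχ0] at this
      simpa [hb0] using this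
    simp [hc0, c]
  obtain ⟨f, hf, hfs, hli⟩ := Submodule.exists_fun_fin_finrank_span_eq ℚ (Set.range w)
  choose τ hτ using hf
  have hd : d = Module.finrank ℚ (Submodule.span ℚ (Set.range w)) := by
    rw [hspan, finrank_top]; simp
  refine ⟨fun j => τ (Fin.cast hd j), fun h0 => ?_⟩
  have hli' : LinearIndependent ℚ (fun j : Fin d => w (τ (Fin.cast hd j))) := by
    have : (fun j : Fin d => w (τ (Fin.cast hd j))) = f ∘ Fin.cast hd := by
      ext1 j; exact hτ _
    rw [this]
    exact hli.comp _ (Fin.cast_injective hd)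
  have hu : IsUnit (Matrix.of fun j : Fin d => w (τ (Fin.cast hd j))) :=
    Matrix.linearIndependent_rows_iff_isUnit.mp hli'
  rw [Matrix.isUnit_iff_isUnit_det, isUnit_iff_ne_zero] at hu
  apply hu
  have := congrArg (Int.castRingHom ℚ) h0
  rw [RingHom.map_det, map_zero] at this
  exact this

/-- The average of `a ⊗ χ` over `Γ` can be made a scalar because the conjugates of `a` contain a
rational basis; the pairings with the generating set `W` measure the determinant of that basis. -/
theorem exists_equivariant_section {Γ : Type*} [Group Γ] [Fintype Γ] {d : ℕ}
    (A : Γ →* Matrix (Fin d) (Fin d) ℤ) (a : Fin d → ℤ) (W : Finset (Fin d → ℤ))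
    (hW : AddSubgroup.closure (W : Set (Fin d → ℤ)) = ⊤) (C : ℕ)
    (hC : ∀ w ∈ W, ∀ σ, |w ⬝ᵥ (A σ).mulVec a| ≤ C)
    (hsep : ∀ χ : Fin d → ℤ, (∀ σ, χ ⬝ᵥ (A σ).mulVec a = 0) → χ = 0) :
    ∃ (χ : Fin d → ℤ) (m : ℕ), 0 < m ∧ m ≤ Fintype.card Γ * (d.factorial * C ^ d) ∧
      ∑ σ, A σ * Matrix.vecMulVec a χ * A σ⁻¹ = (m : ℤ) • 1 := by
  obtain ⟨τ, hτ⟩ := exists_det_ne_zero _ hsep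
  obtain ⟨ω, hω⟩ := exists_det_ne_zero (fun w : W => w.1) (fun χ hχ => by
    have h : ∀ x ∈ AddSubgroup.closure (W : Set (Fin d → ℤ)), χ ⬝ᵥ x = 0 := fun x hx => by
      induction hx using AddSubgroup.closure_induction with
      | mem x hx => exact hχ ⟨x, hx⟩
      | zero => simp
      | add x y _ _ h1 h2 => rw [dotProduct_add, h1, h2, add_zero]
      | neg x _ h1 => rw [dotProduct_neg, h1, neg_zero]
    rw [hW] at h
    exact dotProduct_eq_zero _ fun x => h x (AddSubgroup.mem_top x))
  set N : Matrix (Fin d) (Fin d) ℤ := Matrix.of fun j => (A (τ j)).mulVec a with hN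
  set D : Matrix (Fin d) (Fin d) ℤ := Matrix.of fun j => (ω j).1 with hD
  have hbound : N.det.natAbs ≤ d.factorial * C ^ d := by
    -- The entries of `D Nᵗ` are the pairings of elements of `W` with conjugates of `a`, all at most
    -- `C` in absolute value.
    have h1 : |(D * N.transpose).det| ≤ d.factorial • (C : ℤ) ^ d := by
      have := Matrix.det_le (A := D * N.transpose) (abv := AbsoluteValue.abs) (x := (C : ℤ))
        (fun i j => hC _ (ω i).2 (τ j))
      simpa using this
    have h2 : 1 ≤ |D.det| := Int.one_le_abs hω
    rw [Matrix.det_mul, Matrix.det_transpose, abs_mul] at h1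
    have h3 : |N.det| ≤ d.factorial • (C : ℤ) ^ d :=
      (le_mul_of_one_le_left (abs_nonneg _) h2).trans h1
    zify
    simpa using h3
  -- Cramer's rule: the rows of the adjugate are, up to `det N`, the basis dual to the chosen
  -- conjugates of `a`.
  have hadj : ∑ j, Matrix.vecMulVec ((A (τ j)).mulVec a) (N.transpose.adjugate j) =
      N.det • (1 : Matrix (Fin d) (Fin d) ℤ) := by
    rw [← Matrix.det_transpose, ← Matrix.mul_adjugate]
    ext i k
    simp only [Matrix.sum_apply, Matrix.vecMulVec_apply, Matrix.mul_apply]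
    rfl
  -- Each dual vector is carried back by its `τ j`, so that it pairs with `a` itself. Reindexing the
  -- sum over `Γ` undoes this translation term by term and leaves `|Γ| det N`.
  set χ₀ : Fin d → ℤ := ∑ j, Matrix.vecMul (N.transpose.adjugate j) (A (τ j)) with hχ₀
  have hmain : ∑ σ, A σ * Matrix.vecMulVec a χ₀ * A σ⁻¹ =
      ((Fintype.card Γ : ℤ) * N.det) • (1 : Matrix (Fin d) (Fin d) ℤ) := by
    have hinv : ∀ σ, A σ⁻¹ * A σ = 1 := fun σ => by rw [← map_mul, inv_mul_cancel, map_one]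
    have hterm : ∀ σ j, A σ * Matrix.vecMulVec a (Matrix.vecMul (N.transpose.adjugate j) (A (τ j)))
        * A σ⁻¹ = A (σ * (τ j)⁻¹) * Matrix.vecMulVec ((A (τ j)).mulVec a) (N.transpose.adjugate j)
        * A (σ * (τ j)⁻¹)⁻¹ := fun σ j => by
      rw [Matrix.mul_vecMulVec, Matrix.vecMulVec_mul, Matrix.mul_vecMulVec, Matrix.vecMulVec_mul,
        Matrix.mulVec_mulVec, Matrix.vecMul_vecMul, ← map_mul, ← map_mul]
      simp
    have hsum : ∀ σ, A σ * Matrix.vecMulVec a χ₀ * A σ⁻¹ = ∑ j, A (σ * (τ j)⁻¹) *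
        Matrix.vecMulVec ((A (τ j)).mulVec a) (N.transpose.adjugate j) * A (σ * (τ j)⁻¹)⁻¹ :=
      fun σ => by
        have : Matrix.vecMulVec a χ₀ = ∑ j, Matrix.vecMulVec a
            (Matrix.vecMul (N.transpose.adjugate j) (A (τ j))) := by
          ext i k
          simp [hχ₀, Matrix.vecMulVec_apply, Matrix.sum_apply, Finset.mul_sum]
        rw [this, Finset.mul_sum, Finset.sum_mul]
        exact Finset.sum_congr rfl fun j _ => hterm σ j
    simp only [hsum]
    rw [Finset.sum_comm]
    have hre : ∀ j, ∑ σ, A (σ * (τ j)⁻¹) *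
        Matrix.vecMulVec ((A (τ j)).mulVec a) (N.transpose.adjugate j) * A (σ * (τ j)⁻¹)⁻¹ =
        ∑ σ, A σ *
        Matrix.vecMulVec ((A (τ j)).mulVec a) (N.transpose.adjugate j) * A σ⁻¹ := fun j =>
      Fintype.sum_equiv (Equiv.mulRight (τ j)⁻¹) _ _ fun σ => rfl
    simp only [hre]
    rw [Finset.sum_comm]
    simp only [← Finset.mul_sum, ← Finset.sum_mul, hadj]
    have : ∀ σ, A σ * N.det • (1 : Matrix (Fin d) (Fin d) ℤ) * A σ⁻¹ = N.det • 1 := fun σ => by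
      rw [Matrix.mul_smul, Matrix.smul_mul, mul_one, ← map_mul, mul_inv_cancel, map_one]
    simp only [this, Finset.sum_const, Finset.card_univ, mul_smul]
    rw [← natCast_zsmul]
  -- The sign turns `det N` into its absolute value, so that `m` is a positive natural number.
  refine ⟨N.det.sign • χ₀, Fintype.card Γ * N.det.natAbs,
    Nat.mul_pos Fintype.card_pos (Int.natAbs_pos.mpr hτ), Nat.mul_le_mul_left _ hbound, ?_⟩
  have : ∀ σ, A σ * Matrix.vecMulVec a (N.det.sign • χ₀) * A σ⁻¹ =
      N.det.sign • (A σ * Matrix.vecMulVec a χ₀ * A σ⁻¹) := fun σ => by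
    rw [Matrix.vecMulVec_smul, Matrix.mul_smul, Matrix.smul_mul]
  simp only [this, ← Finset.smul_sum, hmain, smul_smul]
  congr 1
  push_cast
  rw [mul_left_comm, Int.sign_mul_self_eq_natAbs]
  simp

end ShimuraTorus

/-! ### Galois action on the lattice, and points over `R` as Galois-invariant coordinates over `L ⊗
R`. -/

namespace ShimuraTorus

namespace Splitting

variable {n : ℕ} {M : AlgSubgroup n} {L : Type} [Field L] {d : ℕ} (s : Splitting M L d)

lemma range_app {B : Type} [CommRing B] [Algebra ℚ B] (i : L →+* B) :
    (s.rep.app B i).range = M.points B :=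
  le_antisymm (by rintro _ ⟨u, rfl⟩; exact s.mem B i u) fun x hx => s.surj B i x hx

/-- The coordinates of a homomorphism with values in the torus. -/
noncomputable def pull {H : Type*} [Group H] {B : Type} [CommRing B] (i : L →+* B)
    (ψ : H →* GL (Fin n) B) (hψ : ∀ g, ψ g ∈ (s.rep.app B i).range) : H →* (Fin d → Bˣ) :=
  (MonoidHom.ofInjective (s.inj B i)).symm.toMonoidHom.comp (ψ.codRestrict _ hψ)

lemma app_pull {H : Type*} [Group H] {B : Type} [CommRing B] (i : L →+* B)
    (ψ : H →* GL (Fin n) B) (hψ : ∀ g, ψ g ∈ (s.rep.app B i).range) (g : H) :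
    s.rep.app B i (s.pull i ψ hψ g) = ψ g :=
  congrArg Subtype.val
    ((MonoidHom.ofInjective (s.inj B i)).apply_symm_apply ((ψ.codRestrict _ hψ) g))

/-- The weights, at most `n` in number, generate `ℤ^d`. -/
theorem rank_le {n : ℕ} {M : AlgSubgroup n} {L : Type} [Field L] {d : ℕ} (s : Splitting M L d) :
    d ≤ n := by
  have h : Submodule.span ℤ (s.rep.weights : Set (Fin d → ℤ)) = ⊤ := by
    rw [eq_top_iff]
    intro x _
    have hx : x ∈ AddSubgroup.closure (s.rep.weights : Set (Fin d → ℤ)) :=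
      s.closure_weights ▸ AddSubgroup.mem_top x
    rwa [← Submodule.span_int_eq_addSubgroupClosure] at hx
  have h2 := finrank_span_finset_le_card (R := ℤ) s.rep.weights
  rw [Set.finrank, h, finrank_top, Module.finrank_fin_fun] at h2
  exact h2.trans s.rep.weights_card_le

variable [Algebra ℚ L]

lemma app_comp_mem_range {B : Type} [CommRing B] (i j : L →+* B) (u : Fin d → Bˣ) :
    s.rep.app B j u ∈ (s.rep.app B i).range := by
  letI : Algebra ℚ B := (i.comp (algebraMap ℚ L)).toAlgebra
  rw [range_app]
  exact s.mem B j u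

/-- The structure maps `i` and `i.comp σ` give two parametrisations of the same group `M(B)`, as `M`
is defined over `ℚ`. They differ by a natural endomorphism of the split torus, which is monomial. -/
lemma exists_galMat (σ : L →+* L) : ∃ A : Matrix (Fin d) (Fin d) ℤ,
    ∀ (B : Type) [CommRing B] (i : L →+* B) (u : Fin d → Bˣ),
      s.rep.app B (i.comp σ) u = s.rep.app B i (monoMap A u) := by
  obtain ⟨A, hA⟩ := exists_monoMap_eq
    (fun B _ i => s.pull i (s.rep.app B (i.comp σ)) (s.app_comp_mem_range i (i.comp σ)))
    (fun B C _ _ i f u k => by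
      refine congrFun (s.inj C (f.comp i) (a₂ := fun k => Units.map (f : B →* C)
        (s.pull i (s.rep.app B (i.comp σ)) (s.app_comp_mem_range i (i.comp σ)) u k)) ?_) k
      rw [app_pull, s.rep.natural, app_pull, ← s.rep.natural]
      rfl)
  refine ⟨A, fun B _ i u => ?_⟩
  rw [← hA B i u, app_pull]

/-- The action of the Galois group on the cocharacters of the torus. -/
noncomputable def galMat : (L ≃ₐ[ℚ] L) →* Matrix (Fin d) (Fin d) ℤ where
  toFun σ := (s.exists_galMat (σ : L →+* L)).choose
  map_one' := monoMap_injective L fun B _ i u => s.inj B i <| by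
    rw [← (s.exists_galMat ((1 : L ≃ₐ[ℚ] L) : L →+* L)).choose_spec, monoMap_one]
    rfl
  map_mul' σ τ := monoMap_injective L fun B _ i u => s.inj B i <| by
    rw [← (s.exists_galMat ((σ * τ : L ≃ₐ[ℚ] L) : L →+* L)).choose_spec, monoMap_mul,
      ← (s.exists_galMat (σ : L →+* L)).choose_spec,
      ← (s.exists_galMat (τ : L →+* L)).choose_spec]
    rfl

lemma app_comp (σ : L ≃ₐ[ℚ] L) {B : Type} [CommRing B] (i : L →+* B) (u : Fin d → Bˣ) :
    s.rep.app B (i.comp (σ : L →+* L)) u = s.rep.app B i (monoMap (s.galMat σ) u) :=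
  (s.exists_galMat (σ : L →+* L)).choose_spec B i u

lemma galMat_mul_inv (σ : L ≃ₐ[ℚ] L) : s.galMat σ * s.galMat σ⁻¹ = 1 := by
  rw [← map_mul, mul_inv_cancel, map_one]

lemma galMat_inv_mul (σ : L ≃ₐ[ℚ] L) : s.galMat σ⁻¹ * s.galMat σ = 1 := by
  rw [← map_mul, inv_mul_cancel, map_one]

/-- The representation twisted by `σ` has two weight expansions, one from applying `σ` to the
projectors and one from the monomial change of coordinates; by uniqueness they agree. -/
lemma proj_vecMul (σ : L ≃ₐ[ℚ] L) (ψ : Fin d → ℤ) :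
    (s.rep.proj (Matrix.vecMul ψ (s.galMat σ))).map σ = s.rep.proj ψ := by
  have hinv : ∀ ψ, Matrix.vecMul (Matrix.vecMul ψ (s.galMat σ)) (s.galMat σ⁻¹) = ψ := fun ψ => by
    rw [Matrix.vecMul_vecMul, galMat_mul_inv, Matrix.vecMul_one]
  have hinj : Function.Injective fun ψ => Matrix.vecMul ψ (s.galMat σ) :=
    fun x y hxy => by
    rw [← hinv x, ← hinv y]
    exact congrArg (fun z => Matrix.vecMul z (s.galMat σ⁻¹)) hxy
  have h := (s.rep.twist (σ : L →+* L)).proj_eq_of_app_eq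
    (s.rep.weights.image fun ψ => Matrix.vecMul ψ (s.galMat σ))
    (fun χ => s.rep.proj (Matrix.vecMul χ (s.galMat σ⁻¹))) (by
      change (s.rep.app _ ((algebraMap L _).comp (σ : L →+* L)) _).val = _
      rw [s.app_comp, s.rep.app_eq, Finset.sum_image fun _ _ _ _ h => hinj h]
      refine Finset.sum_congr rfl fun χ _ => ?_
      rw [charVal_monoMap, hinv]) (Matrix.vecMul ψ (s.galMat σ))
  rw [TorusRep.proj_twist] at h
  refine h.trans ?_
  rw [hinv]
  split_ifs with hmem
  · rfl
  · by_contra hne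
    exact hmem (Finset.mem_image_of_mem _ (s.rep.mem_weights.mpr (Ne.symm hne)))

lemma vecMul_mem_weights (σ : L ≃ₐ[ℚ] L) {ψ : Fin d → ℤ} (hψ : ψ ∈ s.rep.weights) :
    Matrix.vecMul ψ (s.galMat σ) ∈ s.rep.weights := by
  rw [TorusRep.mem_weights] at hψ ⊢
  intro h
  apply hψ
  rw [← s.proj_vecMul σ, h, Matrix.map_zero _ (map_zero σ)]

/-- An automorphism acting trivially on the lattice fixes all projectors, and the weights generate,
so the action on the set of weights is faithful. The base `n + 1` instead of `n` stays positive, as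
is needed to enlarge the exponent. -/
lemma card_gal_le [Fintype (L ≃ₐ[ℚ] L)]
    (hfix : ∀ σ : L ≃ₐ[ℚ] L, (∀ χ, (s.rep.proj χ).map σ = s.rep.proj χ) → σ = 1) :
    Fintype.card (L ≃ₐ[ℚ] L) ≤ (n + 1) ^ n := by
  have hinj : Function.Injective s.galMat := by
    rw [injective_iff_map_eq_one]
    intro σ hσ
    refine hfix σ fun χ => ?_
    have := s.proj_vecMul σ χ
    rwa [hσ, Matrix.vecMul_one] at this
  let act : (L ≃ₐ[ℚ] L) → (s.rep.weights → s.rep.weights) := fun σ ψ =>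
    ⟨Matrix.vecMul ψ.1 (s.galMat σ), s.vecMul_mem_weights σ ψ.2⟩
  have hact : Function.Injective act := by
    intro σ τ h
    apply hinj
    have hv : ∀ x ∈ AddSubgroup.closure (s.rep.weights : Set (Fin d → ℤ)),
        Matrix.vecMul x (s.galMat σ) = Matrix.vecMul x (s.galMat τ) := fun x hx => by
      induction hx using AddSubgroup.closure_induction with
      | mem x hx => exact congrArg Subtype.val (congrFun h ⟨x, hx⟩)
      | zero => simp
      | add x y _ _ h1 h2 => rw [Matrix.add_vecMul, Matrix.add_vecMul, h1, h2]
      | neg x _ h1 => rw [Matrix.neg_vecMul, Matrix.neg_vecMul, h1]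
    rw [s.closure_weights] at hv
    funext i
    have := hv (Pi.single i 1) (AddSubgroup.mem_top _)
    rwa [Matrix.single_one_vecMul, Matrix.single_one_vecMul] at this
  have h := Fintype.card_le_of_injective act hact
  rw [Fintype.card_fun, Fintype.card_coe] at h
  calc _ ≤ _ := h
    _ ≤ (n + 1) ^ s.rep.weights.card :=
      Nat.pow_le_pow_left (s.rep.weights_card_le.trans (Nat.le_succ n)) _
    _ ≤ _ := Nat.pow_le_pow_right (Nat.succ_pos n) s.rep.weights_card_le

/-- The coordinates over `L ⊗ R` of the points of the torus over `R`. -/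
noncomputable def coord (R : Type) [CommRing R] [Algebra ℚ R] :
    M.points R →* (Fin d → (L ⊗[ℚ] R)ˣ) :=
  s.pull (Algebra.TensorProduct.includeLeftRingHom : L →+* L ⊗[ℚ] R)
    ((Matrix.GeneralLinearGroup.map
      (Algebra.TensorProduct.includeRight : R →ₐ[ℚ] L ⊗[ℚ] R).toRingHom).comp
        (M.points R).subtype) (fun g => by
      rw [s.range_app]
      exact M.map_mem_points _ g.2)

lemma app_coord {R : Type} [CommRing R] [Algebra ℚ R] (x : M.points R) :
    s.rep.app (L ⊗[ℚ] R) Algebra.TensorProduct.includeLeftRingHom (s.coord R x) =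
      Matrix.GeneralLinearGroup.map
        (Algebra.TensorProduct.includeRight : R →ₐ[ℚ] L ⊗[ℚ] R).toRingHom x.1 :=
  s.app_pull _ _ _ x

/-- The action of a Galois automorphism on the units of `L ⊗ R`. -/
noncomputable def _root_.ShimuraTorus.galUnits (R : Type) [CommRing R] [Algebra ℚ R]
    (σ : L ≃ₐ[ℚ] L) : (L ⊗[ℚ] R)ˣ →* (L ⊗[ℚ] R)ˣ :=
  Units.map (Algebra.TensorProduct.map σ.toAlgHom (AlgHom.id ℚ R) : L ⊗[ℚ] R →* L ⊗[ℚ] R)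

lemma galAct_app {R : Type} [CommRing R] [Algebra ℚ R] (σ : L ≃ₐ[ℚ] L)
    (u : Fin d → (L ⊗[ℚ] R)ˣ) :
    galAct R σ (s.rep.app (L ⊗[ℚ] R) Algebra.TensorProduct.includeLeftRingHom u) =
      s.rep.app (L ⊗[ℚ] R) Algebra.TensorProduct.includeLeftRingHom
        (monoMap (s.galMat σ) fun k => galUnits R σ (u k)) := by
  rw [← s.app_comp, galAct, ← s.rep.natural]
  congr 2

lemma galAct_map_includeRight {R : Type} [CommRing R] [Algebra ℚ R] (σ : L ≃ₐ[ℚ] L)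
    (x : GL (Fin n) R) :
    galAct R σ (Matrix.GeneralLinearGroup.map
        (Algebra.TensorProduct.includeRight : R →ₐ[ℚ] L ⊗[ℚ] R).toRingHom x) =
      Matrix.GeneralLinearGroup.map
        (Algebra.TensorProduct.includeRight : R →ₐ[ℚ] L ⊗[ℚ] R).toRingHom x := by
  ext a b
  simp [galAct]

lemma includeRight_inj (L R : Type) [Field L] [Algebra ℚ L] [CommRing R] [Algebra ℚ R] :
    Function.Injective (Algebra.TensorProduct.includeRight : R →ₐ[ℚ] L ⊗[ℚ] R).toRingHom :=
  Algebra.TensorProduct.includeRight_injective (A := L) (B := R) (algebraMap ℚ L).injective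

lemma monoMap_galUnits_coord {R : Type} [CommRing R] [Algebra ℚ R] (σ : L ≃ₐ[ℚ] L)
    (x : M.points R) :
    monoMap (s.galMat σ) (fun k => galUnits R σ (s.coord R x k)) = s.coord R x := by
  apply s.inj _ Algebra.TensorProduct.includeLeftRingHom
  rw [← s.galAct_app, app_coord, galAct_map_includeRight]

lemma galUnits_coord {R : Type} [CommRing R] [Algebra ℚ R] (σ : L ≃ₐ[ℚ] L)
    (x : M.points R) :
    (fun k => galUnits R σ (s.coord R x k)) = monoMap (s.galMat σ⁻¹) (s.coord R x) := by
  conv_rhs => rw [← s.monoMap_galUnits_coord σ x, ← monoMap_mul, galMat_inv_mul, monoMap_one]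

lemma coord_injective (R : Type) [CommRing R] [Algebra ℚ R] :
    Function.Injective (s.coord R) := fun x y h => by
  have h' := congrArg (s.rep.app (L ⊗[ℚ] R) Algebra.TensorProduct.includeLeftRingHom) h
  rw [app_coord, app_coord] at h'
  exact Subtype.ext (GL_map_injective (includeRight_inj L R) h')

/-- The elements of `L ⊗ R` invariant under the Galois group come from `R`. -/
lemma _root_.ShimuraTorus.exists_of_galois_fixed [FiniteDimensional ℚ L] [IsGalois ℚ L]
    {R : Type} [CommRing R] [Algebra ℚ R] (y : L ⊗[ℚ] R)
    (hy : ∀ σ : L ≃ₐ[ℚ] L, Algebra.TensorProduct.map σ.toAlgHom (AlgHom.id ℚ R) y = y) :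
    ∃ r : R, (Algebra.TensorProduct.includeRight : R →ₐ[ℚ] L ⊗[ℚ] R) r = y := by
  have hsum : ∀ z : L ⊗[ℚ] R, ∃ r : R, (Algebra.TensorProduct.includeRight : R →ₐ[ℚ] L ⊗[ℚ] R) r =
      ∑ σ : L ≃ₐ[ℚ] L, Algebra.TensorProduct.map σ.toAlgHom (AlgHom.id ℚ R) z := by
    intro z
    induction z with
    | zero => exact ⟨0, by simp⟩
    | add x y hx hy =>
      obtain ⟨a, ha⟩ := hx
      obtain ⟨b, hb⟩ := hy
      exact ⟨a + b, by simp only [map_add, ha, hb, Finset.sum_add_distrib]⟩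
    | tmul l r =>
      refine ⟨Algebra.trace ℚ L l • r, ?_⟩
      simp only [Algebra.TensorProduct.includeRight_apply, Algebra.TensorProduct.map_tmul,
        AlgHom.coe_id, id]
      rw [← TensorProduct.sum_tmul, TensorProduct.tmul_smul, TensorProduct.smul_tmul',
        ← Algebra.algebraMap_eq_smul_one, trace_eq_sum_automorphisms]
      rfl
  obtain ⟨r, hr⟩ := hsum y
  simp only [hy, Finset.sum_const, Finset.card_univ] at hr
  have hc : (Fintype.card (L ≃ₐ[ℚ] L) : ℚ) ≠ 0 := by exact_mod_cast Fintype.card_ne_zero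
  refine ⟨(Fintype.card (L ≃ₐ[ℚ] L) : ℚ)⁻¹ • r, ?_⟩
  rw [map_smul, hr, ← Nat.cast_smul_eq_nsmul ℚ, smul_smul, inv_mul_cancel₀ hc, one_smul]

/-- Invariant coordinates give a matrix over `L ⊗ R` with invariant entries, and likewise for the
inverse matrix. Both descend to `R` by Galois descent. -/
lemma mem_range_coord [FiniteDimensional ℚ L] [IsGalois ℚ L] {R : Type} [CommRing R]
    [Algebra ℚ R] (u : Fin d → (L ⊗[ℚ] R)ˣ) :
    u ∈ (s.coord R).range ↔
      ∀ σ : L ≃ₐ[ℚ] L, monoMap (s.galMat σ) (fun k => galUnits R σ (u k)) = u := by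
  constructor
  · rintro ⟨x, rfl⟩ σ
    exact s.monoMap_galUnits_coord σ x
  · intro h
    set i : L →+* L ⊗[ℚ] R := Algebra.TensorProduct.includeLeftRingHom
    have hfix : ∀ (v : Fin d → (L ⊗[ℚ] R)ˣ),
        (∀ σ : L ≃ₐ[ℚ] L, monoMap (s.galMat σ) (fun k => galUnits R σ (v k)) = v) → ∀ a b,
        ∃ r : R, (Algebra.TensorProduct.includeRight : R →ₐ[ℚ] L ⊗[ℚ] R) r =
          (s.rep.app _ i v).val a b := fun v hv a b =>
      exists_of_galois_fixed _ fun σ => by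
        have := s.galAct_app σ v
        rw [hv] at this
        exact congrFun (congrFun (congrArg (fun z : GL (Fin n) (L ⊗[ℚ] R) => z.val) this) a) b
    choose X hX using hfix u h
    choose Y hY using hfix u⁻¹ (fun σ => by
      rw [← inv_inj (a := monoMap _ _), inv_inv, ← map_inv, ← h σ]
      congr 1
      ext1 k
      simp [h σ])
    have hXm : (Matrix.of X).map (Algebra.TensorProduct.includeRight : R →ₐ[ℚ] L ⊗[ℚ] R) =
      (s.rep.app _ i u).val := by ext a b; exact hX a b
    have hYm : (Matrix.of Y).map (Algebra.TensorProduct.includeRight : R →ₐ[ℚ] L ⊗[ℚ] R) =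
      (s.rep.app _ i u⁻¹).val := by ext a b; exact hY a b
    have hinj := Matrix.map_injective (m := Fin n) (n := Fin n) (includeRight_inj L R)
    have hXY : Matrix.of X * Matrix.of Y = 1 := hinj <| by
      dsimp only
      rw [Matrix.map_mul, Matrix.map_one _ (map_zero _) (map_one _)]
      refine (congrArg₂ (· * ·) hXm hYm).trans ?_
      rw [map_inv, Units.mul_inv]
    let g : GL (Fin n) R := ⟨Matrix.of X, Matrix.of Y, hXY, mul_eq_one_comm.mp hXY⟩
    have hg : Matrix.GeneralLinearGroup.map
        (Algebra.TensorProduct.includeRight : R →ₐ[ℚ] L ⊗[ℚ] R).toRingHom g =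
        s.rep.app _ i u := Units.ext hXm
    have hgM : g ∈ M.points R := M.mem_points_of_injective (includeRight_inj L R)
      (hg ▸ s.mem _ i u)
    exact ⟨⟨g, hgM⟩, s.inj _ i ((s.app_coord ⟨g, hgM⟩).trans hg)⟩

end Splitting

end ShimuraTorus

/-! ### The reciprocity morphism in coordinates. -/

namespace ShimuraTorus

namespace Splitting

variable {n : ℕ} {M : AlgSubgroup n} {L : Type} [Field L] {d : ℕ} (s : Splitting M L d)
  [Algebra ℚ L]

/-- A cocharacter of the torus is a vector of integers. -/
lemma exists_cocharVec (μ : Cocharacter L n)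
    (hμ : ∀ (B : Type) [CommRing B] [Algebra ℚ B] [Algebra L B] (t : Bˣ),
      μ.app B t ∈ M.points B) :
    ∃ a : Fin d → ℤ, ∀ (B : Type) [CommRing B] [Algebra L B] (t : Bˣ),
      μ.app B t = s.rep.app B (algebraMap L B) fun k => t ^ a k := by
  let ev : ∀ B : Type, [CommRing B] → (Fin 1 → Bˣ) →* Bˣ := fun B _ =>
    Pi.evalMonoidHom (fun _ : Fin 1 => Bˣ) 0
  have hmem : ∀ (B : Type) [CommRing B] (i : L →+* B) (t : Fin 1 → Bˣ),
      (@Cocharacter.app L _ n μ B _ i.toAlgebra).comp (ev B) t ∈ (s.rep.app B i).range := by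
    intro B _ i t
    letI : Algebra ℚ B := (i.comp (algebraMap ℚ L)).toAlgebra
    letI := i.toAlgebra
    rw [s.range_app]
    exact hμ B (t 0)
  obtain ⟨A, hA⟩ := exists_monoMap_eq (L := L) (d := 1) (e := d)
    (fun B _ i => s.pull i ((@Cocharacter.app L _ n μ B _ i.toAlgebra).comp (ev B)) (hmem B i))
    (fun B C _ _ i f u k => by
      refine congrFun (s.inj C (f.comp i) (a₂ := fun k => Units.map (f : B →* C)
        (s.pull i ((@Cocharacter.app L _ n μ B _ i.toAlgebra).comp (ev B)) (hmem B i) u k)) ?_) k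
      rw [app_pull, s.rep.natural, app_pull]
      letI := i.toAlgebra
      letI := (f.comp i).toAlgebra
      exact μ.natural B C ({ f with commutes' := fun _ => rfl } : B →ₐ[L] C) (u 0))
  refine ⟨fun k => A k 0, fun B _ inst t => ?_⟩
  have h := s.app_pull (algebraMap L B) _ (hmem B (algebraMap L B)) (fun _ => t)
  have hi : (algebraMap L B).toAlgebra = inst := Algebra.algebra_ext _ _ fun _ => rfl
  have h2 : @Cocharacter.app L _ n μ B _ (algebraMap L B).toAlgebra t = μ.app B t := by rw [hi]
  rw [hA] at h
  refine h2.symm.trans (h.symm.trans ?_)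
  congr 1
  ext1 k
  exact Fintype.prod_unique fun j : Fin 1 => t ^ A k j

variable [FiniteDimensional ℚ L]

lemma galNorm_app {R : Type} [CommRing R] [Algebra ℚ R] (v : Fin d → (L ⊗[ℚ] R)ˣ) :
    galNorm R (s.rep.app (L ⊗[ℚ] R) Algebra.TensorProduct.includeLeftRingHom v) =
      s.rep.app (L ⊗[ℚ] R) Algebra.TensorProduct.includeLeftRingHom
        (∏ σ : L ≃ₐ[ℚ] L, monoMap (s.galMat σ) fun k => galUnits R σ (v k)) := by
  simp only [galNorm, s.galAct_app]
  rw [← Finset.prod_map_toList, map_list_prod, List.map_map]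
  rfl

variable (μ : Cocharacter L n) (a : Fin d → ℤ)
  (ha : ∀ (B : Type) [CommRing B] [Algebra L B] (t : Bˣ),
    μ.app B t = s.rep.app B (algebraMap L B) fun k => t ^ a k)
  (r : ResHom L M)
  (hr : ∀ (R : Type) [CommRing R] [Algebra ℚ R] (t : (L ⊗[ℚ] R)ˣ),
      Matrix.GeneralLinearGroup.map
          (Algebra.TensorProduct.includeRight : R →ₐ[ℚ] L ⊗[ℚ] R).toRingHom
          (r.app R t : GL (Fin n) R) =
        galNorm R (μ.app (L ⊗[ℚ] R) t))

include ha hr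

lemma coord_reciprocity {R : Type} [CommRing R] [Algebra ℚ R] (t : (L ⊗[ℚ] R)ˣ) :
    s.coord R (r.app R t) =
      ∏ σ : L ≃ₐ[ℚ] L, monoMap (s.galMat σ) fun k => galUnits R σ t ^ a k := by
  apply s.inj _ Algebra.TensorProduct.includeLeftRingHom
  rw [app_coord, hr, ha]
  refine (s.galNorm_app _).trans ?_
  simp only [map_zpow]

/-- For a point `x` over `R`, `σ (χ x)` is `χ` evaluated at the coordinates transformed by `σ⁻¹`.
Hence the norm defining `r` applies the matrix `∑ σ (a ⊗ χ) σ⁻¹` to the coordinates, and this matrix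
is `m`. -/
lemma reciprocity_section {χ : Fin d → ℤ} {m : ℕ}
    (hχ : ∑ σ, s.galMat σ * Matrix.vecMulVec a χ * s.galMat σ⁻¹ =
      (m : ℤ) • (1 : Matrix (Fin d) (Fin d) ℤ))
    {R : Type} [CommRing R] [Algebra ℚ R] (x : M.points R) :
    r.app R (charVal χ (s.coord R x)) = x ^ m := by
  apply s.coord_injective R
  rw [s.coord_reciprocity μ a ha r hr, map_pow, ← zpow_natCast, ← monoMap_smul_one, ← hχ,
    monoMap_sum]
  refine Finset.prod_congr rfl fun σ _ => ?_
  rw [monoMap_mul, monoMap_mul, ← s.galUnits_coord, monoMap_vecMulVec, map_charVal]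

end Splitting

end ShimuraTorus

/-! ### Coordinates `z`, `z̄` on the Deligne torus, and separation of `L ⊗ R` by embeddings. -/

namespace ShimuraTorus

section DeligneTorus

variable (A : Type) [CommRing A] [Algebra ℂ A]

/-- The idempotent of `ℂ ⊗ A` on which `z = 1` and `z̄ = 0`. -/
noncomputable def idemZ : ℂ ⊗[ℝ] A :=
  (1 / 2 : ℝ) • ((1 : ℂ) ⊗ₜ[ℝ] (1 : A) - Complex.I ⊗ₜ[ℝ] (Complex.I • (1 : A)))

/-- The idempotent of `ℂ ⊗ A` on which `z = 0` and `z̄ = 1`. -/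
noncomputable def idemZbar : ℂ ⊗[ℝ] A :=
  (1 / 2 : ℝ) • ((1 : ℂ) ⊗ₜ[ℝ] (1 : A) + Complex.I ⊗ₜ[ℝ] (Complex.I • (1 : A)))

variable {A}

@[simp] lemma charZ_tmul (w : ℂ) (x : A) : charZ A (w ⊗ₜ x) = w • x := by
  simp [charZ, Algebra.smul_def]

@[simp] lemma charZbar_tmul (w : ℂ) (x : A) :
    charZbar A (w ⊗ₜ x) = (starRingEnd ℂ w) • x := by
  simp [charZbar, Algebra.smul_def]

lemma idemZ_add_idemZbar : idemZ A + idemZbar A = 1 := by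
  rw [idemZ, idemZbar, ← smul_add, sub_add_add_cancel, ← two_smul ℝ, smul_smul]
  norm_num
  rfl

lemma charZ_idemZ : charZ A (idemZ A) = 1 := by
  rw [idemZ, map_smul, map_sub, charZ_tmul, charZ_tmul, smul_smul, Complex.I_mul_I, one_smul,
    neg_smul, one_smul, sub_neg_eq_add, ← two_smul ℝ, smul_smul]
  norm_num

lemma charZbar_idemZ : charZbar A (idemZ A) = 0 := by
  rw [idemZ, map_smul, map_sub, charZbar_tmul, charZbar_tmul, smul_smul, Complex.conj_I,
    neg_mul, Complex.I_mul_I]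
  simp

lemma charZ_idemZbar : charZ A (idemZbar A) = 0 := by
  have h := congrArg (charZ A) (idemZ_add_idemZbar (A := A))
  rw [map_add, charZ_idemZ, map_one] at h
  simpa using h

lemma charZbar_idemZbar : charZbar A (idemZbar A) = 1 := by
  have h := congrArg (charZbar A) (idemZ_add_idemZbar (A := A))
  rwa [map_add, charZbar_idemZ, map_one, zero_add] at h

/-- The two characters of the Deligne torus are coordinates. -/
lemma eq_idem_mul (x : ℂ ⊗[ℝ] A) :
    x = idemZ A * (1 ⊗ₜ charZ A x) + idemZbar A * (1 ⊗ₜ charZbar A x) := by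
  induction x with
  | zero => simp
  | add x y hx hy =>
    conv_lhs => rw [hx, hy]
    simp only [map_add, TensorProduct.tmul_add, mul_add]
    ring
  | tmul w x =>
    have hw : w ⊗ₜ[ℝ] x = w.re • ((1 : ℂ) ⊗ₜ[ℝ] x) + w.im • (Complex.I ⊗ₜ[ℝ] x) := by
      rw [TensorProduct.smul_tmul', TensorProduct.smul_tmul', ← TensorProduct.add_tmul]
      congr 1
      simp [Complex.re_add_im]
    have h1 : (1 : ℂ) ⊗ₜ[ℝ] x = idemZ A * (1 ⊗ₜ charZ A ((1 : ℂ) ⊗ₜ[ℝ] x)) +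
        idemZbar A * (1 ⊗ₜ charZbar A ((1 : ℂ) ⊗ₜ[ℝ] x)) := by
      rw [charZ_tmul, charZbar_tmul, map_one, one_smul, ← add_mul, idemZ_add_idemZbar, one_mul]
    have h2 : Complex.I ⊗ₜ[ℝ] x = idemZ A * (1 ⊗ₜ charZ A (Complex.I ⊗ₜ[ℝ] x)) +
        idemZbar A * (1 ⊗ₜ charZbar A (Complex.I ⊗ₜ[ℝ] x)) := by
      have e1 : idemZ A * (1 ⊗ₜ (Complex.I • x)) =
          (1 / 2 : ℝ) • (1 ⊗ₜ (Complex.I • x) + Complex.I ⊗ₜ x) := by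
        rw [idemZ, smul_mul_assoc, sub_mul, Algebra.TensorProduct.tmul_mul_tmul,
          Algebra.TensorProduct.tmul_mul_tmul, smul_mul_smul_comm, Complex.I_mul_I]
        simp [TensorProduct.tmul_neg]
      have e2 : idemZbar A * (1 ⊗ₜ ((-Complex.I) • x)) =
          (1 / 2 : ℝ) • (-(1 ⊗ₜ (Complex.I • x)) + Complex.I ⊗ₜ x) := by
        rw [idemZbar, smul_mul_assoc, add_mul, Algebra.TensorProduct.tmul_mul_tmul,
          Algebra.TensorProduct.tmul_mul_tmul, smul_mul_smul_comm, mul_neg, Complex.I_mul_I]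
        simp [TensorProduct.tmul_neg]
      rw [charZ_tmul, charZbar_tmul, Complex.conj_I, e1, e2, ← smul_add]
      have e3 : (1 : ℂ) ⊗ₜ[ℝ] (Complex.I • x) + Complex.I ⊗ₜ[ℝ] x +
          (-((1 : ℂ) ⊗ₜ[ℝ] (Complex.I • x)) + Complex.I ⊗ₜ[ℝ] x) =
          (2 : ℝ) • (Complex.I ⊗ₜ[ℝ] x) := by
        rw [two_smul]
        abel
      rw [e3, smul_smul]
      norm_num
    rw [hw, map_add, map_add, map_smul, map_smul, map_smul, map_smul, TensorProduct.tmul_add,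
      TensorProduct.tmul_add, TensorProduct.tmul_smul, TensorProduct.tmul_smul,
      TensorProduct.tmul_smul, TensorProduct.tmul_smul, mul_add, mul_add, mul_smul_comm,
      mul_smul_comm, mul_smul_comm, mul_smul_comm]
    conv_lhs => rw [h1, h2]
    rw [smul_add, smul_add]
    abel

lemma deligne_ext {x y : ℂ ⊗[ℝ] A} (h1 : charZ A x = charZ A y)
    (h2 : charZbar A x = charZbar A y) : x = y := by
  rw [eq_idem_mul x, eq_idem_mul y, h1, h2]

lemma exists_deligne_point (t₁ t₂ : A) :
    ∃ x : ℂ ⊗[ℝ] A, charZ A x = t₁ ∧ charZbar A x = t₂ := by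
  refine ⟨idemZ A * (1 ⊗ₜ t₁) + idemZbar A * (1 ⊗ₜ t₂), ?_, ?_⟩ <;>
  simp [charZ_idemZ, charZbar_idemZ, charZ_idemZbar, charZbar_idemZbar]

/-- The point of the Deligne torus with given coordinates. -/
lemma exists_deligne_unit (t₁ t₂ : Aˣ) :
    ∃ s : (ℂ ⊗[ℝ] A)ˣ, charZ A s = t₁ ∧ charZbar A s = t₂ := by
  obtain ⟨x, hx1, hx2⟩ := exists_deligne_point (t₁ : A) (t₂ : A)
  obtain ⟨y, hy1, hy2⟩ := exists_deligne_point ((t₁⁻¹ : Aˣ) : A) ((t₂⁻¹ : Aˣ) : A)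
  have h : x * y = 1 := deligne_ext (by simp [hx1, hy1]) (by simp [hx2, hy2])
  exact ⟨⟨x, y, h, by rw [mul_comm, h]⟩, hx1, hx2⟩

end DeligneTorus

section Embeddings

/-- The ring homomorphism `L ⊗ R → S` given by homomorphisms on the factors. -/
noncomputable def evalTensor {L R S : Type*} [CommRing L] [CommRing R] [CommRing S] [Algebra ℚ L]
    [Algebra ℚ R] [Algebra ℚ S] (i : L →+* S) (j : R →+* S) : L ⊗[ℚ] R →ₐ[ℚ] S :=
  Algebra.TensorProduct.lift i.toRatAlgHom j.toRatAlgHom fun _ _ => Commute.all _ _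

@[simp] lemma evalTensor_tmul {L R S : Type*} [CommRing L] [CommRing R] [CommRing S] [Algebra ℚ L]
    [Algebra ℚ R] [Algebra ℚ S] (i : L →+* S) (j : R →+* S) (l : L) (x : R) :
    evalTensor i j (l ⊗ₜ x) = i l * j x := rfl

lemma exists_eq_sum_tmul {S A B ι : Type*} [CommRing S] [CommRing A] [CommRing B]
    [Algebra S A] [Algebra S B] [Fintype ι] (b : Module.Basis ι S A) (y : A ⊗[S] B) :
    ∃ c : ι → B, y = ∑ k, b k ⊗ₜ c k := by
  classical
  refine ⟨fun k => (TensorProduct.equivFinsuppOfBasisLeft b y) k, ?_⟩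
  conv_lhs => rw [← (TensorProduct.equivFinsuppOfBasisLeft b).symm_apply_apply y]
  rw [TensorProduct.equivFinsuppOfBasisLeft_symm_apply, Finsupp.sum_fintype]
  simp

/-- An element of `L ⊗ R` is zero if it vanishes under all embeddings of `L` in an
algebraically closed field. -/
theorem tensor_eq_zero_of_embeddings {K L R S : Type*} [Field K] [IsAlgClosed K] [Field L]
    [Algebra ℚ K] [Algebra ℚ L] [FiniteDimensional ℚ L] [CommRing R] [CommRing S] [Algebra ℚ R]
    [Algebra ℚ S] [Algebra K S] (j : R →+* S) (hj : Function.Injective j) (y : L ⊗[ℚ] R)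
    (hy : ∀ τ : L →ₐ[ℚ] K, evalTensor ((algebraMap K S).comp (τ : L →+* K)) j y = 0) : y = 0 := by
  classical
  let b := Module.finBasis ℚ L
  obtain ⟨c, rfl⟩ := exists_eq_sum_tmul b y
  let e : (Fin (Module.finrank ℚ L)) ≃ (L →ₐ[ℚ] K) :=
    (Fintype.equivFinOfCardEq (AlgHom.card ℚ L K)).symm
  let N : Matrix (Fin (Module.finrank ℚ L)) (Fin (Module.finrank ℚ L)) K :=
    fun k l => e l (b k)
  -- The square of this determinant is the discriminant of the basis, nonzero by separability. So
  -- the values at all embeddings determine the coordinates of the tensor.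
  have hN : N.det ≠ 0 := by
    intro h0
    have h1 := Algebra.discr_eq_det_embeddingsMatrixReindex_pow_two ℚ K b e
    have h2 : Algebra.embeddingsMatrixReindex ℚ K b e = N := by
      ext k l
      simp [N, Algebra.embeddingsMatrixReindex, Algebra.embeddingsMatrix]
    rw [h2, h0, zero_pow two_ne_zero] at h1
    exact Algebra.discr_not_zero_of_basis ℚ b
      ((algebraMap ℚ K).injective (h1.trans (map_zero _).symm))
  have hv : Matrix.vecMul (fun k => j (c k)) (N.map (algebraMap K S)) = 0 := by
    ext l
    have := hy (e l)
    rw [map_sum] at this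
    simp only [evalTensor_tmul, RingHom.comp_apply] at this
    simp only [Matrix.vecMul, dotProduct, Matrix.map_apply, N, Pi.zero_apply]
    rw [← this]
    exact Finset.sum_congr rfl fun k _ => mul_comm _ _
  have hc : ∀ k, j (c k) = 0 := by
    have h := congrArg (fun v => Matrix.vecMul v (N⁻¹.map (algebraMap K S))) hv
    simp only [Matrix.vecMul_vecMul, Matrix.zero_vecMul] at h
    rw [← Matrix.map_mul, Matrix.mul_nonsing_inv _ (isUnit_iff_ne_zero.mpr hN),
      Matrix.map_one _ (map_zero _) (map_one _), Matrix.vecMul_one] at h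
    exact fun k => congrFun h k
  refine Finset.sum_eq_zero fun k _ => ?_
  rw [hj ((hc k).trans (map_zero j).symm), TensorProduct.tmul_zero]

end Embeddings

end ShimuraTorus

/-! ### Kernels of characters as algebraic groups over `ℚ`. -/

namespace ShimuraTorus

lemma charVal_zpow {ι G : Type*} [Fintype ι] [CommGroup G] (χ a : ι → ℤ) (t : G) :
    charVal χ (fun k => t ^ a k) = t ^ (χ ⬝ᵥ a) := by
  have h : ∀ k, (t ^ a k) ^ χ k = t ^ (χ k * a k) := fun k => by
    rw [← zpow_mul, mul_comm]
  simp only [charVal, h, dotProduct]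
  classical
  induction (Finset.univ : Finset ι) using Finset.induction_on with
  | empty => simp
  | insert k S hk ih => rw [Finset.prod_insert hk, Finset.sum_insert hk, zpow_add, ih]

section Restriction

variable {L : Type} [Field L] [Algebra ℚ L]

/-- The polynomial with rational coefficients obtained by applying a linear form to the
coefficients. -/
noncomputable def coeffForm {σ : Type*} (φ : L →ₗ[ℚ] ℚ) (f : MvPolynomial σ L) :
    MvPolynomial σ ℚ :=
  ∑ m ∈ f.support, MvPolynomial.monomial m (φ (f.coeff m))

lemma aeval_coeffForm {σ : Type*} (φ : L →ₗ[ℚ] ℚ) (f : MvPolynomial σ L) {R : Type*}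
    [CommRing R] [Algebra ℚ R] (x : σ → R) :
    MvPolynomial.aeval x (coeffForm φ f) = TensorProduct.lid ℚ R (φ.rTensor R
      (MvPolynomial.eval₂ (Algebra.TensorProduct.includeLeftRingHom : L →+* L ⊗[ℚ] R)
        (fun j => (Algebra.TensorProduct.includeRight : R →ₐ[ℚ] L ⊗[ℚ] R) (x j)) f)) := by
  rw [coeffForm, map_sum, MvPolynomial.eval₂_eq, map_sum, map_sum]
  refine Finset.sum_congr rfl fun m _ => ?_
  rw [MvPolynomial.aeval_monomial]
  simp only [← map_pow, ← map_prod]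
  simp only [Finsupp.prod, Algebra.TensorProduct.includeRight_apply,
    Algebra.TensorProduct.includeLeftRingHom_apply, Algebra.TensorProduct.tmul_mul_tmul, mul_one,
    one_mul, LinearMap.rTensor_tmul, TensorProduct.lid_tmul, Algebra.smul_def]

lemma eq_zero_of_forms [FiniteDimensional ℚ L] {R : Type*} [CommRing R] [Algebra ℚ R]
    (y : L ⊗[ℚ] R) (hy : ∀ φ : L →ₗ[ℚ] ℚ, TensorProduct.lid ℚ R (φ.rTensor R y) = 0) :
    y = 0 := by
  obtain ⟨c, rfl⟩ := exists_eq_sum_tmul (Module.finBasis ℚ L) y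
  refine Finset.sum_eq_zero fun k _ => ?_
  have h := hy ((Module.finBasis ℚ L).coord k)
  rw [map_sum, map_sum] at h
  simp only [LinearMap.rTensor_tmul, TensorProduct.lid_tmul, Module.Basis.coord_apply,
    Module.Basis.repr_self, Finsupp.single_apply, ite_smul, one_smul, zero_smul,
    Finset.sum_ite_eq', Finset.mem_univ, if_true] at h
  rw [h, TensorProduct.tmul_zero]

end Restriction

namespace TorusRep

variable {L : Type} [Field L] {d n : ℕ} (ρ : TorusRep L d n)

/-- A character in the span of the weights is a quotient of two polynomials in the matrix
entries. -/
lemma exists_char_fraction (χ : Fin d → ℤ)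
    (hχ : χ ∈ AddSubgroup.closure (ρ.weights : Set (Fin d → ℤ))) :
    ∃ f g : MvPolynomial (Fin n × Fin n) L, ∀ (B : Type) [CommRing B] (i : L →+* B)
      (u : Fin d → Bˣ), ∃ v : Bˣ,
        MvPolynomial.eval₂ i (fun ij => (ρ.app B i u).val ij.1 ij.2) f = v ∧
        MvPolynomial.eval₂ i (fun ij => (ρ.app B i u).val ij.1 ij.2) g =
          (v * charVal χ u : Bˣ) := by
  induction hχ using AddSubgroup.closure_induction with
  | mem χ hχ =>
    obtain ⟨a, b, hab⟩ : ∃ a b, ρ.proj χ a b ≠ 0 := by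
      by_contra! h
      exact ρ.mem_weights.mp hχ (by ext a b; exact h a b)
    refine ⟨1, ∑ c, MvPolynomial.C ((ρ.proj χ a b)⁻¹ * ρ.proj χ a c) * MvPolynomial.X (c, b),
      fun B _ i u => ⟨1, by simp, ?_⟩⟩
    rw [one_mul, ρ.charVal_eq_sum hab i u, MvPolynomial.eval₂_sum]
    simp only [MvPolynomial.eval₂_mul, MvPolynomial.eval₂_C, MvPolynomial.eval₂_X]
  | zero => exact ⟨1, 1, fun B _ i u => ⟨1, by simp, by simp⟩⟩
  | add χ ψ _ _ h1 h2 =>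
    obtain ⟨f1, g1, h1⟩ := h1
    obtain ⟨f2, g2, h2⟩ := h2
    refine ⟨f1 * f2, g1 * g2, fun B _ i u => ?_⟩
    obtain ⟨v1, hv1, hw1⟩ := h1 B i u
    obtain ⟨v2, hv2, hw2⟩ := h2 B i u
    refine ⟨v1 * v2, by rw [MvPolynomial.eval₂_mul, hv1, hv2, Units.val_mul], ?_⟩
    rw [MvPolynomial.eval₂_mul, hw1, hw2, ← Units.val_mul, charVal_add, mul_mul_mul_comm]
  | neg χ _ h1 =>
    obtain ⟨f1, g1, h1⟩ := h1
    refine ⟨g1, f1, fun B _ i u => ?_⟩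
    obtain ⟨v1, hv1, hw1⟩ := h1 B i u
    exact ⟨v1 * charVal χ u, hw1, by rw [hv1, charVal_neg, mul_inv_cancel_right]⟩

end TorusRep

namespace Splitting

variable {n : ℕ} {M : AlgSubgroup n} {L : Type} [Field L] {d : ℕ} (s : Splitting M L d)
  [Algebra ℚ L]

/-- Writing `χ` as `g / f` with `f` invertible on the torus, the equation `χ = 1` becomes `g - f =
0`. An honest polynomial is needed, as the equations of an `AlgSubgroup` are polynomials in the
matrix entries. -/
lemma exists_char_poly (χ : Fin d → ℤ) :
    ∃ f : MvPolynomial (Fin n × Fin n) L, ∀ (B : Type) [CommRing B] (i : L →+* B)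
      (u : Fin d → Bˣ),
        MvPolynomial.eval₂ i (fun ij => (s.rep.app B i u).val ij.1 ij.2) f = 0 ↔
          charVal χ u = 1 := by
  obtain ⟨f, g, h⟩ := s.rep.exists_char_fraction χ (s.closure_weights ▸ AddSubgroup.mem_top χ)
  refine ⟨g - f, fun B _ i u => ?_⟩
  obtain ⟨v, hv, hw⟩ := h B i u
  rw [MvPolynomial.eval₂_sub, hv, hw, sub_eq_zero, Units.val_inj, mul_eq_left]

variable [FiniteDimensional ℚ L]

/-- The equations of the kernel of `χ : M → Res_{L/ℚ} 𝔾ₘ`. -/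
def charEqns (χ : Fin d → ℤ) : Set (MvPolynomial (Fin n × Fin n) ℚ) :=
  M.eqns ∪ Set.range fun φ : L →ₗ[ℚ] ℚ => coeffForm φ (s.exists_char_poly χ).choose

/-- The polynomial for `χ = 1` has coefficients in `L`. At an `R`-point its value lies in `L ⊗ R`,
and vanishes exactly when all linear forms `L → ℚ` kill it; these are rational equations. -/
lemma mem_charEqns (χ : Fin d → ℤ) {R : Type} [CommRing R] [Algebra ℚ R] (g : GL (Fin n) R) :
    g ∈ solutions (s.charEqns χ) R ↔
      ∃ hg : g ∈ M.points R, charVal χ (s.coord R ⟨g, hg⟩) = 1 := by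
  have key : ∀ hg : g ∈ M.points R, (∀ φ : L →ₗ[ℚ] ℚ, MvPolynomial.aeval
      (fun ij : Fin n × Fin n => (g : Matrix (Fin n) (Fin n) R) ij.1 ij.2)
        (coeffForm φ (s.exists_char_poly χ).choose) = 0) ↔
      charVal χ (s.coord R ⟨g, hg⟩) = 1 := fun hg => by
    rw [← (s.exists_char_poly χ).choose_spec _ Algebra.TensorProduct.includeLeftRingHom,
      s.app_coord]
    simp only [aeval_coeffForm]
    constructor
    · exact fun h => eq_zero_of_forms _ h
    · intro h φ
      refine Eq.trans (congrArg (fun z => TensorProduct.lid ℚ R (φ.rTensor R z)) h) ?_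
      simp
  constructor
  · intro h
    have hg : g ∈ M.points R := fun f hf => h f (Or.inl hf)
    exact ⟨hg, (key hg).mp fun φ => h _ (Or.inr ⟨φ, rfl⟩)⟩
  · rintro ⟨hg, h⟩ f (hf | ⟨φ, rfl⟩)
    · exact hg f hf
    · exact (key hg).mpr h φ

/-- The kernel of the morphism `χ : M → Res_{L/ℚ} 𝔾ₘ`. -/
def charKer (χ : Fin d → ℤ) : AlgSubgroup n where
  eqns := s.charEqns χ
  one_mem R _ _ := (s.mem_charEqns χ 1).mpr ⟨one_mem _, by
    rw [show (⟨1, one_mem _⟩ : M.points R) = 1 from rfl, map_one, charVal_one]⟩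
  mul_mem R _ _ a b ha hb := by
    obtain ⟨ha, ha'⟩ := (s.mem_charEqns χ a).mp ha
    obtain ⟨hb, hb'⟩ := (s.mem_charEqns χ b).mp hb
    refine (s.mem_charEqns χ _).mpr ⟨mul_mem ha hb, ?_⟩
    rw [show (⟨a * b, mul_mem ha hb⟩ : M.points R) = ⟨a, ha⟩ * ⟨b, hb⟩ from rfl, map_mul,
      charVal_mul, ha', hb', one_mul]
  inv_mem R _ _ a ha := by
    obtain ⟨ha, ha'⟩ := (s.mem_charEqns χ a).mp ha
    refine (s.mem_charEqns χ _).mpr ⟨inv_mem ha, ?_⟩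
    rw [show (⟨a⁻¹, inv_mem ha⟩ : M.points R) = (⟨a, ha⟩ : M.points R)⁻¹ from rfl, map_inv]
    simpa [charVal] using ha'

/-- A character that vanishes on `M` over `ℚ` is trivial. -/
lemma eq_zero_of_le_charKer {χ : Fin d → ℤ} (h : M.Le (s.charKer χ)) : χ = 0 := by
  -- The test point is the universal one. Contracting `L ⊗ R` to `R` by multiplication turns its
  -- coordinates back into the universal monomials, on which `χ` takes the value `1` only if it is
  -- zero.
  let R := AddMonoidAlgebra L (Fin d → ℤ)
  let x := s.rep.app R (algebraMap L R) (TorusRep.univPoint L d)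
  have hx : x ∈ M.points R := s.mem R _ _
  obtain ⟨_, h1⟩ := (s.mem_charEqns χ x).mp (h R hx)
  let f : L ⊗[ℚ] R →+* R := (evalTensor (algebraMap L R) (RingHom.id R) : L ⊗[ℚ] R →ₐ[ℚ] R)
  have h2 := congrArg (Matrix.GeneralLinearGroup.map f) (s.app_coord ⟨x, hx⟩)
  rw [← s.rep.natural] at h2
  have e1 : f.comp (Algebra.TensorProduct.includeLeftRingHom : L →+* L ⊗[ℚ] R) =
      algebraMap L R := RingHom.ext fun l => by simp [f]
  have e2 : f.comp (Algebra.TensorProduct.includeRight : R →ₐ[ℚ] L ⊗[ℚ] R).toRingHom =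
      RingHom.id R := RingHom.ext fun l => by simp [f]
  have e3 : Matrix.GeneralLinearGroup.map f (Matrix.GeneralLinearGroup.map
      (Algebra.TensorProduct.includeRight : R →ₐ[ℚ] L ⊗[ℚ] R).toRingHom x) = x :=
    Units.ext (Matrix.ext fun a b => congrArg (fun g => g (x.val a b)) e2)
  rw [e1] at h2
  have h3 := s.inj _ _ (h2.trans e3)
  have h4 := congrArg (Units.map (f : L ⊗[ℚ] R →* R)) h1
  have h5 := map_charVal (Units.map (f : L ⊗[ℚ] R →* R)) χ (s.coord R ⟨x, hx⟩)
  rw [h3, TorusRep.charVal_univPoint] at h5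
  have h6 := h5.symm.trans (h4.trans (map_one _))
  rw [map_eq_one_iff _ (monoUnit_injective L)] at h6
  exact ofAdd_eq_one.mp h6

end Splitting

end ShimuraTorus

/-! ### The Hodge cocharacter and its conjugates generate the Mumford–Tate torus. -/

namespace ShimuraTorus

section Hodge

variable {n : ℕ} {h : DeligneHom n} {L : IntermediateField ℚ ℂ} {μ : Cocharacter L n}

lemma hodge_app_eq (hμ : IsHodgeCocharacter h L μ) {A : Type} [CommRing A] [Algebra ℂ A]
    {s : (ℂ ⊗[ℝ] A)ˣ} {t : Aˣ} (h1 : charZ A s = t) (h2 : charZbar A s = 1) :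
    h.app A s = μ.app A t := by
  rw [hμ A s h2]
  congr 1
  exact Units.ext h1

lemma hodge_app_mem_complex (hμ : IsHodgeCocharacter h L μ) {A : Type} [CommRing A]
    [Algebra ℂ A] [Algebra ℚ A] (t : Aˣ) : μ.app A t ∈ h.mumfordTate.points A := by
  obtain ⟨s, h1, h2⟩ := exists_deligne_unit t 1
  rw [← hodge_app_eq hμ h1 h2]
  exact h.factorsThrough_mumfordTate A s

/-- Over a `ℂ`-algebra `μ(t)` is a value of `h`. The general case follows because `B` embeds in `ℂ
⊗[L] B`. -/
lemma hodge_app_mem (hμ : IsHodgeCocharacter h L μ) (B : Type) [CommRing B] [Algebra ℚ B]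
    [Algebra L B] (t : Bˣ) : μ.app B t ∈ h.mumfordTate.points B := by
  let f : B →ₐ[L] ℂ ⊗[L] B := Algebra.TensorProduct.includeRight
  have hf : Function.Injective f :=
    Algebra.TensorProduct.includeRight_injective (A := ℂ) (B := B) (algebraMap L ℂ).injective
  letI : Algebra ℚ (ℂ ⊗[L] B) := ((f : B →+* ℂ ⊗[L] B).comp (algebraMap ℚ B)).toAlgebra
  refine h.mumfordTate.mem_points_of_injective (f := (f : B →+* ℂ ⊗[L] B)) hf ?_
  rw [← μ.natural B (ℂ ⊗[L] B) f t]
  exact hodge_app_mem_complex hμ _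

/-- The Hodge cocharacter and its complex conjugate determine `h`. -/
lemma deligne_app_eq (hμ : IsHodgeCocharacter h L μ) {E : Type} [CommRing E] [Algebra ℂ E]
    (κ : E →ₐ[ℝ] E) (hκ : ∀ x, κ (κ x) = x)
    (hκc : ∀ c : ℂ, κ (algebraMap ℂ E c) = algebraMap ℂ E (starRingEnd ℂ c))
    (s : (ℂ ⊗[ℝ] E)ˣ) :
    ∃ t₁ t₂ : Eˣ, h.app E s = μ.app E t₁ *
      Matrix.GeneralLinearGroup.map (κ : E →+* E) (μ.app E t₂) := by
  have hsmul : ∀ (c : ℂ) (x : E), κ (c • x) = starRingEnd ℂ c • κ x := fun c x => by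
    rw [Algebra.smul_def, Algebra.smul_def, map_mul, hκc]
  have hz : ∀ x : ℂ ⊗[ℝ] E, charZ E (Algebra.TensorProduct.map (AlgHom.id ℝ ℂ) κ x) =
      κ (charZbar E x) := fun x => by
    induction x with
    | zero => simp
    | add x y hx hy => rw [map_add, map_add, hx, hy, map_add, map_add]
    | tmul w x => simp [hsmul]
  have hzbar : ∀ x : ℂ ⊗[ℝ] E, charZbar E (Algebra.TensorProduct.map (AlgHom.id ℝ ℂ) κ x) =
      κ (charZ E x) := fun x => by
    induction x with
    | zero => simp
    | add x y hx hy => rw [map_add, map_add, hx, hy, map_add, map_add]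
    | tmul w x => simp [hsmul]
  -- The point is split as `(z, 1) · (1, z̄)`. The first factor is a value of `μ`; complex
  -- conjugation `κ` exchanges the two coordinates, so the second is the conjugate of a value of
  -- `μ`.
  obtain ⟨s₁, h1z, h1b⟩ := exists_deligne_unit (Units.map (charZ E : _ →* E) s) 1
  obtain ⟨s₂, h2z, h2b⟩ := exists_deligne_unit 1 (Units.map (charZbar E : _ →* E) s)
  have hs : s = s₁ * s₂ := Units.ext <| deligne_ext
    (by rw [Units.val_mul, map_mul, h1z, h2z]; simp)
    (by rw [Units.val_mul, map_mul, h1b, h2b]; simp)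
  have h3 : h.app E (Units.map (Algebra.TensorProduct.map (AlgHom.id ℝ ℂ) κ :
      ℂ ⊗[ℝ] E →* ℂ ⊗[ℝ] E) s₂) =
      μ.app E (Units.map (κ : E →* E) (Units.map (charZbar E : _ →* E) s)) :=
    hodge_app_eq hμ ((hz _).trans (by rw [h2b]; rfl)) ((hzbar _).trans (by rw [h2z]; simp))
  rw [h.natural] at h3
  refine ⟨Units.map (charZ E : _ →* E) s,
    Units.map (κ : E →* E) (Units.map (charZbar E : _ →* E) s), ?_⟩
  rw [← h3, ← hodge_app_eq hμ h1z h1b]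
  have h4 : Matrix.GeneralLinearGroup.map (κ : E →+* E)
      (Matrix.GeneralLinearGroup.map (κ : E →+* E) (h.app E s₂)) = h.app E s₂ :=
    Units.ext (Matrix.ext fun k l => hκ _)
  rw [h4, ← map_mul, ← hs]

/-- An element of `L ⊗ A` is tested under all embeddings of `L` in `ℂ`, each of which is an
automorphism of `L`. There `h(pt)` is a product of values of conjugates of `μ`, and `χ` pairs to
zero with all of these. -/
lemma hodge_charVal_eq_one [FiniteDimensional ℚ L] (hL : h.mumfordTate.IsSplittingField L) {d : ℕ}
    (s : Splitting h.mumfordTate L d) (hμ : IsHodgeCocharacter h L μ) {a : Fin d → ℤ}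
    (ha : ∀ (B : Type) [CommRing B] [Algebra L B] (t : Bˣ),
      μ.app B t = s.rep.app B (algebraMap L B) fun k => t ^ a k)
    {χ : Fin d → ℤ} (hχ : ∀ σ : L ≃ₐ[ℚ] L, χ ⬝ᵥ (s.galMat σ).mulVec a = 0)
    {A E : Type} [CommRing A] [Algebra ℚ A] [Algebra ℝ A] [CommRing E] [Algebra ℂ E]
    (j : A →ₐ[ℝ] E) (hj : Function.Injective j) (κ : E →ₐ[ℝ] E) (hκ : ∀ x, κ (κ x) = x)
    (hκc : ∀ c : ℂ, κ (algebraMap ℂ E c) = algebraMap ℂ E (starRingEnd ℂ c))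
    (pt : (ℂ ⊗[ℝ] A)ˣ) (hmem : h.app A pt ∈ h.mumfordTate.points A) :
    charVal χ (s.coord A ⟨h.app A pt, hmem⟩) = 1 := by
  letI : Algebra ℚ E := ((algebraMap ℂ E).comp (algebraMap ℚ ℂ)).toAlgebra
  refine Units.ext (sub_eq_zero.mp ?_)
  apply tensor_eq_zero_of_embeddings (K := ℂ) (S := E) (j : A →+* E) hj
  intro τ
  obtain ⟨σ, hσ⟩ := hL.exists_algEquiv τ
  obtain ⟨c, hc⟩ := hL.exists_algEquiv
    (((starRingEnd ℂ).comp (algebraMap L ℂ)).toRatAlgHom)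
  obtain ⟨t₁, t₂, ht⟩ := deligne_app_eq hμ κ hκ hκc (Units.map
    (Algebra.TensorProduct.map (AlgHom.id ℝ ℂ) j : ℂ ⊗[ℝ] A →* ℂ ⊗[ℝ] E) pt)
  rw [h.natural, ha, ha, ← s.rep.natural] at ht
  have hκi : (κ : E →+* E).comp (algebraMap L E) = (algebraMap L E).comp (c : L →+* L) := by
    ext x
    refine (hκc x).trans ?_
    exact congrArg (algebraMap ℂ E) (hc x)
  have hτi : (algebraMap ℂ E).comp (τ : L →+* ℂ) = (algebraMap L E).comp (σ : L →+* L) := by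
    ext x
    exact congrArg (algebraMap ℂ E) (hσ x)
  rw [hκi, s.app_comp, ← map_mul] at ht
  set ev : L ⊗[ℚ] A →+* E :=
    (evalTensor ((algebraMap ℂ E).comp (τ : L →+* ℂ)) (j : A →+* E)).toRingHom with hev
  have e1 : ev.comp (Algebra.TensorProduct.includeLeftRingHom : L →+* L ⊗[ℚ] A) =
      (algebraMap L E).comp (σ : L →+* L) := by
    rw [← hτi]
    exact RingHom.ext fun l => by simp [ev]
  have e2 : ev.comp (Algebra.TensorProduct.includeRight : A →ₐ[ℚ] L ⊗[ℚ] A).toRingHom =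
      (j : A →+* E) := RingHom.ext fun l => by simp [ev]
  have h2 := congrArg (Matrix.GeneralLinearGroup.map ev) (s.app_coord ⟨_, hmem⟩)
  rw [← s.rep.natural, e1, s.app_comp] at h2
  have h3 : Matrix.GeneralLinearGroup.map ev (Matrix.GeneralLinearGroup.map
      (Algebra.TensorProduct.includeRight : A →ₐ[ℚ] L ⊗[ℚ] A).toRingHom (h.app A pt)) =
      Matrix.GeneralLinearGroup.map (j : A →+* E) (h.app A pt) :=
    Units.ext (Matrix.ext fun k l => congrArg (fun g => g ((h.app A pt).val k l)) e2)
  have h4 := s.inj _ _ (h2.trans (h3.trans ht))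
  have h5 := congrArg (charVal (Matrix.vecMul χ (s.galMat σ⁻¹))) h4
  have h6 : ∀ ρ : L ≃ₐ[ℚ] L, Matrix.vecMul χ (s.galMat ρ) ⬝ᵥ a = 0 := fun ρ => by
    rw [← Matrix.dotProduct_mulVec, hχ]
  rw [charVal_monoMap, Matrix.vecMul_vecMul, s.galMat_inv_mul, Matrix.vecMul_one, charVal_mul,
    charVal_zpow, h6, zpow_zero, one_mul, charVal_monoMap, Matrix.vecMul_vecMul, ← map_mul] at h5
  have h7 : charVal χ (fun k => Units.map (ev : L ⊗[ℚ] A →* E)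
      (s.coord A ⟨h.app A pt, hmem⟩ k)) = 1 := by
    rw [h5, show (fun k => (Units.map ((κ : E →+* E) : E →* E)) (t₂ ^ a k)) =
      fun k => (Units.map ((κ : E →+* E) : E →* E) t₂) ^ a k from funext fun k => map_zpow _ _ _,
      charVal_zpow, h6, zpow_zero]
  replace h7 := (map_charVal (Units.map (ev : L ⊗[ℚ] A →* E)) χ
    (s.coord A ⟨h.app A pt, hmem⟩)).trans h7
  have h8 := congrArg Units.val h7
  change ev (_ - 1) = 0
  rw [map_sub, map_one, sub_eq_zero]
  exact h8


/-- The conjugates of the Hodge cocharacter separate the characters of the Mumford–Tate torus. -/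
theorem hodge_separating [FiniteDimensional ℚ L] (hL : h.mumfordTate.IsSplittingField L) {d : ℕ}
    (s : Splitting h.mumfordTate L d) (hμ : IsHodgeCocharacter h L μ) {a : Fin d → ℤ}
    (ha : ∀ (B : Type) [CommRing B] [Algebra L B] (t : Bˣ),
      μ.app B t = s.rep.app B (algebraMap L B) fun k => t ^ a k)
    {χ : Fin d → ℤ} (hχ : ∀ σ : L ≃ₐ[ℚ] L, χ ⬝ᵥ (s.galMat σ).mulVec a = 0) : χ = 0 := by
  apply s.eq_zero_of_le_charKer
  apply h.mumfordTate_le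
  intro A _ _ _ pt
  have hmem := h.factorsThrough_mumfordTate A pt
  let κ₀ : ℂ ⊗[ℝ] A →+* ℂ ⊗[ℝ] A :=
    (Algebra.TensorProduct.map Complex.conjAe.toAlgHom (AlgHom.id ℝ A)).toRingHom
  have hκc : ∀ c : ℂ, κ₀ (algebraMap ℂ (ℂ ⊗[ℝ] A) c) =
      algebraMap ℂ (ℂ ⊗[ℝ] A) (starRingEnd ℂ c) := fun c => by
    change κ₀ (c ⊗ₜ 1) = (starRingEnd ℂ c) ⊗ₜ 1
    simp [κ₀]
  have hκ : ∀ x, κ₀ (κ₀ x) = x := fun x => by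
    induction x with
    | zero => simp
    | add x y hx hy => rw [map_add, map_add, hx, hy]
    | tmul w x => simp [κ₀]
  exact (s.mem_charEqns χ _).mpr ⟨hmem, hodge_charVal_eq_one hL s hμ ha hχ (E := ℂ ⊗[ℝ] A)
    { (Algebra.TensorProduct.includeRight : A →ₐ[ℝ] ℂ ⊗[ℝ] A).toRingHom with
      commutes' := fun r => by
        change (1 : ℂ) ⊗ₜ[ℝ] (algebraMap ℝ A r) = (r : ℂ) ⊗ₜ[ℝ] (1 : A)
        exact (Algebra.TensorProduct.tmul_one_eq_one_tmul (A := ℂ) (B := A) r).symm }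
    (Algebra.TensorProduct.includeRight_injective (A := ℂ) (B := A) (algebraMap ℝ ℂ).injective)
    { κ₀ with
      commutes' := fun r => (hκc r).trans (by rw [Complex.conj_ofReal]; rfl) } hκ hκc pt hmem⟩

end Hodge

end ShimuraTorus

/-! ### A bound on the Hodge weights, uniform over the conjugacy class. -/

namespace ShimuraTorus

section WeightBound

variable {n : ℕ} {h₀ h : DeligneHom n} {L : IntermediateField ℚ ℂ} {μ : Cocharacter L n}

lemma algebraMap_mul_mem {A : Type} [CommRing A] [Algebra ℂ A] (N : Submodule ℂ A) (c : ℂ) {x : A}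
    (hx : x ∈ N) : algebraMap ℂ A c * x ∈ N := by
  rw [← Algebra.smul_def]
  exact N.smul_mem c hx

/-- Conjugation by a real matrix and extraction of a weight are both `ℂ`-linear in the matrix
entries, so a `ℂ`-subspace containing the entries of `h₀` contains the weight values of every
conjugate of `h₀`. -/
lemma weight_value_mem {g : GL (Fin n) ℝ} (hg : DeligneHom.IsConjBy g h₀ h)
    (hμ : IsHodgeCocharacter h L μ) {d : ℕ} (ρ : TorusRep L d n) {a : Fin d → ℤ}
    (ha : ∀ (B : Type) [CommRing B] [Algebra L B] (t : Bˣ),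
      μ.app B t = ρ.app B (algebraMap L B) fun k => t ^ a k)
    {A : Type} [CommRing A] [Algebra ℂ A] (N : Submodule ℂ A) {s : (ℂ ⊗[ℝ] A)ˣ} {t : Aˣ}
    (h1 : charZ A s = t) (h2 : charZbar A s = 1)
    (hN : ∀ i j, (h₀.app A s).val i j ∈ N) {w : Fin d → ℤ} (hw : w ∈ ρ.weights) :
    ((t ^ (w ⬝ᵥ a) : Aˣ) : A) ∈ N := by
  have hmem : ∀ i j, (μ.app A t).val i j ∈ N := fun i j => by
    rw [← hodge_app_eq hμ h1 h2, hg A s, ← map_inv, Units.val_mul, Units.val_mul,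
      Matrix.mul_apply]
    refine N.sum_mem fun c _ => ?_
    rw [Matrix.mul_apply, Finset.sum_mul]
    refine N.sum_mem fun e _ => ?_
    have e1 : ∀ (γ : GL (Fin n) ℝ) i j, (Matrix.GeneralLinearGroup.map (algebraMap ℝ A) γ).val i j =
      algebraMap ℂ A (γ.val i j : ℝ) := fun γ i j => IsScalarTower.algebraMap_apply ℝ ℂ A _
    rw [e1, e1, mul_comm]
    exact algebraMap_mul_mem N _ (algebraMap_mul_mem N _ (hN e c))
  obtain ⟨i, j, hij⟩ : ∃ i j, ρ.proj w i j ≠ 0 := by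
    by_contra! h
    exact ρ.mem_weights.mp hw (Matrix.ext fun i j => h i j)
  rw [← charVal_zpow, ρ.charVal_eq_sum hij (algebraMap L A), ← ha]
  refine N.sum_mem fun c _ => ?_
  exact algebraMap_mul_mem N (((ρ.proj w i j)⁻¹ * ρ.proj w i c : L) : ℂ) (hmem c j)

/-- The Hodge weights of the conjugates of `h₀` are bounded. -/
theorem exists_weight_bound (h₀ : DeligneHom n) : ∃ C : ℕ, ∀ (h : DeligneHom n)
    (g : GL (Fin n) ℝ), DeligneHom.IsConjBy g h₀ h → ∀ (L : IntermediateField ℚ ℂ)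
    (μ : Cocharacter L n), IsHodgeCocharacter h L μ → ∀ (d : ℕ) (ρ : TorusRep L d n)
    (a : Fin d → ℤ), (∀ (B : Type) [CommRing B] [Algebra L B] (t : Bˣ),
      μ.app B t = ρ.app B (algebraMap L B) fun k => t ^ a k) →
    ∀ w ∈ ρ.weights, |w ⬝ᵥ a| ≤ C := by
  obtain ⟨s, h1, h2⟩ := exists_deligne_unit (monoUnit ℂ ℤ (Multiplicative.ofAdd 1)) 1
  classical
  -- The exponents occurring in the Laurent polynomial entries of `h₀` at the universal point `(T,
  -- 1)`. For any conjugate of `h₀` the weight `w` takes the value `T ^ (w ⬝ᵥ a)` there, so this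
  -- pairing is one of these exponents.
  let S : Finset ℤ := Finset.univ.biUnion fun i => Finset.univ.biUnion fun j =>
    ((h₀.app _ s).val i j : AddMonoidAlgebra ℂ ℤ).coeff.support
  let N : Submodule ℂ (AddMonoidAlgebra ℂ ℤ) :=
    { carrier := {x | ∀ k ∉ S, x.coeff k = 0}
      zero_mem' := fun k _ => by simp
      add_mem' := fun {x y} hx hy k hk => by simp [hx k hk, hy k hk]
      smul_mem' := fun c x hx k hk => by simp [hx k hk] }
  refine ⟨S.sup Int.natAbs, fun h g hg L μ hμ d ρ a ha w hw => ?_⟩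
  have hN := weight_value_mem hg hμ ρ ha N h1 h2 (fun i j k hk => by
    by_contra h0
    exact hk (Finset.mem_biUnion.mpr ⟨i, Finset.mem_univ _, Finset.mem_biUnion.mpr
      ⟨j, Finset.mem_univ _, Finsupp.mem_support_iff.mpr h0⟩⟩)) hw
  have hS : w ⬝ᵥ a ∈ S := by
    by_contra h0
    have h3 := hN _ h0
    rw [← map_zpow, ← ofAdd_zsmul, monoUnit_val] at h3
    simp at h3
  rw [Int.abs_eq_natAbs]
  exact_mod_cast Finset.le_sup (f := Int.natAbs) hS

end WeightBound

end ShimuraTorus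

/-! ### Indices of `m`-th powers in unit groups of finite free `ℤ_p`-algebras. -/

namespace ShimuraTorus

section PowerIndex

/-- In a commutative group with a subgroup `N` of finite index, each of whose elements is an `m`-th
power in `N`, the index of the `m`-th powers is at most the order of the `m`-torsion. -/
lemma index_pow_le_card_ker {G : Type*} [CommGroup G] (N : Subgroup G) (hN : N.index ≠ 0) {m : ℕ}
    (h : ∀ x ∈ N, ∃ y ∈ N, y ^ m = x) (hfin : Finite (powMonoidHom m : G →* G).ker) :
    (powMonoidHom m : G →* G).range.index ≠ 0 ∧
      (powMonoidHom m : G →* G).range.index ≤ Nat.card (powMonoidHom m : G →* G).ker := by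
  have hle : N ≤ (powMonoidHom m : G →* G).range := fun x hx => by
    obtain ⟨y, _, hy⟩ := h x hx
    exact ⟨y, hy⟩
  haveI : Finite (G ⧸ N) := @Subgroup.finite_quotient_of_finiteIndex G _ N ⟨hN⟩
  refine ⟨fun h0 => hN (Nat.eq_zero_of_zero_dvd (h0 ▸ Subgroup.index_dvd_of_le hle)), ?_⟩
  let π := QuotientGroup.mk' N
  have h1 : (powMonoidHom m : G →* G).range.map π = (powMonoidHom m : G ⧸ N →* G ⧸ N).range := by
    ext x
    constructor
    · rintro ⟨_, ⟨y, rfl⟩, rfl⟩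
      exact ⟨π y, (map_pow π y m).symm⟩
    · rintro ⟨y, rfl⟩
      obtain ⟨y, rfl⟩ := QuotientGroup.mk'_surjective N y
      exact ⟨y ^ m, ⟨y, rfl⟩, map_pow π y m⟩
  have h2 : (powMonoidHom m : G →* G).range.index =
      (powMonoidHom m : G ⧸ N →* G ⧸ N).range.index := by
    rw [← h1, Subgroup.index_map_eq _ (QuotientGroup.mk'_surjective N)
      (by rw [QuotientGroup.ker_mk']; exact hle)]
  -- On the finite group `G / N` the kernel and the cokernel of the `m`-th power have equal order.
  -- The torsion of the quotient then lifts to torsion of `G`, as elements of `N` are `m`-th powers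
  -- inside `N`.
  have h3 : (powMonoidHom m : G ⧸ N →* G ⧸ N).range.index =
      Nat.card (powMonoidHom m : G ⧸ N →* G ⧸ N).ker := by
    have e1 := (powMonoidHom m : G ⧸ N →* G ⧸ N).range.card_mul_index
    have e2 := (powMonoidHom m : G ⧸ N →* G ⧸ N).ker.card_mul_index
    rw [Subgroup.index_ker] at e2
    have e3 : 0 < Nat.card (powMonoidHom m : G ⧸ N →* G ⧸ N).range := Nat.card_pos
    rw [← e2, mul_comm] at e1
    exact Nat.eq_of_mul_eq_mul_right e3 e1
  rw [h2, h3]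
  have hsurj : ∀ x : (powMonoidHom m : G ⧸ N →* G ⧸ N).ker,
      ∃ y : (powMonoidHom m : G →* G).ker, π y = x := by
    rintro ⟨x, hx⟩
    obtain ⟨x, rfl⟩ := QuotientGroup.mk'_surjective N x
    have hx' : x ^ m ∈ N := by
      rw [← QuotientGroup.eq_one_iff]
      exact hx
    obtain ⟨y, hy, hxy⟩ := h _ hx'
    refine ⟨⟨x * y⁻¹, ?_⟩, ?_⟩
    · rw [MonoidHom.mem_ker, powMonoidHom_apply, mul_pow, inv_pow, hxy, mul_inv_cancel]
    · change π (x * y⁻¹) = π x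
      rw [map_mul, map_inv, show π y = 1 from (QuotientGroup.eq_one_iff y).mpr hy, inv_one, mul_one]
  choose f hf using hsurj
  exact Nat.card_le_card_of_injective f fun x y hxy =>
    Subtype.ext ((hf x).symm.trans ((congrArg (fun z => π z.1) hxy).trans (hf y)))

end PowerIndex

section CompleteRing

variable {p : ℕ} [Fact p.Prime] {R : Type*} [CommRing R] [Algebra ℤ_[p] R] {k : ℕ}

lemma prime_pow_dvd_iff (b : Module.Basis (Fin k) ℤ_[p] R) (j : ℕ) (x : R) :
    (p : R) ^ j ∣ x ↔ ∀ i, (p : ℤ_[p]) ^ j ∣ b.repr x i := by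
  have hp : ∀ y : R, (p : R) ^ j * y = (p : ℤ_[p]) ^ j • y := fun y => by
    rw [Algebra.smul_def, map_pow, map_natCast]
  constructor
  · rintro ⟨y, rfl⟩ i
    exact ⟨b.repr y i, by rw [hp, map_smul]; rfl⟩
  · intro h
    choose c hc using h
    refine ⟨∑ i, c i • b i, ?_⟩
    rw [hp, Finset.smul_sum]
    conv_lhs => rw [← b.sum_repr x]
    exact Finset.sum_congr rfl fun i _ => by rw [hc, mul_smul]

/-- The contraction principle for the `p`-adic topology. -/
lemma exists_fixed_point (b : Module.Basis (Fin k) ℤ_[p] R) (f : R → R)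
    (hf : ∀ j x y, (p : R) ^ j ∣ x - y → (p : R) ^ (j + 1) ∣ f x - f y) : ∃ z, f z = z := by
  let z : ℕ → R := fun j => f^[j] 0
  have hz : ∀ j, (p : R) ^ j ∣ z j - z (j + 1) := fun j => by
    induction j with
    | zero => simp
    | succ j ih =>
      have := hf j _ _ ih
      simpa only [z, Function.iterate_succ_apply'] using this
  have hzl : ∀ j l, j ≤ l → (p : R) ^ j ∣ z j - z l := fun j l hjl => by
    induction l, hjl using Nat.le_induction with
    | base => simp
    | succ l hl ih =>
      have h := ((pow_dvd_pow (p : R) hl).trans (hz l))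
      have h' := dvd_add ih h
      rwa [sub_add_sub_cancel] at h'
  have hsmod : ∀ (j : ℕ) (x y : ℤ_[p]), x ≡ y
      [SMOD (IsLocalRing.maximalIdeal ℤ_[p] ^ j • ⊤ : Submodule ℤ_[p] ℤ_[p])] ↔
        (p : ℤ_[p]) ^ j ∣ x - y := fun j x y => by
    rw [SModEq.sub_mem, smul_eq_mul, Ideal.mul_top, PadicInt.maximalIdeal_eq_span_p,
      Ideal.span_singleton_pow, Ideal.mem_span_singleton]
  have hlim : ∀ i, ∃ c : ℤ_[p], ∀ j, (p : ℤ_[p]) ^ j ∣ b.repr (z j) i - c := fun i => by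
    obtain ⟨c, hc⟩ := IsPrecomplete.prec' (I := IsLocalRing.maximalIdeal ℤ_[p])
      (fun j => b.repr (z j) i) (fun {j l} hjl => (hsmod j _ _).mpr (by
        have := (prime_pow_dvd_iff b j _).mp (hzl j l hjl) i
        rwa [map_sub] at this))
    exact ⟨c, fun j => (hsmod j _ _).mp (hc j)⟩
  choose c hc using hlim
  let y : R := b.equivFun.symm c
  have hy : ∀ j, (p : R) ^ j ∣ z j - y := fun j => by
    rw [prime_pow_dvd_iff b]
    intro i
    have h1 : b.repr y i = c i := by
      rw [← b.equivFun_apply, LinearEquiv.apply_symm_apply]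
    rw [map_sub, Finsupp.sub_apply, h1]
    exact hc i j
  refine ⟨y, ?_⟩
  have h0 : ∀ j, (p : R) ^ j ∣ f y - y := fun j => by
    have h1 := (pow_dvd_pow (p : R) j.le_succ).trans (hf j _ _ (hy j))
    have h2 := (pow_dvd_pow (p : R) j.le_succ).trans (hy (j + 1))
    have h3 := dvd_sub h2 h1
    simp only [z, Function.iterate_succ_apply'] at h3
    rwa [sub_sub_sub_cancel_left] at h3
  rw [← sub_eq_zero, ← b.repr.map_eq_zero_iff]
  ext i
  refine IsHausdorff.haus' (I := IsLocalRing.maximalIdeal ℤ_[p]) _ fun j => (hsmod j _ _).mpr ?_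
  rw [sub_zero]
  exact (prime_pow_dvd_iff b j _).mp (h0 j) i

/-- Units close to `1` are `m`-th powers. -/
lemma exists_pow_eq_of_dvd (b : Module.Basis (Fin k) ℤ_[p] R) {m : ℕ} (hm : 0 < m) (u : Rˣ)
    (hu : (m : R) ^ 2 * p ∣ u - 1) : ∃ v : Rˣ, (p : R) ∣ v - 1 ∧ v ^ m = u := by
  obtain ⟨w, hw⟩ := hu
  -- The root is sought as `1 + m p z`. Expanding to second order and dividing by `m² p` leaves `z =
  -- w - p z² g(z)`, a contraction for the `p`-adic topology.
  obtain ⟨g, hg⟩ := Polynomial.powAddExpansion (1 : Polynomial R)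
    (Polynomial.C ((m : R) * p) * Polynomial.X) m
  have hg' : ∀ z : R, (1 + m * p * z) ^ m =
      1 + m ^ 2 * p * (z + p * (z ^ 2 * g.eval z)) := fun z => by
    have := congrArg (Polynomial.eval z) hg
    simp only [Polynomial.eval_pow, Polynomial.eval_add, Polynomial.eval_one,
      Polynomial.eval_mul, Polynomial.eval_C, Polynomial.eval_X, Polynomial.eval_natCast,
      one_pow] at this
    rw [this]
    ring
  obtain ⟨z, hz⟩ := exists_fixed_point b (fun z => w - p * (z ^ 2 * g.eval z)) (fun j x y h => by
    have h1 : x - y ∣ (y ^ 2 * g.eval y) - (x ^ 2 * g.eval x) := by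
      have := Polynomial.sub_dvd_eval_sub x y (Polynomial.X ^ 2 * g)
      simp only [Polynomial.eval_mul, Polynomial.eval_pow, Polynomial.eval_X] at this
      rwa [← dvd_neg, neg_sub] at this
    rw [sub_sub_sub_cancel_left, ← mul_sub, pow_succ']
    exact mul_dvd_mul_left _ (h.trans h1))
  have h1 : (1 + m * p * z) ^ m = (u : R) := by
    rw [hg', sub_eq_iff_eq_add'.mp hw]
    linear_combination -(m ^ 2 * p : R) * hz
  have h2 : IsUnit (1 + m * p * z) := (isUnit_pow_iff hm.ne').mp (h1 ▸ u.isUnit)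
  obtain ⟨v, hv⟩ := h2
  refine ⟨v, ⟨m * z, by rw [hv]; ring⟩, Units.ext ?_⟩
  rw [Units.val_pow_eq_pow_val, hv, h1]

/-- The units congruent to `1` modulo `p ^ s`. -/
def congrUnits (p : ℕ) (R : Type*) [CommRing R] (s : ℕ) : Subgroup Rˣ :=
  (Units.map (Ideal.Quotient.mk (Ideal.span {(p : R) ^ s}) :
    R →* R ⧸ Ideal.span {(p : R) ^ s})).ker

lemma mem_congrUnits {s : ℕ} {u : Rˣ} : u ∈ congrUnits p R s ↔ (p : R) ^ s ∣ u - 1 := by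
  rw [congrUnits, MonoidHom.mem_ker, ← Ideal.mem_span_singleton, ← Ideal.Quotient.mk_eq_mk_iff_sub_mem,
    Units.ext_iff]
  rfl

lemma index_congrUnits_le (b : Module.Basis (Fin k) ℤ_[p] R) (s : ℕ) :
    (congrUnits p R s).index ≠ 0 ∧ (congrUnits p R s).index ≤ (p ^ s) ^ k := by
  haveI : NeZero (p ^ s) := ⟨pow_ne_zero _ (Fact.out : p.Prime).ne_zero⟩
  let f : Rˣ ⧸ congrUnits p R s → Fin k → ZMod (p ^ s) :=
    fun q i => PadicInt.toZModPow s (b.repr (q.out : Rˣ) i)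
  have hf : Function.Injective f := fun x y h => by
    rw [← x.out_eq', ← y.out_eq']
    refine QuotientGroup.eq.mpr (mem_congrUnits.mpr ?_)
    have h1 : (p : R) ^ s ∣ (y.out : Rˣ) - (x.out : Rˣ) := by
      rw [prime_pow_dvd_iff b]
      intro i
      rw [← Ideal.mem_span_singleton, ← PadicInt.ker_toZModPow, RingHom.mem_ker, map_sub,
        Finsupp.sub_apply, map_sub, sub_eq_zero]
      exact (congrFun h i).symm
    have h2 : (((x.out)⁻¹ * y.out : Rˣ) : R) - 1 =
        ((x.out)⁻¹ : Rˣ) * ((y.out : Rˣ) - (x.out : Rˣ)) := by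
      rw [mul_sub, Units.inv_mul, Units.val_mul]
    rw [h2]
    exact Dvd.dvd.mul_left h1 _
  haveI : Finite (Rˣ ⧸ congrUnits p R s) := Finite.of_injective f hf
  refine ⟨Subgroup.index_ne_zero_of_finite, ?_⟩
  have h := Nat.card_le_card_of_injective f hf
  simpa [Subgroup.index] using h

/-- A bound on the index of the `m`-th powers in the unit group of a finite free `ℤ_p`-algebra,
depending on the rank and `m` only. -/
theorem index_pow_units_le (b : Module.Basis (Fin k) ℤ_[p] R) {m : ℕ} (hm : 0 < m)
    (hfin : Finite (powMonoidHom m : Rˣ →* Rˣ).ker)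
    (ht : Nat.card (powMonoidHom m : Rˣ →* Rˣ).ker ≤ m ^ k) :
    (powMonoidHom m : Rˣ →* Rˣ).range.index ≠ 0 ∧
      (powMonoidHom m : Rˣ →* Rˣ).range.index ≤ (m ^ 3) ^ k := by
  have hp : p.Prime := Fact.out
  obtain ⟨v, m', hm', hmv⟩ := Nat.exists_eq_pow_mul_and_not_dvd hm.ne' p hp.ne_one
  have hunit : IsUnit (m' : R) := by
    have h : IsUnit (m' : ℤ_[p]) := by
      rw [PadicInt.isUnit_iff, ← Int.cast_natCast, PadicInt.norm_intCast_eq_one_iff]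
      exact (Nat.isCoprime_iff_coprime.mpr ((Nat.Prime.coprime_iff_not_dvd hp).mpr hm').symm)
    simpa using h.map (algebraMap ℤ_[p] R)
  obtain ⟨c, hc⟩ := hunit
  have hdvd : (m : R) ^ 2 * p ∣ (p : R) ^ (2 * v + 1) := by
    refine ⟨((c⁻¹ : Rˣ) : R) ^ 2, ?_⟩
    have h1 : (m' : R) * ((c⁻¹ : Rˣ) : R) = 1 := by rw [← hc, Units.mul_inv]
    have h2 : (m : R) = p ^ v * m' := by rw [hmv]; push_cast; ring
    rw [h2]
    linear_combination -(p : R) ^ (2 * v + 1) * (m' * ((c⁻¹ : Rˣ) : R) + 1) * h1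
  have hpow : ∀ u ∈ congrUnits p R (2 * v + 1), ∃ w ∈ congrUnits p R 1, w ^ m = u :=
    fun u hu => by
      obtain ⟨w, hw, hwu⟩ := exists_pow_eq_of_dvd b hm u (hdvd.trans (mem_congrUnits.mp hu))
      exact ⟨w, mem_congrUnits.mpr (by rwa [pow_one]), hwu⟩
  obtain ⟨hi0, hi⟩ := index_congrUnits_le b (2 * v + 1)
  -- When `p ∤ m` the index is bounded by the torsion, uniformly in `p`. When `p ∣ m` both `p` and
  -- `p ^ v` are at most `m`, so the modulus `p ^ (2 v + 1)` is at most `m ^ 3`.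
  rcases Nat.eq_zero_or_pos v with rfl | hv
  · obtain ⟨h0, h1⟩ := index_pow_le_card_ker _ hi0 hpow hfin
    refine ⟨h0, h1.trans (ht.trans (Nat.pow_le_pow_left ?_ k))⟩
    exact Nat.le_self_pow (by norm_num) m
  · have hle : congrUnits p R (2 * v + 1) ≤ (powMonoidHom m : Rˣ →* Rˣ).range := fun u hu => by
      obtain ⟨w, _, hwu⟩ := hpow u hu
      exact ⟨w, hwu⟩
    have h1 : p ^ v ≤ m := Nat.le_of_dvd hm ⟨m', hmv⟩
    have h2 : p ≤ m := (Nat.le_self_pow hv.ne' p).trans h1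
    refine ⟨fun h0 => hi0 (Nat.eq_zero_of_zero_dvd (h0 ▸ Subgroup.index_dvd_of_le hle)), ?_⟩
    refine (Nat.le_of_dvd (Nat.pos_of_ne_zero hi0) (Subgroup.index_dvd_of_le hle)).trans
      (hi.trans (Nat.pow_le_pow_left ?_ k))
    rw [pow_succ, pow_mul', pow_succ m 2]
    exact Nat.mul_le_mul (Nat.pow_le_pow_left h1 2) h2

end CompleteRing

end ShimuraTorus

/-! ### Integral elements of `L ⊗ ℚ_p`, recognised by the embeddings of `L`. -/

namespace ShimuraTorus

section BasisTensor

variable {S A B ι : Type*} [CommRing S] [CommRing A] [CommRing B] [Algebra S A] [Algebra S B]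
  [Fintype ι] (b : Module.Basis ι S A)

lemma eq_zero_of_sum_tmul_eq_zero {c : ι → B} (h : ∑ k, b k ⊗ₜ[S] c k = 0) (k : ι) : c k = 0 := by
  classical
  have h1 := congrArg (fun z => TensorProduct.equivFinsuppOfBasisLeft b z k) h
  simpa [Finsupp.finsetSum_apply, Finsupp.single_apply] using h1

end BasisTensor

lemma exists_integral_basis_of_charZero (L : Type) [Field L] [CharZero L] [Algebra ℚ L]
    [FiniteDimensional ℚ L] :
    ∃ (b : Module.Basis (Fin (Module.finrank ℚ L)) ℤ (NumberField.RingOfIntegers L))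
      (b' : Module.Basis (Fin (Module.finrank ℚ L)) ℚ L),
      ∀ i, b' i = algebraMap (NumberField.RingOfIntegers L) L (b i) := by
  obtain rfl : ‹Algebra ℚ L› = DivisionRing.toRatAlgebra := Subsingleton.elim _ _
  haveI : NumberField L := { }
  let e := Fintype.equivFinOfCardEq ((Module.finrank_eq_card_basis
    (NumberField.integralBasis L)).symm)
  exact ⟨(NumberField.RingOfIntegers.basis L).reindex e, (NumberField.integralBasis L).reindex e,
    fun i => by simp⟩

lemma exists_integral_basis (L : Type) [Field L] [Algebra ℚ L] [FiniteDimensional ℚ L] :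
    ∃ (b : Module.Basis (Fin (Module.finrank ℚ L)) ℤ (NumberField.RingOfIntegers L))
      (b' : Module.Basis (Fin (Module.finrank ℚ L)) ℚ L),
      ∀ i, b' i = algebraMap (NumberField.RingOfIntegers L) L (b i) :=
  haveI : CharZero L := algebraRat.charZero L
  exists_integral_basis_of_charZero L

section LocalEmbeddings

variable {L : Type} [Field L] [Algebra ℚ L] {p : ℕ} [Fact p.Prime]

/-- The homomorphism of `L ⊗ ℚ_p` in an algebraic closure of `ℚ_p` given by an embedding of `L`. -/
noncomputable def locEmb (τ : L →ₐ[ℚ] PadicAlgCl p) : L ⊗[ℚ] ℚ_[p] →+* PadicAlgCl p :=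
  (evalTensor (τ : L →+* PadicAlgCl p) (algebraMap ℚ_[p] (PadicAlgCl p))).toRingHom

@[simp] lemma locEmb_tmul (τ : L →ₐ[ℚ] PadicAlgCl p) (l : L) (x : ℚ_[p]) :
    locEmb τ (l ⊗ₜ x) = τ l * algebraMap ℚ_[p] (PadicAlgCl p) x := rfl

lemma norm_le_one_of_isIntegral {x : PadicAlgCl p} (hx : IsIntegral ℤ x) : ‖x‖ ≤ 1 := by
  have h := (Valuation.integer.integers (NormedField.valuation (K := PadicAlgCl p))).mem_of_integral
    (x := x) (hx.tower_top)
  exact h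

variable [FiniteDimensional ℚ L]

lemma locEmb_ext {x y : L ⊗[ℚ] ℚ_[p]} (h : ∀ τ : L →ₐ[ℚ] PadicAlgCl p, locEmb τ x = locEmb τ y) :
    x = y := by
  rw [← sub_eq_zero]
  refine tensor_eq_zero_of_embeddings (K := PadicAlgCl p) (S := PadicAlgCl p)
    (algebraMap ℚ_[p] (PadicAlgCl p)) (algebraMap ℚ_[p] (PadicAlgCl p)).injective _ fun τ => ?_
  have h1 : locEmb τ (x - y) = 0 := by rw [map_sub, h, sub_self]
  exact h1

/-- The embeddings of `L`, `[L : ℚ]` in number, map the torsion injectively into tuples of `m`-th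
roots of unity of a field. -/
lemma card_ker_pow_units_le {m : ℕ} (hm : 0 < m) :
    Finite (powMonoidHom m : (L ⊗[ℚ] ℚ_[p])ˣ →* (L ⊗[ℚ] ℚ_[p])ˣ).ker ∧
      Nat.card (powMonoidHom m : (L ⊗[ℚ] ℚ_[p])ˣ →* (L ⊗[ℚ] ℚ_[p])ˣ).ker ≤
        m ^ Module.finrank ℚ L := by
  haveI : NeZero m := ⟨hm.ne'⟩
  let f : (powMonoidHom m : (L ⊗[ℚ] ℚ_[p])ˣ →* (L ⊗[ℚ] ℚ_[p])ˣ).ker →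
      ((L →ₐ[ℚ] PadicAlgCl p) → rootsOfUnity m (PadicAlgCl p)) := fun u τ =>
    ⟨Units.map (locEmb τ : L ⊗[ℚ] ℚ_[p] →* PadicAlgCl p) u, by
      rw [mem_rootsOfUnity, ← map_pow, show (u : (L ⊗[ℚ] ℚ_[p])ˣ) ^ m = 1 from u.2, map_one]⟩
  have hf : Function.Injective f := fun u v h => by
    refine Subtype.ext (Units.ext (locEmb_ext fun τ => ?_))
    exact congrArg (fun z : rootsOfUnity m (PadicAlgCl p) => ((z : (PadicAlgCl p)ˣ) : PadicAlgCl p))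
      (congrFun h τ)
  refine ⟨Finite.of_injective f hf, (Nat.card_le_card_of_injective f hf).trans ?_⟩
  rw [Nat.card_fun, Nat.card_eq_fintype_card (α := L →ₐ[ℚ] PadicAlgCl p),
    AlgHom.card ℚ L (PadicAlgCl p)]
  exact Nat.pow_le_pow_left (card_rootsOfUnity _ _) _

end LocalEmbeddings

section IntegralPoints

variable {L : Type} [Field L] [Algebra ℚ L] {p : ℕ} [Fact p.Prime]

lemma integralToRational_tmul (x : NumberField.RingOfIntegers L) (z : ℤ_[p]) :
    integralToRational L p (x ⊗ₜ z) = (x : L) ⊗ₜ (z : ℚ_[p]) := by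
  refine (Algebra.TensorProduct.productMap_apply_tmul _ _ _ _).trans ?_
  exact (Algebra.TensorProduct.tmul_mul_tmul _ _ _ _).trans (by rw [mul_one, one_mul]; rfl)

variable [FiniteDimensional ℚ L]

lemma integralToRational_injective : Function.Injective (integralToRational L p) := by
  rw [injective_iff_map_eq_zero]
  intro y hy
  obtain ⟨b, b', hb⟩ := exists_integral_basis L
  obtain ⟨c, rfl⟩ := exists_eq_sum_tmul b y
  simp only [map_sum, integralToRational_tmul] at hy
  have h := eq_zero_of_sum_tmul_eq_zero b' (c := fun k => (c k : ℚ_[p])) (by simpa [hb] using hy)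
  refine Finset.sum_eq_zero fun k _ => ?_
  rw [show c k = 0 from Subtype.ext (h k), TensorProduct.tmul_zero]

lemma norm_locEmb_integral_le (y : NumberField.RingOfIntegers L ⊗[ℤ] ℤ_[p])
    (τ : L →ₐ[ℚ] PadicAlgCl p) : ‖locEmb τ (integralToRational L p y)‖ ≤ 1 := by
  induction y with
  | zero => simp
  | add x y hx hy =>
    rw [map_add, map_add]
    exact (IsUltrametricDist.norm_add_le_max _ _).trans (max_le hx hy)
  | tmul x z =>
    rw [integralToRational_tmul, locEmb_tmul, norm_mul, norm_algebraMap']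
    exact mul_le_one₀ (norm_le_one_of_isIntegral
      (x.isIntegral_coe.map (τ.restrictScalars ℤ))) (norm_nonneg _) z.2

/-- The roots of the minimal polynomial are the conjugates `τ l`, so its coefficients lie in the
valuation ring. -/
lemma coeff_minpoly_norm_le {l : L} (h : ∀ τ : L →ₐ[ℚ] PadicAlgCl p, ‖τ l‖ ≤ 1) (i : ℕ) :
    ‖((minpoly ℚ l).coeff i : ℚ_[p])‖ ≤ 1 := by
  let V := (NormedField.valuation (K := PadicAlgCl p)).integer
  have hmem : (minpoly ℚ l).map (algebraMap ℚ (PadicAlgCl p)) ∈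
      Polynomial.lifts (algebraMap V (PadicAlgCl p)) := by
    refine (IsAlgClosed.splits _).mem_lift_of_roots_mem_range
      ((minpoly.monic (Algebra.IsIntegral.isIntegral l)).map _) _ fun a ha => ?_
    have ha' : a ∈ (minpoly ℚ l).rootSet (PadicAlgCl p) := by
      rw [Polynomial.mem_rootSet']
      rw [Polynomial.mem_roots'] at ha
      exact ⟨ha.1, by simpa [Polynomial.aeval_def, Polynomial.eval_map] using ha.2⟩
    rw [← Algebra.IsAlgebraic.range_eval_eq_rootSet_minpoly] at ha'
    obtain ⟨τ, rfl⟩ := ha'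
    exact ⟨⟨τ l, h τ⟩, rfl⟩
  rw [Polynomial.lifts_iff_coeff_lifts] at hmem
  obtain ⟨⟨c, hc⟩, h1⟩ := hmem i
  rw [Polynomial.coeff_map] at h1
  have h2 : algebraMap ℚ_[p] (PadicAlgCl p) ((minpoly ℚ l).coeff i : ℚ_[p]) = c := by
    rw [map_ratCast]
    exact (eq_ratCast (algebraMap ℚ (PadicAlgCl p)) _).symm.trans h1.symm
  rw [← norm_algebraMap' (PadicAlgCl p), h2]
  exact hc

/-- An element of `L` that is integral at the places above `p` becomes integral after
multiplication by an integer prime to `p`. -/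
lemma exists_mul_isIntegral {l : L} (h : ∀ τ : L →ₐ[ℚ] PadicAlgCl p, ‖τ l‖ ≤ 1) :
    ∃ D : ℕ, IsUnit (D : ℤ_[p]) ∧ IsIntegral ℤ ((D : L) * l) := by
  set f := minpoly ℚ l with hf
  have hmon : f.Monic := minpoly.monic (Algebra.IsIntegral.isIntegral l)
  -- The product of the denominators of the lower coefficients of the minimal polynomial. It is
  -- prime to `p`, and scaling the roots by it makes the monic polynomial integral.
  let D : ℕ := ∏ i ∈ Finset.range f.natDegree, (f.coeff i).den
  have hD : IsUnit (D : ℤ_[p]) := by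
    rw [Nat.cast_prod]
    exact IsUnit.prod_iff.mpr fun i _ => PadicInt.isUnit_den _ (coeff_minpoly_norm_le h i)
  refine ⟨D, hD, ?_⟩
  have hlift : f.scaleRoots (D : ℚ) ∈ Polynomial.lifts (algebraMap ℤ ℚ) := by
    rw [Polynomial.lifts_iff_coeff_lifts]
    intro i
    rw [Polynomial.coeff_scaleRoots]
    rcases lt_trichotomy i f.natDegree with hi | hi | hi
    · obtain ⟨e, he⟩ := Finset.dvd_prod_of_mem (fun i => (f.coeff i).den) (Finset.mem_range.mpr hi)
      have h1 : (D : ℚ) = (f.coeff i).den * e := by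
        rw [← Nat.cast_mul, ← he]
      refine ⟨(f.coeff i).num * e * D ^ (f.natDegree - i - 1), ?_⟩
      have h2 : f.natDegree - i = (f.natDegree - i - 1) + 1 := by omega
      have h3 : f.coeff i * (f.coeff i).den = (f.coeff i).num := Rat.mul_den_eq_num _
      rw [eq_intCast, Int.cast_mul, Int.cast_mul, Int.cast_pow, ← h3]
      generalize f.natDegree - i - 1 = N at h2 ⊢
      rw [h2, pow_succ]
      push_cast
      linear_combination -(f.coeff i * (D : ℚ) ^ N) * h1
    · refine ⟨1, ?_⟩
      rw [hi, Nat.sub_self, pow_zero, mul_one, hmon.coeff_natDegree, map_one]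
    · refine ⟨0, ?_⟩
      rw [Polynomial.coeff_eq_zero_of_natDegree_lt hi, map_zero, zero_mul]
  obtain ⟨g, hg, -, hgm⟩ := Polynomial.lifts_and_natDegree_eq_and_monic hlift
    ((Polynomial.monic_scaleRoots_iff _).mpr hmon)
  refine ⟨g, hgm, ?_⟩
  have h4 := Polynomial.scaleRoots_aeval_eq_zero (p := f) (a := l) (r := (D : ℚ)) (minpoly.aeval ℚ l)
  rw [← hg, map_natCast, Polynomial.aeval_map_algebraMap] at h4
  exact h4

/-- The image of `O_L ⊗ ℤ_p` consists of the elements of norm at most `1`. -/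
theorem mem_range_integralToRational (y : L ⊗[ℚ] ℚ_[p]) :
    (∃ x, integralToRational L p x = y) ↔ ∀ τ : L →ₐ[ℚ] PadicAlgCl p, ‖locEmb τ y‖ ≤ 1 := by
  constructor
  · rintro ⟨x, rfl⟩ τ
    exact norm_locEmb_integral_le x τ
  · intro h
    obtain ⟨b, b', hb⟩ := exists_integral_basis L
    obtain ⟨c, rfl⟩ := exists_eq_sum_tmul b' y
    -- Approximating the coordinates by rationals writes `y` as `l ⊗ 1` plus an integral element.
    -- The ultrametric inequality transfers the norm condition to `l`, which is integral up to a
    -- factor that is a `p`-adic unit.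
    have hq : ∀ i, ∃ q : ℚ, ‖c i - q‖ < 1 := fun i => Padic.rat_dense p (c i) one_pos
    choose q hq using hq
    let z : Fin (Module.finrank ℚ L) → ℤ_[p] := fun i => ⟨c i - q i, (hq i).le⟩
    let o := ∑ i, b i ⊗ₜ[ℤ] z i
    let l : L := ∑ i, q i • b' i
    have hsum : ∑ i, b' i ⊗ₜ[ℚ] c i = l ⊗ₜ[ℚ] (1 : ℚ_[p]) + integralToRational L p o := by
      simp only [l, o, map_sum, integralToRational_tmul, TensorProduct.sum_tmul]
      rw [← Finset.sum_add_distrib]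
      refine Finset.sum_congr rfl fun i _ => ?_
      refine Eq.trans ?_ (congrArg (fun w => (q i • b' i) ⊗ₜ[ℚ] (1 : ℚ_[p]) +
        w ⊗ₜ[ℚ] (c i - (q i : ℚ_[p]))) (hb i))
      rw [TensorProduct.smul_tmul, ← TensorProduct.tmul_add]
      congr 1
      simp [Algebra.smul_def]
    have hl : ∀ τ : L →ₐ[ℚ] PadicAlgCl p, ‖τ l‖ ≤ 1 := fun τ => by
      have h1 := h τ
      rw [hsum, map_add, locEmb_tmul, map_one, mul_one] at h1
      have h2 := IsUltrametricDist.norm_add_le_max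
        (τ l + locEmb τ (integralToRational L p o)) (-locEmb τ (integralToRational L p o))
      rw [add_neg_cancel_right, norm_neg] at h2
      exact h2.trans (max_le h1 (norm_locEmb_integral_le o τ))
    obtain ⟨D, ⟨u, hu⟩, hD⟩ := exists_mul_isIntegral hl
    let x : NumberField.RingOfIntegers L := ⟨(D : L) * l, hD⟩
    refine ⟨x ⊗ₜ[ℤ] ((u⁻¹ : ℤ_[p]ˣ) : ℤ_[p]) + o, ?_⟩
    rw [hsum, map_add, integralToRational_tmul]
    congr 1
    have h3 : ((D : ℚ_[p])) * (((u⁻¹ : ℤ_[p]ˣ) : ℤ_[p]) : ℚ_[p]) = 1 := by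
      have := congrArg (fun z : ℤ_[p] => (z : ℚ_[p])) u.mul_inv
      simpa [hu] using this
    change ((D : L) * l) ⊗ₜ[ℚ] _ = _
    have h4 : (D : L) * l = (D : ℚ) • l := by rw [Algebra.smul_def, map_natCast]
    rw [h4, TensorProduct.smul_tmul, Algebra.smul_def, map_natCast, h3]

theorem mem_integralUnits (u : (L ⊗[ℚ] ℚ_[p])ˣ) :
    u ∈ integralUnits L p ↔ ∀ τ : L →ₐ[ℚ] PadicAlgCl p, ‖locEmb τ (u : L ⊗[ℚ] ℚ_[p])‖ = 1 := by
  have hinv : ∀ (v : (L ⊗[ℚ] ℚ_[p])ˣ) (τ : L →ₐ[ℚ] PadicAlgCl p),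
      ‖locEmb τ (v : L ⊗[ℚ] ℚ_[p])‖ * ‖locEmb τ ((v⁻¹ : (L ⊗[ℚ] ℚ_[p])ˣ) : L ⊗[ℚ] ℚ_[p])‖ = 1 :=
    fun v τ => by rw [← norm_mul, ← map_mul, Units.mul_inv, map_one, norm_one]
  constructor
  · rintro ⟨v, rfl⟩ τ
    have h1 := norm_locEmb_integral_le (v : NumberField.RingOfIntegers L ⊗[ℤ] ℤ_[p]) τ
    have h2 := norm_locEmb_integral_le
      ((v⁻¹ : (NumberField.RingOfIntegers L ⊗[ℤ] ℤ_[p])ˣ) :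
        NumberField.RingOfIntegers L ⊗[ℤ] ℤ_[p]) τ
    have h3 := hinv (Units.map (integralToRational L p :
      NumberField.RingOfIntegers L ⊗[ℤ] ℤ_[p] →* L ⊗[ℚ] ℚ_[p]) v) τ
    rw [← map_inv] at h3
    refine le_antisymm h1 ?_
    by_contra! hlt
    refine absurd h3 (ne_of_lt ?_)
    exact mul_lt_one_of_nonneg_of_lt_one_left (norm_nonneg _) hlt h2
  · intro h
    obtain ⟨x, hx⟩ := (mem_range_integralToRational (u : L ⊗[ℚ] ℚ_[p])).mpr fun τ => (h τ).le
    obtain ⟨y, hy⟩ := (mem_range_integralToRational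
      ((u⁻¹ : (L ⊗[ℚ] ℚ_[p])ˣ) : L ⊗[ℚ] ℚ_[p])).mpr fun τ => by
        have := hinv u τ
        rw [h, one_mul] at this
        exact this.le
    have hxy : x * y = 1 := integralToRational_injective (by
      rw [map_mul, hx, hy, Units.mul_inv, map_one])
    exact ⟨⟨x, y, hxy, by rw [mul_comm, hxy]⟩, Units.ext hx⟩

end IntegralPoints

end ShimuraTorus

/-! ### From integral units to all units of `L ⊗ ℚ_p`, through valuations. -/

namespace ShimuraTorus

section PowBound

/-- The index of the `m`-th powers is finite and at most `q`, and the `m`-torsion is finite of order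
at most `t`. -/
structure PowBound (G : Type*) [CommGroup G] (m q t : ℕ) : Prop where
  index_ne_zero : (powMonoidHom m : G →* G).range.index ≠ 0
  index_le : (powMonoidHom m : G →* G).range.index ≤ q
  finite_ker : Finite (powMonoidHom m : G →* G).ker
  card_ker_le : Nat.card (powMonoidHom m : G →* G).ker ≤ t

variable {G H : Type*} [CommGroup G] [CommGroup H] {m q t : ℕ}

lemma index_pow_congr (e : G ≃* H) (m : ℕ) :
    (powMonoidHom m : G →* G).range.index = (powMonoidHom m : H →* H).range.index := by
  rw [← Subgroup.index_map_equiv _ e]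
  congr 1
  ext x
  constructor
  · rintro ⟨_, ⟨y, rfl⟩, rfl⟩
    exact ⟨e y, (map_pow e y m).symm⟩
  · rintro ⟨y, rfl⟩
    exact ⟨_, ⟨e.symm y, rfl⟩, by simp⟩

lemma card_ker_pow_le_of_injective (f : G →* H) (hf : Function.Injective f)
    (hfin : Finite (powMonoidHom m : H →* H).ker)
    (ht : Nat.card (powMonoidHom m : H →* H).ker ≤ t) :
    Finite (powMonoidHom m : G →* G).ker ∧ Nat.card (powMonoidHom m : G →* G).ker ≤ t := by
  let g : (powMonoidHom m : G →* G).ker → (powMonoidHom m : H →* H).ker := fun x =>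
    ⟨f x, by
      rw [MonoidHom.mem_ker, powMonoidHom_apply, ← map_pow, show (x : G) ^ m = 1 from x.2, map_one]⟩
  have hg : Function.Injective g := fun x y h => Subtype.ext (hf (congrArg Subtype.val h))
  exact ⟨Finite.of_injective g hg, (Nat.card_le_card_of_injective g hg).trans ht⟩

lemma PowBound.pi (h : PowBound G m q t) (d : ℕ) : PowBound (Fin d → G) m (q ^ d) (t ^ d) := by
  have hr : (powMonoidHom m : (Fin d → G) →* (Fin d → G)).range =
      Subgroup.pi Set.univ fun _ => (powMonoidHom m : G →* G).range := by
    ext x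
    rw [Subgroup.mem_pi]
    constructor
    · rintro ⟨y, rfl⟩ i _
      exact ⟨y i, rfl⟩
    · intro hx
      choose y hy using fun i => hx i trivial
      exact ⟨y, funext hy⟩
  haveI := h.finite_ker
  haveI : Finite (G ⧸ (powMonoidHom m : G →* G).range) :=
    @Subgroup.finite_quotient_of_finiteIndex G _ _ ⟨h.index_ne_zero⟩
  let f : (Fin d → G) ⧸ (powMonoidHom m : (Fin d → G) →* (Fin d → G)).range →
      Fin d → G ⧸ (powMonoidHom m : G →* G).range := fun x i => ((x.out i : G) : G ⧸ _)
  have hf : Function.Injective f := fun x y hxy => by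
    rw [← x.out_eq', ← y.out_eq']
    refine QuotientGroup.eq.mpr ?_
    exact hr.ge fun i _ => QuotientGroup.eq.mp (congrFun hxy i)
  haveI := Finite.of_injective f hf
  let g : (powMonoidHom m : (Fin d → G) →* (Fin d → G)).ker →
      Fin d → (powMonoidHom m : G →* G).ker := fun x i => ⟨x.1 i, congrFun x.2 i⟩
  have hg : Function.Injective g := fun x y hxy =>
    Subtype.ext (funext fun i => congrArg Subtype.val (congrFun hxy i))
  refine ⟨Subgroup.index_ne_zero_of_finite, ?_, Finite.of_injective g hg, ?_⟩
  · refine (Nat.card_le_card_of_injective f hf).trans ?_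
    rw [Nat.card_fun, Nat.card_eq_fintype_card (α := Fin d), Fintype.card_fin]
    exact Nat.pow_le_pow_left h.index_le d
  · refine (Nat.card_le_card_of_injective g hg).trans ?_
    rw [Nat.card_fun, Nat.card_eq_fintype_card (α := Fin d), Fintype.card_fin]
    exact Nat.pow_le_pow_left h.card_ker_le d

/-- The image of `v` is free of rank at most `|ι|`, so the `m`-th powers together with `v.ker` have
index at most `m ^ |ι|`. The remaining index is taken inside `v.ker`. -/
lemma index_pow_le_of_ker {ι : Type*} [Fintype ι] (v : G →* Multiplicative (ι → ℤ)) (hm : 0 < m)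
    (h0 : (powMonoidHom m : v.ker →* v.ker).range.index ≠ 0)
    (hq : (powMonoidHom m : v.ker →* v.ker).range.index ≤ q) :
    (powMonoidHom m : G →* G).range.index ≠ 0 ∧
      (powMonoidHom m : G →* G).range.index ≤ q * m ^ Fintype.card ι := by
  haveI : NeZero m := ⟨hm.ne'⟩
  set P := (powMonoidHom m : G →* G).range with hP
  let A : Submodule ℤ (ι → ℤ) := AddSubgroup.toIntSubmodule (Subgroup.toAddSubgroup' v.range)
  obtain ⟨r, ⟨b⟩⟩ := Submodule.nonempty_basis_of_pid (Pi.basisFun ℤ ι) A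
  have hr : r ≤ Fintype.card ι := by
    have h1 := Submodule.finrank_le A
    rwa [Module.finrank_eq_card_basis b, Fintype.card_fin, Module.finrank_fintype_fun_eq_card] at h1
  let w : G → A := fun g => ⟨(v g).toAdd, ⟨g, rfl⟩⟩
  have hw : ∀ x y : G, w (x⁻¹ * y) = w y - w x := fun x y => Subtype.ext (by
    change (v (x⁻¹ * y)).toAdd = (v y).toAdd - (v x).toAdd
    rw [map_mul, map_inv, toAdd_mul, toAdd_inv]
    abel)
  let f : G ⧸ (P ⊔ v.ker) → Fin r → ZMod m := fun x i => (b.repr (w x.out) i : ZMod m)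
  have hf : Function.Injective f := fun x y hxy => by
    rw [← x.out_eq', ← y.out_eq']
    refine QuotientGroup.eq.mpr ?_
    have hdvd : ∀ i, (m : ℤ) ∣ b.repr (w (x.out⁻¹ * y.out)) i := fun i => by
      rw [hw, map_sub, Finsupp.sub_apply]
      exact (ZMod.intCast_eq_intCast_iff_dvd_sub _ _ _).mp (congrFun hxy i)
    choose c hc using hdvd
    have hsum : w (x.out⁻¹ * y.out) = (m : ℤ) • ∑ i, c i • b i := by
      rw [Finset.smul_sum]
      conv_lhs => rw [← b.sum_repr (w (x.out⁻¹ * y.out))]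
      exact Finset.sum_congr rfl fun i _ => by rw [hc, mul_smul]
    obtain ⟨g, hg⟩ := (∑ i, c i • b i : A).2
    have hg' : v (x.out⁻¹ * y.out) = v (g ^ m) := by
      have h2 := congrArg (fun z : A => Multiplicative.ofAdd (z : ι → ℤ)) hsum
      refine h2.trans ?_
      rw [map_pow, natCast_zsmul]
      change Multiplicative.ofAdd (m • ((∑ i, c i • b i : A) : ι → ℤ)) = _
      rw [ofAdd_nsmul]
      exact congrArg (fun z => z ^ m) hg.symm
    have h3 : x.out⁻¹ * y.out = g ^ m * ((g ^ m)⁻¹ * (x.out⁻¹ * y.out)) := by group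
    rw [h3]
    refine Subgroup.mul_mem_sup ⟨g, rfl⟩ ?_
    rw [MonoidHom.mem_ker, map_mul, map_inv, hg', inv_mul_cancel]
  haveI := Finite.of_injective f hf
  have h1 : (P ⊔ v.ker).index ≤ m ^ Fintype.card ι := by
    refine (Nat.card_le_card_of_injective f hf).trans ?_
    rw [Nat.card_fun, Nat.card_zmod, Nat.card_eq_fintype_card (α := Fin r), Fintype.card_fin]
    exact Nat.pow_le_pow_right hm hr
  have h10 : (P ⊔ v.ker).index ≠ 0 := Subgroup.index_ne_zero_of_finite
  have hle : (powMonoidHom m : v.ker →* v.ker).range ≤ P.subgroupOf v.ker := by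
    rintro _ ⟨x, rfl⟩
    exact ⟨x.1, rfl⟩
  have h2 : P.relIndex (P ⊔ v.ker) = (P.subgroupOf v.ker).index := by
    rw [Subgroup.relIndex_sup_left]
    rfl
  have h3 : (P.subgroupOf v.ker).index ≠ 0 := fun h =>
    h0 (Nat.eq_zero_of_zero_dvd (h ▸ Subgroup.index_dvd_of_le hle))
  have h4 : (P.subgroupOf v.ker).index ≤ q :=
    (Nat.le_of_dvd (Nat.pos_of_ne_zero h0) (Subgroup.index_dvd_of_le hle)).trans hq
  have h5 := Subgroup.relIndex_mul_index (le_sup_left : P ≤ P ⊔ v.ker)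
  rw [← h5, h2]
  exact ⟨mul_ne_zero h3 h10, Nat.mul_le_mul h4 h1⟩

end PowBound

section LocalUnits

variable {L : Type} [Field L] [Algebra ℚ L] {p : ℕ} [Fact p.Prime] [FiniteDimensional ℚ L]

lemma powBound_range_units {k m : ℕ} (hm : 0 < m) {R E : Type*} [CommRing R] [CommRing E]
    [Algebra ℤ_[p] R] (b : Module.Basis (Fin k) ℤ_[p] R) (φ : R →+* E)
    (hφ : Function.Injective φ) (hfin : Finite (powMonoidHom m : Eˣ →* Eˣ).ker)
    (hcard : Nat.card (powMonoidHom m : Eˣ →* Eˣ).ker ≤ m ^ k) :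
    PowBound (Units.map (φ : R →* E)).range m ((m ^ 3) ^ k) (m ^ k) := by
  have hψ : Function.Injective (Units.map (φ : R →* E)) := Units.map_injective hφ
  obtain ⟨hfin1, hcard1⟩ := card_ker_pow_le_of_injective _ hψ hfin hcard
  obtain ⟨h0, h1⟩ := index_pow_units_le b hm hfin1 hcard1
  rw [index_pow_congr (MonoidHom.ofInjective hψ)] at h0 h1
  obtain ⟨hfin2, hcard2⟩ := card_ker_pow_le_of_injective (Units.map (φ : R →* E)).range.subtype
    Subtype.val_injective hfin hcard
  exact ⟨h0, h1, hfin2, hcard2⟩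

theorem powBound_integralUnits {m : ℕ} (hm : 0 < m) :
    PowBound (integralUnits L p) m ((m ^ 3) ^ Module.finrank ℚ L) (m ^ Module.finrank ℚ L) := by
  obtain ⟨hfin, hcard⟩ := card_ker_pow_units_le (L := L) (p := p) hm
  obtain ⟨b, -⟩ := exists_integral_basis L
  let c : ℤ_[p] ⊗[ℤ] NumberField.RingOfIntegers L ≃+* NumberField.RingOfIntegers L ⊗[ℤ] ℤ_[p] :=
    (Algebra.TensorProduct.comm ℤ ℤ_[p] (NumberField.RingOfIntegers L)).toRingEquiv
  let φ : ℤ_[p] ⊗[ℤ] NumberField.RingOfIntegers L →+* L ⊗[ℚ] ℚ_[p] :=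
    (integralToRational L p).toRingHom.comp c.toRingHom
  have hr : integralUnits L p = (Units.map (φ : ℤ_[p] ⊗[ℤ] NumberField.RingOfIntegers L →*
      L ⊗[ℚ] ℚ_[p])).range := by
    ext u
    constructor
    · rintro ⟨x, rfl⟩
      exact ⟨Units.map (c.symm : NumberField.RingOfIntegers L ⊗[ℤ] ℤ_[p] →*
        ℤ_[p] ⊗[ℤ] NumberField.RingOfIntegers L) x,
        Units.ext (congrArg (integralToRational L p) (c.apply_symm_apply x))⟩
    · rintro ⟨x, rfl⟩
      exact ⟨Units.map (c : ℤ_[p] ⊗[ℤ] NumberField.RingOfIntegers L →*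
        NumberField.RingOfIntegers L ⊗[ℤ] ℤ_[p]) x, Units.ext rfl⟩
  rw [hr]
  exact powBound_range_units hm (Algebra.TensorProduct.basis ℤ_[p] b) φ
    (integralToRational_injective.comp c.injective) hfin hcard

lemma natDegree_minpoly_locEmb_le (τ : L →ₐ[ℚ] PadicAlgCl p) (y : L ⊗[ℚ] ℚ_[p]) :
    (minpoly ℚ_[p] (locEmb τ y)).natDegree ≤ Module.finrank ℚ L := by
  let ψ : ℚ_[p] ⊗[ℚ] L →ₐ[ℚ_[p]] PadicAlgCl p :=
    Algebra.TensorProduct.lift (Algebra.ofId ℚ_[p] (PadicAlgCl p)) τ fun _ _ => Commute.all _ _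
  have hψ : ψ (Algebra.TensorProduct.comm ℚ L ℚ_[p] y) = locEmb τ y := by
    induction y with
    | zero => simp
    | add x y hx hy => rw [map_add, map_add, map_add, hx, hy]
    | tmul l x => simp [ψ, mul_comm, Algebra.ofId_apply]
  have hdvd : minpoly ℚ_[p] (locEmb τ y) ∣
      minpoly ℚ_[p] (Algebra.TensorProduct.comm ℚ L ℚ_[p] y) := by
    apply minpoly.dvd
    rw [← hψ, Polynomial.aeval_algHom_apply, minpoly.aeval, map_zero]
  refine (Polynomial.natDegree_le_of_dvd hdvd (minpoly.monic
    (Algebra.IsIntegral.isIntegral _)).ne_zero).trans ?_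
  rw [← Module.finrank_baseChange (R := ℚ_[p])]
  exact minpoly.natDegree_le _

/-- The norm is the spectral norm, hence attained as some `‖c_j‖ ^ (1 / (deg - j))` for a
coefficient `c_j` in `ℚ_p`. The denominators are at most `[L : ℚ]`, so its factorial clears them all
and makes the valuations integral. -/
lemma exists_norm_locEmb_pow_eq (τ : L →ₐ[ℚ] PadicAlgCl p) (u : (L ⊗[ℚ] ℚ_[p])ˣ) :
    ∃ z : ℤ, ‖locEmb τ (u : L ⊗[ℚ] ℚ_[p])‖ ^ (Module.finrank ℚ L).factorial = (p : ℝ) ^ z := by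
  set x := locEmb τ (u : L ⊗[ℚ] ℚ_[p]) with hx
  have hx0 : x ≠ 0 := (u.isUnit.map (locEmb τ)).ne_zero
  have hmem : ‖x‖ ∈ Set.range (spectralValueTerms (minpoly ℚ_[p] x)) := by
    rw [← PadicAlgCl.spectralNorm_eq]
    exact (Set.range_nonempty _).csSup_mem (spectralValueTerms_finite_range _)
  obtain ⟨j, hj⟩ := hmem
  by_cases hjd : j < (minpoly ℚ_[p] x).natDegree
  swap
  · rw [spectralValueTerms_of_natDegree_le _ (not_lt.mp hjd)] at hj
    exact absurd hj.symm (norm_ne_zero_iff.mpr hx0)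
  rw [spectralValueTerms_of_lt_natDegree _ hjd, ← Nat.cast_sub hjd.le] at hj
  have hpos : 0 < (minpoly ℚ_[p] x).natDegree - j := Nat.sub_pos_of_lt hjd
  have hpow : ‖x‖ ^ ((minpoly ℚ_[p] x).natDegree - j) = ‖(minpoly ℚ_[p] x).coeff j‖ := by
    rw [← hj, one_div, Real.rpow_inv_natCast_pow (norm_nonneg _) hpos.ne']
  have hc0 : (minpoly ℚ_[p] x).coeff j ≠ 0 := by
    rw [← norm_ne_zero_iff, ← hpow]
    exact pow_ne_zero _ (norm_ne_zero_iff.mpr hx0)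
  obtain ⟨e, he⟩ := Nat.dvd_factorial hpos
    ((Nat.sub_le _ _).trans (natDegree_minpoly_locEmb_le τ (u : L ⊗[ℚ] ℚ_[p])))
  refine ⟨-((minpoly ℚ_[p] x).coeff j).valuation * e, ?_⟩
  rw [he, pow_mul, hpow, Padic.norm_eq_zpow_neg_valuation hc0, zpow_mul, zpow_natCast]

/-- The valuations of the images of a unit under the embeddings. -/
lemma exists_valuation (L : Type) [Field L] [Algebra ℚ L] (p : ℕ) [Fact p.Prime]
    [FiniteDimensional ℚ L] :
    ∃ v : (L ⊗[ℚ] ℚ_[p])ˣ →* Multiplicative ((L →ₐ[ℚ] PadicAlgCl p) → ℤ),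
      v.ker = integralUnits L p := by
  have hp : (1 : ℝ) < p := by exact_mod_cast (Fact.out : p.Prime).one_lt
  choose z hz using exists_norm_locEmb_pow_eq (L := L) (p := p)
  have hinj : ∀ a b : ℤ, (p : ℝ) ^ a = (p : ℝ) ^ b → a = b := fun a b h =>
    zpow_right_injective₀ (by linarith) hp.ne' h
  refine ⟨MonoidHom.mk' (fun u => Multiplicative.ofAdd fun τ => z τ u) fun u w => ?_, ?_⟩
  · refine congrArg Multiplicative.ofAdd (funext fun τ => hinj _ _ ?_)
    change _ = (p : ℝ) ^ (z τ u + z τ w)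
    rw [zpow_add₀ (by linarith), ← hz, ← hz, ← hz, Units.val_mul, map_mul, norm_mul, mul_pow]
  · ext u
    rw [mem_integralUnits, MonoidHom.mem_ker]
    have h1 : ∀ τ, z τ u = 0 ↔ ‖locEmb τ (u : L ⊗[ℚ] ℚ_[p])‖ = 1 := fun τ => by
      rw [← pow_eq_one_iff_of_nonneg (norm_nonneg _) (Nat.factorial_ne_zero _), hz]
      exact ⟨fun h => by rw [h, zpow_zero], fun h => hinj _ _ (h.trans (zpow_zero _).symm)⟩
    simp only [← h1]
    exact ⟨fun h τ => congrFun (congrArg Multiplicative.toAdd h) τ,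
      fun h => congrArg Multiplicative.ofAdd (funext h)⟩

theorem powBound_localUnits {m : ℕ} (hm : 0 < m) :
    PowBound (L ⊗[ℚ] ℚ_[p])ˣ m
      ((m ^ 3) ^ Module.finrank ℚ L * m ^ Module.finrank ℚ L) (m ^ Module.finrank ℚ L) := by
  obtain ⟨hfin, hcard⟩ := card_ker_pow_units_le (L := L) (p := p) hm
  obtain ⟨v, hv⟩ := exists_valuation L p
  have h := powBound_integralUnits (L := L) (p := p) hm
  rw [← hv] at h
  obtain ⟨h0, h1⟩ := index_pow_le_of_ker v hm h.index_ne_zero h.index_le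
  rw [AlgHom.card ℚ L (PadicAlgCl p)] at h1
  exact ⟨h0, h1, hfin, hcard⟩

end LocalUnits

end ShimuraTorus

/-! ### The maximal compact subgroup of the `p`-adic points. -/

namespace ShimuraTorus

lemma AlgSubgroup.isClosed_points {n : ℕ} (M : AlgSubgroup n) (p : ℕ) [Fact p.Prime] :
    IsClosed (M.points ℚ_[p] : Set (GL (Fin n) ℚ_[p])) := by
  have h : (M.points ℚ_[p] : Set (GL (Fin n) ℚ_[p])) = ⋂ f ∈ M.eqns, {g : GL (Fin n) ℚ_[p] | MvPolynomial.aeval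
      (fun ij : Fin n × Fin n => (g : Matrix (Fin n) (Fin n) ℚ_[p]) ij.1 ij.2) f = 0} := by
    ext g
    simp only [Set.mem_iInter]
    rfl
  rw [h]
  refine isClosed_biInter fun f _ => isClosed_eq ?_ continuous_const
  simp only [MvPolynomial.aeval_def, MvPolynomial.eval₂_eq_eval_map]
  exact (MvPolynomial.continuous_eval _).comp
    (continuous_pi fun ij => Units.continuous_val.matrix_elem ij.1 ij.2)

lemma isCompact_bounded_GL (n : ℕ) (p : ℕ) [Fact p.Prime] (B : ℝ) :
    IsCompact {g : GL (Fin n) ℚ_[p] | (∀ i j, ‖g.val i j‖ ≤ B) ∧ ∀ i j, ‖g⁻¹.val i j‖ ≤ B} := by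
  have hK : IsCompact {A : Matrix (Fin n) (Fin n) ℚ_[p] | ∀ i j, ‖A i j‖ ≤ B} := by
    have h := isCompact_univ_pi fun _ : Fin n => isCompact_univ_pi fun _ : Fin n =>
      isCompact_closedBall (0 : ℚ_[p]) B
    refine Eq.mp (congrArg IsCompact (Set.ext fun A => ?_)) h
    exact ⟨fun h i j => mem_closedBall_zero_iff.mp (h i trivial j trivial),
      fun h i _ j _ => mem_closedBall_zero_iff.mpr (h i j)⟩
  have h := Units.isClosedEmbedding_embedProduct.isCompact_preimage
    (hK.prod (hK.image MulOpposite.continuous_op))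
  refine Eq.mp (congrArg IsCompact (Set.ext fun g => ?_)) h
  constructor
  · rintro ⟨h1, ⟨A, h2, h3⟩⟩
    have h4 : A = g⁻¹.val := MulOpposite.op_injective h3
    exact ⟨h1, h4 ▸ h2⟩
  · rintro ⟨h1, h2⟩
    exact ⟨h1, ⟨g⁻¹.val, h2, rfl⟩⟩

namespace Splitting

variable {n : ℕ} {M : AlgSubgroup n} {L : Type} [Field L] [Algebra ℚ L] {d : ℕ}
  (s : Splitting M L d) (p : ℕ) [Fact p.Prime]

/-- The points of the torus over `ℚ_p` with integral coordinates. -/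
noncomputable def integralPoints : Subgroup (M.points ℚ_[p]) :=
  (Subgroup.pi Set.univ fun _ : Fin d => integralUnits L p).comap (s.coord ℚ_[p])

variable {p}

lemma mem_integralPoints {x : M.points ℚ_[p]} :
    x ∈ s.integralPoints p ↔ ∀ k, s.coord ℚ_[p] x k ∈ integralUnits L p := by
  rw [integralPoints, Subgroup.mem_comap, Subgroup.mem_pi]
  simp

/-- The weights generate the characters. Unlike the coordinates, they are linear in the matrix
entries, which makes the condition accessible to topology. -/
lemma mem_integralPoints_iff_weights {x : M.points ℚ_[p]} :
    x ∈ s.integralPoints p ↔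
      ∀ w ∈ s.rep.weights, charVal w (s.coord ℚ_[p] x) ∈ integralUnits L p := by
  rw [mem_integralPoints]
  constructor
  · exact fun h w _ => charVal_mem _ w h
  · intro h k
    have h1 : ∀ χ ∈ AddSubgroup.closure (s.rep.weights : Set (Fin d → ℤ)),
        charVal χ (s.coord ℚ_[p] x) ∈ integralUnits L p := fun χ hχ => by
      induction hχ using AddSubgroup.closure_induction with
      | mem χ hχ => exact h χ hχ
      | zero => rw [charVal_zero]; exact one_mem _
      | add χ ψ _ _ h1 h2 => rw [charVal_add]; exact mul_mem h1 h2
      | neg χ _ h1 => rw [charVal_neg]; exact inv_mem h1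
    rw [← charVal_single k (s.coord ℚ_[p] x)]
    exact h1 _ (s.closure_weights ▸ AddSubgroup.mem_top _)

lemma exists_weight_form {w : Fin d → ℤ} (hw : w ∈ s.rep.weights) (τ : L →ₐ[ℚ] PadicAlgCl p) :
    ∃ Φ : GL (Fin n) ℚ_[p] → PadicAlgCl p, Continuous Φ ∧ ∀ x : M.points ℚ_[p],
      locEmb τ (charVal w (s.coord ℚ_[p] x) : (L ⊗[ℚ] ℚ_[p])ˣ) = Φ x := by
  obtain ⟨i, j, hij⟩ : ∃ i j, s.rep.proj w i j ≠ 0 := by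
    by_contra! h
    exact s.rep.mem_weights.mp hw (Matrix.ext fun i j => h i j)
  refine ⟨fun g => ∑ c, τ ((s.rep.proj w i j)⁻¹ * s.rep.proj w i c) *
    algebraMap ℚ_[p] (PadicAlgCl p) (g.val c j), ?_, fun x => ?_⟩
  · exact continuous_finsetSum _ fun c _ => continuous_const.mul
      ((continuous_algebraMap ℚ_[p] (PadicAlgCl p)).comp (Units.continuous_val.matrix_elem c j))
  · rw [s.rep.charVal_eq_sum hij Algebra.TensorProduct.includeLeftRingHom, s.app_coord, map_sum]
    refine Finset.sum_congr rfl fun c _ => ?_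
    rw [map_mul]
    congr 1
    · exact (locEmb_tmul τ _ _).trans (by rw [map_one, mul_one])
    · exact (locEmb_tmul τ _ _).trans (by rw [map_one, one_mul])

variable [FiniteDimensional ℚ L]

lemma locEmb_charVal_mul_inv (w : Fin d → ℤ) (x : M.points ℚ_[p]) (τ : L →ₐ[ℚ] PadicAlgCl p) :
    ‖locEmb τ (charVal w (s.coord ℚ_[p] x) : (L ⊗[ℚ] ℚ_[p])ˣ)‖ *
      ‖locEmb τ (charVal w (s.coord ℚ_[p] x⁻¹) : (L ⊗[ℚ] ℚ_[p])ˣ)‖ = 1 := by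
  rw [← norm_mul, ← map_mul, ← Units.val_mul, ← charVal_mul, ← map_mul, mul_inv_cancel, map_one,
    charVal_one, Units.val_one, map_one, norm_one]

lemma mem_integralPoints_iff_norm {x : M.points ℚ_[p]} :
    x ∈ s.integralPoints p ↔ ∀ w ∈ s.rep.weights, ∀ τ : L →ₐ[ℚ] PadicAlgCl p,
      ‖locEmb τ (charVal w (s.coord ℚ_[p] x) : (L ⊗[ℚ] ℚ_[p])ˣ)‖ ≤ 1 ∧
      ‖locEmb τ (charVal w (s.coord ℚ_[p] x⁻¹) : (L ⊗[ℚ] ℚ_[p])ˣ)‖ ≤ 1 := by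
  rw [mem_integralPoints_iff_weights]
  simp only [mem_integralUnits]
  refine forall₂_congr fun w _ => forall_congr' fun τ => ?_
  have h := s.locEmb_charVal_mul_inv w x τ
  constructor
  · intro h1
    rw [h1, one_mul] at h
    exact ⟨h1.le, h.le⟩
  · rintro ⟨h1, h2⟩
    by_contra hne
    exact absurd h (ne_of_lt (mul_lt_one_of_nonneg_of_lt_one_left (norm_nonneg _)
      (lt_of_le_of_ne h1 hne) h2))

lemma exists_entry_bound (M : AlgSubgroup n) (s : Splitting M L d) (p : ℕ) [Fact p.Prime] :
    ∃ B : ℝ, ∀ x ∈ s.integralPoints p, ∀ i j, ‖x.1.val i j‖ ≤ B := by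
  obtain ⟨τ⟩ : Nonempty (L →ₐ[ℚ] PadicAlgCl p) := ⟨IsAlgClosed.lift⟩
  refine ⟨∑ w ∈ s.rep.weights, ∑ i, ∑ j, ‖τ (s.rep.proj w i j)‖, fun x hx i j => ?_⟩
  have h1 : algebraMap ℚ_[p] (PadicAlgCl p) (x.1.val i j) = ∑ w ∈ s.rep.weights,
      locEmb τ (charVal w (s.coord ℚ_[p] x) : (L ⊗[ℚ] ℚ_[p])ˣ) * τ (s.rep.proj w i j) := by
    have h := congrArg (fun A : Matrix (Fin n) (Fin n) (L ⊗[ℚ] ℚ_[p]) => locEmb τ (A i j))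
      ((s.rep.app_eq Algebra.TensorProduct.includeLeftRingHom (s.coord ℚ_[p] x)))
    rw [s.app_coord] at h
    refine Eq.trans ?_ (h.trans ?_)
    · exact ((locEmb_tmul τ 1 (x.1.val i j)).trans (by rw [map_one, one_mul])).symm
    · rw [Matrix.sum_apply, map_sum]
      refine Finset.sum_congr rfl fun w _ => ?_
      rw [Matrix.smul_apply, smul_eq_mul, map_mul]
      congr 1
      exact (locEmb_tmul τ _ 1).trans (by rw [map_one, mul_one])
  rw [← norm_algebraMap' (PadicAlgCl p), h1]
  refine (norm_sum_le _ _).trans (Finset.sum_le_sum fun w hw => ?_)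
  rw [norm_mul]
  refine (mul_le_of_le_one_left (norm_nonneg _)
    (s.mem_integralPoints_iff_norm.mp hx w hw τ).1).trans ?_
  refine le_trans ?_ (Finset.single_le_sum (f := fun i => ∑ j, ‖τ (s.rep.proj w i j)‖)
    (fun _ _ => Finset.sum_nonneg fun _ _ => norm_nonneg _) (Finset.mem_univ i))
  exact Finset.single_le_sum (f := fun j => ‖τ (s.rep.proj w i j)‖)
    (fun _ _ => norm_nonneg _) (Finset.mem_univ j)

/-- The integral points are cut out by closed conditions on the weights, and the weight
decomposition bounds the entries of a point and of its inverse. -/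
lemma isCompact_integralPoints : IsCompact (s.integralPoints p : Set (M.points ℚ_[p])) := by
  rw [Subtype.isCompact_iff]
  choose Φ hΦc hΦ using fun w : s.rep.weights => fun τ : L →ₐ[ℚ] PadicAlgCl p =>
    s.exists_weight_form w.2 τ
  obtain ⟨B, hB⟩ := exists_entry_bound M s p
  refine (isCompact_bounded_GL n p B).of_isClosed_subset ?_ ?_
  · have h : Subtype.val '' (s.integralPoints p : Set (M.points ℚ_[p])) =
        (M.points ℚ_[p] : Set (GL (Fin n) ℚ_[p])) ∩ ⋂ (w : s.rep.weights)
          (τ : L →ₐ[ℚ] PadicAlgCl p), {g | ‖Φ w τ g‖ ≤ 1} ∩ {g | ‖Φ w τ g⁻¹‖ ≤ 1} := by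
      ext g
      simp only [Set.mem_inter_iff, Set.mem_iInter, Set.mem_ofPred_eq]
      constructor
      · rintro ⟨x, hx, rfl⟩
        refine ⟨x.2, fun w τ => ?_⟩
        have h1 := s.mem_integralPoints_iff_norm.mp hx w w.2 τ
        rwa [hΦ, hΦ] at h1
      · rintro ⟨hg, h⟩
        refine ⟨⟨g, hg⟩, s.mem_integralPoints_iff_norm.mpr fun w hw τ => ?_, rfl⟩
        rw [hΦ ⟨w, hw⟩ τ, hΦ ⟨w, hw⟩ τ]
        exact h ⟨w, hw⟩ τ
    rw [h]
    refine (M.isClosed_points p).inter (isClosed_iInter fun w => isClosed_iInter fun τ => ?_)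
    exact (isClosed_le (hΦc w τ).norm continuous_const).inter
      (isClosed_le ((hΦc w τ).comp continuous_inv).norm continuous_const)
  · rintro _ ⟨x, hx, rfl⟩
    exact ⟨hB x hx, hB x⁻¹ (inv_mem hx)⟩

/-- Weights are continuous, hence bounded on a compact group; a value of norm greater than `1` would
have unbounded powers. -/
lemma le_integralPoints_of_isCompact {K : Subgroup (M.points ℚ_[p])}
    (hK : IsCompact (K : Set (M.points ℚ_[p]))) : K ≤ s.integralPoints p := by
  have key : ∀ w ∈ s.rep.weights, ∀ τ : L →ₐ[ℚ] PadicAlgCl p, ∀ x ∈ K,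
      ‖locEmb τ (charVal w (s.coord ℚ_[p] x) : (L ⊗[ℚ] ℚ_[p])ˣ)‖ ≤ 1 := fun w hw τ x hx => by
    obtain ⟨Φ, hΦc, hΦ⟩ := s.exists_weight_form hw τ
    obtain ⟨B, hB⟩ := hK.exists_bound_of_continuousOn
      (hΦc.comp continuous_subtype_val).continuousOn
    by_contra! hlt
    obtain ⟨j, hj⟩ := pow_unbounded_of_one_lt B hlt
    have h1 := hB (x ^ j) (pow_mem hx j)
    rw [Function.comp_apply, ← hΦ, map_pow] at h1
    have h2 : charVal w (s.coord ℚ_[p] x ^ j) = charVal w (s.coord ℚ_[p] x) ^ j :=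
      (map_charVal (powMonoidHom j : (L ⊗[ℚ] ℚ_[p])ˣ →* (L ⊗[ℚ] ℚ_[p])ˣ) w _).symm
    rw [h2, Units.val_pow_eq_pow_val, map_pow, norm_pow] at h1
    exact absurd h1 (not_le.mpr hj)
  exact fun x hx => s.mem_integralPoints_iff_norm.mpr fun w hw τ =>
    ⟨key w hw τ x hx, key w hw τ x⁻¹ (inv_mem hx)⟩

/-- The maximal compact subgroup of `M(ℚ_p)` consists of the points with integral coordinates. -/
theorem maximalCompact_eq : maximalCompact M p = s.integralPoints p :=
  le_antisymm (sSup_le fun _ hK => s.le_integralPoints_of_isCompact hK)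
    (le_sSup s.isCompact_integralPoints)

end Splitting

end ShimuraTorus

/-! ### Assembly of the uniform bound. -/

namespace ShimuraTorus

namespace Splitting

variable {n : ℕ} {M : AlgSubgroup n} {L : Type} [Field L] [Algebra ℚ L] {d : ℕ}
  (s : Splitting M L d) [FiniteDimensional ℚ L]

/-- The index in the group of points with coordinates in `S` of a subgroup that contains all their
`m`-th powers. -/
theorem relIndex_le_of_pow_mem [IsGalois ℚ L] {R : Type} [CommRing R] [Algebra ℚ R]
    (S : Subgroup (L ⊗[ℚ] R)ˣ) (hS : ∀ (σ : L ≃ₐ[ℚ] L), ∀ u ∈ S, galUnits R σ u ∈ S)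
    {m q t : ℕ} (hB : PowBound S m q t) (P : Subgroup (M.points R))
    (hP : ∀ x, (∀ k, s.coord R x k ∈ S) → x ^ m ∈ P) :
    P.relIndex ((Subgroup.pi Set.univ fun _ : Fin d => S).comap (s.coord R)) ≠ 0 ∧
      P.relIndex ((Subgroup.pi Set.univ fun _ : Fin d => S).comap (s.coord R)) ≤
        q ^ d * (t ^ d) ^ Fintype.card (L ≃ₐ[ℚ] L) := by
  let g : (L ≃ₐ[ℚ] L) → S →* S := fun σ =>
    ((galUnits R σ).comp S.subtype).codRestrict S fun u => hS σ u u.2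
  -- The twisted Galois action on `S^d`, whose fixed tuples are the coordinates of the points of
  -- `M(R)` that lie in `S`.
  let f : (L ≃ₐ[ℚ] L) → (Fin d → S) →* (Fin d → S) := fun σ =>
    (monoMap (s.galMat σ)).comp ((g σ).compLeft (Fin d))
  let j : (Fin d → S) →* (Fin d → (L ⊗[ℚ] R)ˣ) := S.subtype.compLeft (Fin d)
  have hj : Function.Injective j := fun u v h =>
    funext fun k => Subtype.ext (congrFun h k)
  have hjf : ∀ σ u, j (f σ u) = monoMap (s.galMat σ) fun k => galUnits R σ (j u k) := fun σ u =>
    map_monoMap S.subtype (s.galMat σ) fun k => g σ (u k)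
  let A : Subgroup (Fin d → S) := (s.coord R).range.comap j
  have hA : ∀ b, b ∈ A ↔ ∀ σ, f σ b = b := fun b => by
    rw [Subgroup.mem_comap, s.mem_range_coord]
    exact forall_congr' fun σ => by rw [← hjf, hj.eq_iff]
  have hpi := hB.pi d
  obtain ⟨h0, h1⟩ := relIndex_map_pow_fixed f A hA hpi.index_ne_zero hpi.index_le
    hpi.finite_ker hpi.card_ker_le
  have hmap : ((Subgroup.pi Set.univ fun _ : Fin d => S).comap (s.coord R)).map (s.coord R) =
      A.map j := by
    ext u
    constructor
    · rintro ⟨x, hx, rfl⟩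
      exact ⟨fun k => ⟨s.coord R x k, hx k trivial⟩, ⟨x, rfl⟩, rfl⟩
    · rintro ⟨b, ⟨x, hx⟩, rfl⟩
      refine ⟨x, fun k _ => ?_, hx⟩
      rw [hx]
      exact (b k).2
  have hle : (A.map (powMonoidHom m)).map j ≤ P.map (s.coord R) := by
    rintro _ ⟨_, ⟨b, ⟨x, hx⟩, rfl⟩, rfl⟩
    refine ⟨x ^ m, hP x fun k => ?_, ?_⟩
    · rw [hx]
      exact (b k).2
    · rw [map_pow, hx, powMonoidHom_apply, map_pow]
  rw [← Subgroup.relIndex_map_map_of_injective P _ (s.coord_injective R), hmap]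
  rw [← Subgroup.relIndex_map_map_of_injective _ A hj] at h0 h1
  have hdvd := Subgroup.relIndex_dvd_of_le_left (A.map j) hle
  exact ⟨fun h => h0 (Nat.eq_zero_of_zero_dvd (h ▸ hdvd)),
    (Nat.le_of_dvd (Nat.pos_of_ne_zero h0) hdvd).trans h1⟩

end Splitting

lemma galUnits_mem_integralUnits {L : Type} [Field L] [Algebra ℚ L] [FiniteDimensional ℚ L] {p : ℕ}
    [Fact p.Prime] (σ : L ≃ₐ[ℚ] L) {u : (L ⊗[ℚ] ℚ_[p])ˣ} (hu : u ∈ integralUnits L p) :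
    galUnits ℚ_[p] σ u ∈ integralUnits L p := by
  rw [mem_integralUnits] at hu ⊢
  intro τ
  rw [← hu (τ.comp σ.toAlgHom)]
  congr 1
  change locEmb τ (Algebra.TensorProduct.map σ.toAlgHom (AlgHom.id ℚ ℚ_[p]) (u : L ⊗[ℚ] ℚ_[p])) = _
  generalize (u : L ⊗[ℚ] ℚ_[p]) = y
  induction y with
  | zero => simp
  | add x y hx hy => rw [map_add, map_add, map_add, hx, hy]
  | tmul l x => simp

lemma PowBound.top {G : Type*} [CommGroup G] {m q t : ℕ} (h : PowBound G m q t) :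
    PowBound (⊤ : Subgroup G) m q t := by
  obtain ⟨h1, h2⟩ := card_ker_pow_le_of_injective (⊤ : Subgroup G).subtype
    Subtype.val_injective h.finite_ker h.card_ker_le
  have h3 := index_pow_congr (Subgroup.topEquiv (G := G)) m
  exact ⟨h3 ▸ h.index_ne_zero, h3 ▸ h.index_le, h1, h2⟩

lemma PowBound.mono {G : Type*} [CommGroup G] {m q t q' t' : ℕ} (h : PowBound G m q t)
    (hq : q ≤ q') (ht : t ≤ t') : PowBound G m q' t' :=
  ⟨h.index_ne_zero, h.index_le.trans hq, h.finite_ker, h.card_ker_le.trans ht⟩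

/-- A bound for the exponent of the cokernel of the reciprocity morphism. -/
def exponentBound (n C : ℕ) : ℕ := (n + 1) ^ n * (n.factorial * (C + 1) ^ n)

/-- A bound for the indices of the images of the reciprocity morphism. -/
def reciprocityBound (n C : ℕ) : ℕ :=
  (((exponentBound n C ^ 3) ^ (n + 1) ^ n * exponentBound n C ^ (n + 1) ^ n) ^ n) *
    ((exponentBound n C ^ (n + 1) ^ n) ^ n) ^ (n + 1) ^ n

lemma exponentBound_pos (n C : ℕ) : 0 < exponentBound n C := by
  unfold exponentBound
  positivity

lemma reciprocityBound_pos (n C : ℕ) : 0 < reciprocityBound n C := by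
  have := exponentBound_pos n C
  unfold reciprocityBound
  positivity

namespace Splitting

variable {n : ℕ} {M : AlgSubgroup n} {L : Type} [Field L] [Algebra ℚ L] {d : ℕ}
  (s : Splitting M L d) [FiniteDimensional ℚ L]

theorem reciprocity_index_le [IsGalois ℚ L]
    (hfix : ∀ σ : L ≃ₐ[ℚ] L, (∀ χ, (s.rep.proj χ).map σ = s.rep.proj χ) → σ = 1)
    (μ : Cocharacter L n) (a : Fin d → ℤ)
    (ha : ∀ (B : Type) [CommRing B] [Algebra L B] (t : Bˣ),
      μ.app B t = s.rep.app B (algebraMap L B) fun k => t ^ a k)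
    (r : ResHom L M)
    (hr : ∀ (R : Type) [CommRing R] [Algebra ℚ R] (t : (L ⊗[ℚ] R)ˣ),
      Matrix.GeneralLinearGroup.map
          (Algebra.TensorProduct.includeRight : R →ₐ[ℚ] L ⊗[ℚ] R).toRingHom
          (r.app R t : GL (Fin n) R) =
        galNorm R (μ.app (L ⊗[ℚ] R) t))
    (C : ℕ) (hC : ∀ w ∈ s.rep.weights, |w ⬝ᵥ a| ≤ C)
    (hsep : ∀ χ : Fin d → ℤ, (∀ σ, χ ⬝ᵥ (s.galMat σ).mulVec a = 0) → χ = 0)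
    (p : ℕ) [Fact p.Prime] :
    ((r.app ℚ_[p]).range.index ≠ 0 ∧ (r.app ℚ_[p]).range.index ≤ reciprocityBound n C) ∧
      ((integralUnits L p).map (r.app ℚ_[p]) ≤ maximalCompact M p ∧
        ((integralUnits L p).map (r.app ℚ_[p])).relIndex (maximalCompact M p) ≠ 0 ∧
        ((integralUnits L p).map (r.app ℚ_[p])).relIndex (maximalCompact M p) ≤
          reciprocityBound n C) := by
  obtain ⟨χ, m, hm, hmle, hχ⟩ := exists_equivariant_section s.galMat a s.rep.weights
    s.closure_weights C (fun w hw σ => by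
      rw [Matrix.dotProduct_mulVec]
      exact hC _ (s.vecMul_mem_weights σ hw)) hsep
  have hd : d ≤ n := s.rank_le
  have hcard : Fintype.card (L ≃ₐ[ℚ] L) ≤ (n + 1) ^ n := s.card_gal_le hfix
  have hrank : Module.finrank ℚ L ≤ (n + 1) ^ n := by
    rw [← IsGalois.card_aut_eq_finrank, Nat.card_eq_fintype_card]
    exact hcard
  -- The base `C + 1` is positive even for `C = 0`, so the exponent `d` can be raised to `n`.
  have hmN : m ≤ exponentBound n C := hmle.trans <| Nat.mul_le_mul hcard <|
    Nat.mul_le_mul (Nat.factorial_le hd) <| (Nat.pow_le_pow_left C.le_succ d).trans <|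
      Nat.pow_le_pow_right C.succ_pos hd
  have hN := exponentBound_pos n C
  have ht : m ^ Module.finrank ℚ L ≤ exponentBound n C ^ (n + 1) ^ n :=
    (Nat.pow_le_pow_left hmN _).trans (Nat.pow_le_pow_right hN hrank)
  have hq : (m ^ 3) ^ Module.finrank ℚ L ≤ (exponentBound n C ^ 3) ^ (n + 1) ^ n :=
    (Nat.pow_le_pow_left (Nat.pow_le_pow_left hmN 3) _).trans
      (Nat.pow_le_pow_right (pow_pos hN 3) hrank)
  have hbound : ((exponentBound n C ^ 3) ^ (n + 1) ^ n * exponentBound n C ^ (n + 1) ^ n) ^ d *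
      ((exponentBound n C ^ (n + 1) ^ n) ^ d) ^ Fintype.card (L ≃ₐ[ℚ] L) ≤
      reciprocityBound n C := by
    unfold reciprocityBound
    refine Nat.mul_le_mul (Nat.pow_le_pow_right (by positivity) hd) ?_
    exact (Nat.pow_le_pow_left (Nat.pow_le_pow_right (by positivity) hd) _).trans
      (Nat.pow_le_pow_right (by positivity) hcard)
  have hsection := fun x : M.points ℚ_[p] => s.reciprocity_section μ a ha r hr hχ x
  constructor
  · have h := s.relIndex_le_of_pow_mem ⊤ (fun _ _ _ => Subgroup.mem_top _)
      ((powBound_localUnits (L := L) (p := p) hm).top.mono (Nat.mul_le_mul hq ht) ht)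
      (r.app ℚ_[p]).range fun x _ => ⟨_, hsection x⟩
    rw [Subgroup.pi_top, Subgroup.comap_top, Subgroup.relIndex_top_right] at h
    exact ⟨h.1, h.2.trans hbound⟩
  · rw [s.maximalCompact_eq]
    refine ⟨?_, ?_⟩
    · rintro _ ⟨t, ht, rfl⟩
      rw [s.mem_integralPoints]
      intro k
      rw [s.coord_reciprocity μ a ha r hr, Finset.prod_apply]
      exact Subgroup.prod_mem _ fun σ _ => charVal_mem _ (s.galMat σ k) fun i =>
        Subgroup.zpow_mem _ (galUnits_mem_integralUnits σ ht) (a i)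
    -- For a point with integral coordinates the preimage `χ x` of `x ^ m` is itself an integral
    -- unit.
    · have h := s.relIndex_le_of_pow_mem (integralUnits L p)
        (fun σ _ hu => galUnits_mem_integralUnits σ hu)
        ((powBound_integralUnits (L := L) (p := p) hm).mono
          (hq.trans (Nat.le_mul_of_pos_right _ (pow_pos hN ((n + 1) ^ n)))) ht)
        ((integralUnits L p).map (r.app ℚ_[p])) fun x hx =>
          ⟨_, charVal_mem _ χ hx, hsection x⟩
      exact ⟨h.1, h.2.trans hbound⟩

end Splitting

end ShimuraTorus

theorem mainTheorem6 {n : ℕ} (G : ShimuraTorus.AlgSubgroup n)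
    (X : Set (ShimuraTorus.DeligneHom n)) (hGX : ShimuraTorus.IsAdjointShimuraDatum G X) :
    ∃ e : ℝ, 0 < e ∧
      ∀ h ∈ X, h.IsSpecial →
      ∀ (L : IntermediateField ℚ ℂ) [FiniteDimensional ℚ L],
        h.mumfordTate.IsSplittingField L →
      ∀ r : ShimuraTorus.ResHom L h.mumfordTate, ShimuraTorus.IsReciprocityMorphism h L r →
      ∀ (p : ℕ) [Fact p.Prime],
        ((r.app ℚ_[p]).range.FiniteIndex ∧ ((r.app ℚ_[p]).range.index : ℝ) ≤ e) ∧
        ((ShimuraTorus.integralUnits L p).map (r.app ℚ_[p]) ≤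
            ShimuraTorus.maximalCompact h.mumfordTate p ∧
          ((ShimuraTorus.integralUnits L p).map (r.app ℚ_[p])).IsFiniteRelIndex
            (ShimuraTorus.maximalCompact h.mumfordTate p) ∧
          (((ShimuraTorus.integralUnits L p).map (r.app ℚ_[p])).relIndex
            (ShimuraTorus.maximalCompact h.mumfordTate p) : ℝ) ≤ e) := by
  obtain ⟨h₀, -, hX⟩ := hGX.conjClass
  -- The constant comes from one base point of the conjugacy class, hence does not depend on `h`,
  -- `L` or `p`.
  obtain ⟨C, hC⟩ := ShimuraTorus.exists_weight_bound h₀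
  refine ⟨ShimuraTorus.reciprocityBound n C,
    by exact_mod_cast ShimuraTorus.reciprocityBound_pos n C, ?_⟩
  rintro h hh - L _ hL r ⟨μ, hμ, hr⟩ p _
  obtain ⟨g, -, hg⟩ := (hX h).mp hh
  haveI : IsGalois ℚ L := hL.isGalois
  obtain ⟨d, ⟨s⟩⟩ := hL.1.2.exists_splitting
  obtain ⟨a, ha⟩ := s.exists_cocharVec μ (ShimuraTorus.hodge_app_mem hμ)
  obtain ⟨⟨h1, h2⟩, h3, h4, h5⟩ := s.reciprocity_index_le (hL.eq_one_of_proj_fixed s) μ a ha r hr C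
    (hC h g hg L μ hμ d s.rep a ha)
    (fun _ hχ => ShimuraTorus.hodge_separating hL s hμ ha hχ) p
  exact ⟨⟨⟨h1⟩, by exact_mod_cast h2⟩, h3, ⟨h4⟩, by exact_mod_cast h5⟩
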